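/- Let $F$ be a local field of characteristic $0$ (that is, $\mathbb R$, $\mathbb C$, or a nonarchimedean local field of characteristic $0$), with normalized absolute value $|\cdot|$ (the modulus of Haar measure; so $|z|=z\bar z$ on $\mathbb C$), and let $\psi$ be a nontrivial continuous unitary additive character of $F$. For $1\le i\le 3$ let $V_i=F^{d_i}$ with $d_i$ even and $d_i>2$, let $Q_i$ be a nondegenerate quadratic form on $V_i$, and put $\langle x,y\rangle_i=Q_i(x+y)-Q_i(x)-Q_i(y)$. Let $V(F)=V_1\times V_2\times V_3$, $Q(u)=\sum_i Q_i(u_i)$, $\langle u,u'\rangle=\sum_i\langle u_i,u_i'\rangle_i$, and $$Y^{\mathrm{ani}}(F)=\{\xi\in V(F): Q_1(\xi_1)=Q_2(\xi_2)=Q_3(\xi_3)\neq 0\}.$$ For a vector $y\in F^n$ let $|y|=\max_j|y_j|$ (this is also used for $\xi_1\otimes\xi_2\otimes\xi_3\in V_1\otimes V_2\otimes V_3\cong F^{d_1d_2d_3}$), and for $y\ne0$ let $\widetilde y=\varpi^{\min_j\mathrm{ord}(y_j)}$ if $F$ is nonarchimedean, with $\varpi$ a fixed uniformizer, and $\widetilde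 y=|y|^{1/[F:\mathbb R]}$ if $F$ is archimedean. For $a\in(F^\times)^3$ and $v\in F^2$ write $$[a]=a_1a_2a_3,\qquad [\widetilde\xi]=\widetilde\xi_1\widetilde\xi_2\widetilde\xi_3,\qquad \frac{a\xi}{\widetilde\xi}=\left(\frac{a_i\xi_i}{\widetilde\xi_i}\right)_{i},\qquad \{a\}^{d/2-1}=\prod_{i=1}^3|a_i|^{d_i/2-1},$$ $$\mathfrak c(u,v)=v_1Q_1(u_1)+v_2Q_2(u_2)-(v_1+v_2)Q_3(u_3).$$ Let $dv$, $du$ and $d^\times a$ be given by fixed Haar measures on $F$, $V(F)$ and $F^\times$. **Theorem.** Let $0<\varepsilon<\tfrac12$. For every $f\in\mathcal S(V(F))$ (the space of locally constant compactly supported functions if $F$ is nonarchimedean, the usual Schwartz space if $F$ is archimedean) there is a constant $C>0$, depending only on $\varepsilon$, $f$ and the fixed data $F,\psi,\varpi,d_i,Q_i$ and the Haar measures, such that for all $b\in F$ and all $\xi\in Y^{\mathrm{ani}}(F)$ $$\int_{(F^\times)^3\times F^2}\left|\int_{V(F)}\psi\left(\left\langle\frac{a\xi}{\widetilde\xi},u\right\rangle+\frac{b[a]Q(u)}{9[\widetilde\xi]}+\mathfrak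 c(u,v)\right)f(u)\,du\right|\{a\}^{d/2-1}\,dv\,d^\times a\;\le\; C\,\min\left(1,\left|\frac{\xi_1\otimes\xi_2\otimes\xi_3}{b}\right|\right)^{\min(d_1,d_2,d_3)/2-1-\varepsilon},$$ where for $b=0$ the minimum is read as $1$. If $F$ is archimedean, then moreover, for each fixed $\varepsilon$, the constant $C=C(f)$ can be chosen to be a continuous function of $f\in\mathcal S(V(F))$. -/

import Mathlib

open MeasureTheory ValuativeRel
open scoped NNReal ENNReal SchwartzMap

namespace QuadraticTriple

noncomputable section

/-- The normalized absolute value `|x|` of a locally compact topological field: the factor by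
which multiplication by `x` scales Haar measure, and `|0| = 0`.  It is the usual absolute value
on `ℝ`, its square on `ℂ`, and sends a uniformizer to `q⁻¹` in the nonarchimedean case. -/
def nabs {F : Type*} [Field F] [TopologicalSpace F] [IsTopologicalRing F] [LocallyCompactSpace F]
    (x : F) : ℝ≥0 :=
  open scoped Classical in if h : x = 0 then 0 else distribHaarChar F (Units.mk0 x h)

/-- The box norm `max_j |y_j|` of a vector of `F^J`. -/
def boxNorm {F J : Type*} [Field F] [TopologicalSpace F] [IsTopologicalRing F]
    [LocallyCompactSpace F] [Fintype J] (y : J → F) : ℝ≥0 :=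
  Finset.univ.sup fun j => nabs (y j)

/-- The coordinates of the tensor `ξ₁ ⊗ ξ₂ ⊗ ξ₃` of `V₁ ⊗ V₂ ⊗ V₃` in the basis of pure tensors of
standard basis vectors. -/
def tensorCoords {F : Type*} [Field F] {d : Fin 3 → ℕ} (ξ : (i : Fin 3) → Fin (d i) → F) :
    ((i : Fin 3) → Fin (d i)) → F :=
  fun j => ∏ i, ξ i (j i)

/-- The `F`-points of the anisotropic locus of `Q₁(ξ₁) = Q₂(ξ₂) = Q₃(ξ₃)`. -/
def Yani {F : Type*} [Field F] {d : Fin 3 → ℕ}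
    (Q : (i : Fin 3) → QuadraticForm F (Fin (d i) → F)) : Set ((i : Fin 3) → Fin (d i) → F) :=
  {ξ | Q 0 (ξ 0) = Q 1 (ξ 1) ∧ Q 1 (ξ 1) = Q 2 (ξ 2) ∧ Q 0 (ξ 0) ≠ 0}

/-- The argument of `ψ`, for given scalars `t₁, t₂, t₃` in the role of the `ξ̃ᵢ`:
`∑ᵢ ⟨(aᵢ / tᵢ) ξᵢ, uᵢ⟩ᵢ + b a₁ a₂ a₃ (∑ᵢ Qᵢ(uᵢ)) / (9 t₁ t₂ t₃)
+ v₁ Q₁(u₁) + v₂ Q₂(u₂) - (v₁ + v₂) Q₃(u₃)`,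
where `⟨x, y⟩ᵢ = Qᵢ(x + y) - Qᵢ(x) - Qᵢ(y)`. -/
def phase {F : Type*} [Field F] {d : Fin 3 → ℕ}
    (Q : (i : Fin 3) → QuadraticForm F (Fin (d i) → F)) (t : Fin 3 → F)
    (ξ : (i : Fin 3) → Fin (d i) → F) (b : F) (a : Fin 3 → Fˣ) (v : F × F)
    (u : (i : Fin 3) → Fin (d i) → F) : F :=
  ∑ i, QuadraticMap.polar (Q i) (((a i : F) / t i) • ξ i) (u i)
    + b * (∏ i, (a i : F)) * (∑ i, Q i (u i)) / (9 * ∏ i, t i)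
    + (v.1 * Q 0 (u 0) + v.2 * Q 1 (u 1) - (v.1 + v.2) * Q 2 (u 2))

/-- The integral over `(F^×)³ × F²`, against `|a₁|^{d₁/2-1} |a₂|^{d₂/2-1} |a₃|^{d₃/2-1} d^×a dv`, of
the absolute value of the oscillatory integral `∫_V ψ(phase) f(u) du`.  Here `μ`, `ν`, `μV` are the
measures on `F`, `F^×` and `V = V₁ × V₂ × V₃`. -/
def absIntegral {F : Type*} [Field F] [TopologicalSpace F] [IsTopologicalRing F]
    [LocallyCompactSpace F] [MeasurableSpace F] {d : Fin 3 → ℕ}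
    (μ : Measure F) (ν : Measure Fˣ) (μV : Measure ((i : Fin 3) → Fin (d i) → F))
    (ψ : AddChar F Circle) (Q : (i : Fin 3) → QuadraticForm F (Fin (d i) → F))
    (f : ((i : Fin 3) → Fin (d i) → F) → ℂ) (t : Fin 3 → F) (b : F)
    (ξ : (i : Fin 3) → Fin (d i) → F) : ℝ≥0∞ :=
  ∫⁻ p : (Fin 3 → Fˣ) × (F × F),
    ‖∫ u, (ψ (phase Q t ξ b p.1 p.2 u) : ℂ) * f u ∂μV‖ₑ
      * ∏ i, (nabs (p.1 i : F) : ℝ≥0∞) ^ ((d i : ℝ) / 2 - 1)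
    ∂((Measure.pi fun _ : Fin 3 => ν).prod (μ.prod μ))

/-- `min(1, |ξ₁ ⊗ ξ₂ ⊗ ξ₃| / |b|)^{min(d₁,d₂,d₃)/2 - 1 - ε}`; for `b = 0` and `ξᵢ ≠ 0` the quotient
is `∞`, and the minimum is `1`. -/
def decayBound {F : Type*} [Field F] [TopologicalSpace F] [IsTopologicalRing F]
    [LocallyCompactSpace F] {d : Fin 3 → ℕ} (ε : ℝ) (b : F)
    (ξ : (i : Fin 3) → Fin (d i) → F) : ℝ≥0∞ :=
  (min 1 ((boxNorm (tensorCoords ξ) : ℝ≥0∞) / (nabs b : ℝ≥0∞)))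
    ^ (((min (d 0) (min (d 1) (d 2)) : ℕ) : ℝ) / 2 - 1 - ε)

/-- `ord(y) = min_j ord(y_j)` for a nonzero vector `y` over a nonarchimedean local field
(the normalized valuation of `x` being `exp (-ord x)`). -/
def ordVec {F J : Type*} [Field F] [ValuativeRel F] [TopologicalSpace F]
    [IsNonarchimedeanLocalField F] [Fintype J] (y : J → F) : ℤ :=
  -(IsNonarchimedeanLocalField.valueGroupWithZeroIsoInt F
      (Finset.univ.sup fun j => valuation F (y j))).log

/-- `ỹ = ϖ^{ord(y)}`, for nonarchimedean `F` with a chosen uniformizer `ϖ`. -/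
def tildeNonarch {F J : Type*} [Field F] [ValuativeRel F] [TopologicalSpace F]
    [IsNonarchimedeanLocalField F] [Fintype J] (ϖ : F) (y : J → F) : F :=
  ϖ ^ ordVec y

/-- `ỹ = |y|^{1/[F : ℝ]}`, for `F` equal to `ℝ` or `ℂ`. -/
def tildeArch {F J : Type*} [RCLike F] [Fintype J] (y : J → F) : F :=
  (((boxNorm y : ℝ) ^ (1 / (Module.finrank ℝ F : ℝ)) : ℝ) : F)

end

end QuadraticTriple

/-! The proof bounds the inner integral pointwise and then integrates the bound.

Inner integral. The phase has the form `∑ ⟨xᵢ, uᵢ⟩ᵢ + ∑ wᵢ Qᵢ(uᵢ)`, and the integral is `O(∏ max(1,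
|xᵢ|, |wᵢ|)^(-dᵢ/2))` (`HasOscillatoryDecay`). Neither Gaussian Fourier transforms nor completion of
squares is needed. Weyl differencing bounds the squared integral by `∫ |K(h)| dh`, where `K` is the
autocorrelation of `f` twisted by a character linear in `u` with frequencies `wᵢ hᵢ`. Since `f` is a
test function, `K` is concentrated where `max(1, |wᵢ|) |hᵢ|` is bounded, a region of volume `∏
max(1, |wᵢ|)^(-dᵢ)`; the square root gives the decay in `w`. For `|xᵢ|` much larger than `max(1,
|wᵢ|)` the phase has no critical point on the bulk of `f`, and the integral vanishes (nonarchimedean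
case, by translation invariance of `f`) or decays rapidly (archimedean case, by integration by
parts). In the archimedean case every step costs finitely many continuous operators on Schwartz
space, which gives constants continuous in `f`.

Outer integral. Here `|xᵢ| = |aᵢ|`, and `w₁, w₂, w₃` are `B[a] + v₁`, `B[a] + v₂`, `B[a] - v₁ - v₂`
with `B = b / (9[ξ̃])`. Their sum is `3B[a]`, so the largest satisfies `|B| |a₁a₂a₃| ≤ C |wᵢ|`.
Spending a power `δ` of its decay yields `|B|^(-δ)` and lowers the powers of the `|aⱼ|` by `δ`; what
remains converges for `δ < min dⱼ/2 - 1`. The other two `wⱼ` serve as coordinates on the `v`-plane.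
Their own decay may be too slow to be integrable, so part of the decay in the largest is lent to
them (`kernel_le_separated`). The exponent `δ = 0` gives the bound `1`, and `δ = min dⱼ/2 - 1 - ε`
gives the power of `|ξ₁ ⊗ ξ₂ ⊗ ξ₃| / |b|`, because `|[ξ̃]| = |ξ₁ ⊗ ξ₂ ⊗ ξ₃|`. -/

namespace QuadraticTriple

/-! ### Normalized absolute value and box norms. -/

section NormalizedAbs

variable {F : Type*} [Field F] [TopologicalSpace F] [IsTopologicalRing F] [LocallyCompactSpace F]

lemma nabs_zero : nabs (0 : F) = 0 := by simp [nabs]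

lemma nabs_of_ne_zero {x : F} (h : x ≠ 0) : nabs x = distribHaarChar F (Units.mk0 x h) := by
  simp [nabs, h]

lemma nabs_units (a : Fˣ) : nabs (a : F) = distribHaarChar F a := by
  rw [nabs_of_ne_zero a.ne_zero]; congr; ext; rfl

lemma nabs_pos {x : F} (h : x ≠ 0) : 0 < nabs x := by
  rw [nabs_of_ne_zero h]; exact distribHaarChar_pos

/-- The normalized absolute value as a multiplicative homomorphism. -/
noncomputable def nabsHom (F : Type*) [Field F] [TopologicalSpace F] [IsTopologicalRing F]
    [LocallyCompactSpace F] : F →*₀ ℝ≥0 where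
  toFun := nabs
  map_zero' := nabs_zero
  map_one' := by rw [← Units.val_one, nabs_units, map_one]
  map_mul' x y := by
    rcases eq_or_ne x 0 with rfl | hx
    · simp [nabs_zero]
    rcases eq_or_ne y 0 with rfl | hy
    · simp [nabs_zero]
    have := nabs_units (Units.mk0 x hx * Units.mk0 y hy)
    rw [map_mul, ← nabs_of_ne_zero, ← nabs_of_ne_zero] at this
    simpa using this

lemma nabs_one : nabs (1 : F) = 1 := map_one (nabsHom F)
lemma nabs_mul (x y : F) : nabs (x * y) = nabs x * nabs y := map_mul (nabsHom F) x y
lemma nabs_div (x y : F) : nabs (x / y) = nabs x / nabs y := map_div₀ (nabsHom F) x y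
lemma nabs_inv (x : F) : nabs x⁻¹ = (nabs x)⁻¹ := map_inv₀ (nabsHom F) x
lemma nabs_pow (x : F) (n : ℕ) : nabs (x ^ n) = nabs x ^ n := map_pow (nabsHom F) x n
lemma nabs_zpow (x : F) (n : ℤ) : nabs (x ^ n) = nabs x ^ n := map_zpow₀ (nabsHom F) x n
lemma nabs_prod {ι : Type*} (s : Finset ι) (x : ι → F) :
    nabs (∏ i ∈ s, x i) = ∏ i ∈ s, nabs (x i) := map_prod (nabsHom F) x s
lemma nabs_eq_zero {x : F} : nabs x = 0 ↔ x = 0 := map_eq_zero (nabsHom F)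

lemma nabs_neg (x : F) : nabs (-x) = nabs x := by
  have h : nabs (-1 : F) ^ 2 = 1 := by rw [← nabs_pow]; simp [nabs_one]
  have h1 : nabs (-1 : F) = 1 := (pow_eq_one_iff_of_nonneg zero_le two_ne_zero).1 h
  rw [neg_eq_neg_one_mul, nabs_mul, h1, one_mul]

lemma nabs_le_boxNorm {J : Type*} [Fintype J] (y : J → F) (j : J) : nabs (y j) ≤ boxNorm y :=
  Finset.le_sup (f := fun j => nabs (y j)) (Finset.mem_univ j)

lemma boxNorm_le_iff {J : Type*} [Fintype J] {y : J → F} {r : ℝ≥0} :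
    boxNorm y ≤ r ↔ ∀ j, nabs (y j) ≤ r := by
  simp [boxNorm]

lemma boxNorm_pos {J : Type*} [Fintype J] {y : J → F} (h : y ≠ 0) : 0 < boxNorm y := by
  obtain ⟨j, hj⟩ := Function.ne_iff.1 h
  exact (nabs_pos hj).trans_le (nabs_le_boxNorm y j)

lemma boxNorm_zero {J : Type*} [Fintype J] : boxNorm (0 : J → F) = 0 :=
  le_antisymm (boxNorm_le_iff.2 fun j => by simp [nabs_zero]) zero_le

lemma boxNorm_smul {J : Type*} [Fintype J] (c : F) (y : J → F) :
    boxNorm (c • y) = nabs c * boxNorm y := by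
  simp only [boxNorm, NNReal.mul_finset_sup, Pi.smul_apply, smul_eq_mul, nabs_mul]

lemma exists_nabs_eq_boxNorm {J : Type*} [Fintype J] [Nonempty J] (y : J → F) :
    ∃ j, nabs (y j) = boxNorm y := by
  obtain ⟨j, -, hj⟩ := Finset.exists_mem_eq_sup Finset.univ Finset.univ_nonempty
    (fun j => nabs (y j))
  exact ⟨j, hj.symm⟩

/-- Indices maximizing each factor separately maximize the product of coordinates. -/
lemma boxNorm_tensorCoords {d : Fin 3 → ℕ} (hd : ∀ i, 0 < d i)
    (ξ : (i : Fin 3) → Fin (d i) → F) : boxNorm (tensorCoords ξ) = ∏ i, boxNorm (ξ i) := by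
  have := fun i => Fin.pos_iff_nonempty.1 (hd i)
  refine le_antisymm (boxNorm_le_iff.2 fun j => ?_) ?_
  · rw [tensorCoords, nabs_prod]
    exact Finset.prod_le_prod' fun i _ => nabs_le_boxNorm _ _
  · choose j hj using fun i => exists_nabs_eq_boxNorm (ξ i)
    simp_rw [← hj, ← nabs_prod]
    exact nabs_le_boxNorm (tensorCoords ξ) j

end NormalizedAbs

/-- The properties of the normalized absolute value of a local field used in the estimates. -/
structure IsLocalModulus (F : Type*) [Field F] [TopologicalSpace F] [IsTopologicalRing F]
    [LocallyCompactSpace F] : Prop where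
  continuous : Continuous (nabs : F → ℝ≥0)
  isCompact : IsCompact {x : F | nabs x ≤ 1}
  quasi : ∃ C : ℝ≥0, ∀ x y : F, nabs (x + y) ≤ C * max (nabs x) (nabs y)
  exists_lt_one : ∃ ϖ : F, ϖ ≠ 0 ∧ nabs ϖ < 1

/-! ### Volumes of balls and convergence of integrals over `F`. -/

section Measure

variable {F : Type*} [Field F] [TopologicalSpace F] [IsTopologicalRing F] [LocallyCompactSpace F]
  [T2Space F] [SecondCountableTopology F] [MeasurableSpace F] [BorelSpace F]

lemma measure_nabs_le_mul (μ : Measure F) [μ.IsAddHaarMeasure] {x : F} (hx : x ≠ 0) (r : ℝ≥0) :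
    μ {y | nabs y ≤ nabs x * r} = nabs x * μ {y | nabs y ≤ r} := by
  have := TopologicalSpace.metrizableSpace_of_t3_secondCountable F
  rw [nabs_of_ne_zero hx, distribHaarChar_mul, ← nabs_of_ne_zero hx]
  congr 1
  ext y
  simp only [Set.mem_ofPred_eq, Set.mem_smul_set, Units.smul_def, Units.val_mk0, smul_eq_mul]
  constructor
  · intro h
    refine ⟨x⁻¹ * y, ?_, by field_simp⟩
    rw [nabs_mul, nabs_inv]
    exact (inv_mul_le_iff₀ (nabs_pos hx)).2 h
  · rintro ⟨z, hz, rfl⟩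
    rw [nabs_mul]
    gcongr

variable (hF : IsLocalModulus F)
include hF

omit [T2Space F] [SecondCountableTopology F] [MeasurableSpace F] [BorelSpace F] in
lemma IsLocalModulus.isCompact_le (r : ℝ≥0) : IsCompact {x : F | nabs x ≤ r} := by
  obtain ⟨ϖ, h0, h1⟩ := hF.exists_lt_one
  obtain ⟨n, hn⟩ : ∃ n : ℕ, r * nabs ϖ ^ n ≤ 1 := by
    rcases eq_or_ne r 0 with rfl | hr
    · exact ⟨0, by simp⟩
    obtain ⟨n, hn⟩ := exists_pow_lt_of_lt_one (inv_pos.2 (pos_iff_ne_zero.2 hr)) h1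
    refine ⟨n, ?_⟩
    rw [mul_comm]
    exact (le_mul_inv_iff₀ (pos_iff_ne_zero.2 hr)).1 (by simpa using hn.le)
  refine (hF.isCompact.image (continuous_const_mul ((ϖ ^ n)⁻¹))).of_isClosed_subset
    (isClosed_le hF.continuous continuous_const) fun x hx => ⟨ϖ ^ n * x, ?_, ?_⟩
  · simp only [Set.mem_ofPred_eq, nabs_mul, nabs_pow] at hx ⊢
    exact (mul_le_mul_right hx _).trans (by rwa [mul_comm])
  · field_simp

omit [T2Space F] [SecondCountableTopology F] in
lemma IsLocalModulus.measurable : Measurable (nabs : F → ℝ≥0) := hF.continuous.measurable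

/-- The values of `nabs` need not fill the half-line, so `r` is rounded up to a power of `|ϖ|⁻¹`,
where exact scaling applies; the rounding costs the factor `|ϖ|⁻¹`. -/
lemma IsLocalModulus.measure_le (μ : Measure F) [μ.IsAddHaarMeasure] :
    ∃ C : ℝ≥0, ∀ r : ℝ≥0, 0 < r → μ {y | nabs y ≤ r} ≤ C * r := by
  obtain ⟨ϖ, h0, h1⟩ := hF.exists_lt_one
  have hq := nabs_pos h0
  lift μ {y : F | nabs y ≤ 1} to ℝ≥0 using hF.isCompact.measure_lt_top.ne with A hA
  refine ⟨A * (nabs ϖ)⁻¹, fun r hr => ?_⟩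
  obtain ⟨n, hn1, hn2⟩ := exists_mem_Ioc_zpow hr (one_lt_inv₀ hq |>.2 h1)
  have hz : (ϖ⁻¹ ^ (n + 1)) ≠ 0 := zpow_ne_zero _ (inv_ne_zero h0)
  have hnz : nabs (ϖ⁻¹ ^ (n + 1)) = (nabs ϖ)⁻¹ ^ (n + 1) := by rw [nabs_zpow, nabs_inv]
  calc μ {y | nabs y ≤ r} ≤ μ {y | nabs y ≤ nabs (ϖ⁻¹ ^ (n + 1)) * 1} :=
        by
        refine measure_mono fun y hy => ?_
        rw [Set.mem_ofPred_eq] at hy ⊢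
        rw [hnz, mul_one]
        exact hy.trans hn2
    _ = ((nabs ϖ)⁻¹ ^ (n + 1) * A : ℝ≥0) := by
        rw [measure_nabs_le_mul μ hz, hnz, ← hA, ENNReal.coe_mul]
    _ ≤ _ := by
        rw [zpow_add_one₀ (inv_pos.2 hq).ne']
        norm_cast
        calc (nabs ϖ)⁻¹ ^ n * (nabs ϖ)⁻¹ * A ≤ r * (nabs ϖ)⁻¹ * A := by gcongr
          _ = _ := by ring

/-- The integrand is dominated by the balls of radius `q⁻¹ ^ (n + 1)` with weights `(q ^ n) ^ (1 +
η)`. The volume of a ball is at most linear in its radius, leaving a geometric series of ratio `q ^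
η`. -/
lemma IsLocalModulus.lintegral_max_one_rpow_lt_top (μ : Measure F) [μ.IsAddHaarMeasure] {η : ℝ}
    (hη : 0 < η) : ∫⁻ w, ((max 1 (nabs w) ^ (-(1 + η)) : ℝ≥0) : ℝ≥0∞) ∂μ < ⊤ := by
  obtain ⟨ϖ, h0, h1⟩ := hF.exists_lt_one
  obtain ⟨C, hC⟩ := hF.measure_le μ
  set q := nabs ϖ with hqdef
  have hq : 0 < q := nabs_pos h0
  have hr : q ^ η < 1 := NNReal.rpow_lt_one h1 hη
  have hmeas : ∀ n : ℕ, MeasurableSet {w : F | nabs w ≤ q⁻¹ ^ (n + 1)} := fun n =>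
    hF.measurable measurableSet_Iic
  calc ∫⁻ w, ((max 1 (nabs w) ^ (-(1 + η)) : ℝ≥0) : ℝ≥0∞) ∂μ
      ≤ ∫⁻ w, ∑' n : ℕ, {w : F | nabs w ≤ q⁻¹ ^ (n + 1)}.indicator
          (fun _ => (((q ^ n) ^ (1 + η) : ℝ≥0) : ℝ≥0∞)) w ∂μ := by
        refine lintegral_mono fun w => ?_
        rcases le_or_gt (nabs w) 1 with h | h
        · refine le_trans ?_ (ENNReal.le_tsum 0)
          rw [Set.indicator_of_mem]
          · simp [h]
          · simpa using h.trans (one_le_inv₀ hq |>.2 h1.le)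
        · obtain ⟨n, hn1, hn2⟩ := exists_nat_pow_near_of_lt_one (inv_pos.2 (one_pos.trans h))
            (inv_le_one_of_one_le₀ h.le) hq h1
          refine le_trans ?_ (ENNReal.le_tsum n)
          rw [Set.indicator_of_mem]
          · rw [max_eq_right h.le, NNReal.rpow_neg, ← NNReal.inv_rpow]
            norm_cast
            gcongr
          · simpa [inv_pow] using (lt_inv_comm₀ (pow_pos hq _) (one_pos.trans h)).1 hn1 |>.le
    _ = ∑' n : ℕ, (((q ^ n) ^ (1 + η) : ℝ≥0) : ℝ≥0∞) * μ {w : F | nabs w ≤ q⁻¹ ^ (n + 1)} := by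
        rw [lintegral_tsum fun n => (measurable_const.indicator (hmeas n)).aemeasurable]
        simp_rw [lintegral_indicator_const (hmeas _)]
    _ ≤ ∑' n : ℕ, ((C * q⁻¹ : ℝ≥0) : ℝ≥0∞) * ((q ^ η : ℝ≥0) : ℝ≥0∞) ^ n := by
        refine ENNReal.tsum_le_tsum fun n => ?_
        refine (mul_le_mul_right (hC _ (pow_pos (inv_pos.2 hq) _)) _).trans ?_
        norm_cast
        apply le_of_eq
        have e : (q ^ n) ^ η = (q ^ η) ^ n := by
          rw [← NNReal.rpow_natCast, ← NNReal.rpow_mul, ← NNReal.rpow_natCast, ← NNReal.rpow_mul,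
            mul_comm]
        rw [NNReal.rpow_add (pow_pos hq _).ne', NNReal.rpow_one, e, pow_succ]
        have : q ^ n * q⁻¹ ^ n = 1 := by rw [← mul_pow, mul_inv_cancel₀ hq.ne', one_pow]
        calc _ = C * q⁻¹ * (q ^ η) ^ n * (q ^ n * q⁻¹ ^ n) := by ring
          _ = _ := by rw [this, mul_one]
    _ < ⊤ := by
        rw [ENNReal.tsum_mul_left, ENNReal.tsum_geometric]
        refine ENNReal.mul_lt_top ENNReal.coe_lt_top ?_
        rw [ENNReal.inv_lt_top, tsub_pos_iff_lt]
        exact_mod_cast hr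

end Measure

/-! ### Integration over the multiplicative group. -/

section Units

variable {F : Type*} [Field F] [TopologicalSpace F] [IsTopologicalRing F] [LocallyCompactSpace F]
  [T2Space F] [SecondCountableTopology F] [ContinuousInv₀ F] [MeasurableSpace F] [BorelSpace F]

omit [IsTopologicalRing F] [LocallyCompactSpace F] [T2Space F] [MeasurableSpace F]
  [BorelSpace F] in
lemma secondCountableTopology_units : SecondCountableTopology Fˣ :=
  Units.isEmbedding_val₀.secondCountableTopology

omit [IsTopologicalRing F] [LocallyCompactSpace F] [T2Space F] [SecondCountableTopology F] in
lemma borelSpace_units : BorelSpace Fˣ where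
  measurable_eq := by
    rw [Units.instMeasurableSpace, BorelSpace.measurable_eq (α := F),
      Units.isEmbedding_val₀.eq_induced, borel_comap]

omit [BorelSpace F] in
lemma sigmaFinite_haar_units (ν : Measure Fˣ) [ν.IsHaarMeasure] : SigmaFinite ν := by
  have : SecondCountableTopology Fˣ := secondCountableTopology_units
  infer_instance

variable (hF : IsLocalModulus F)
include hF

omit [SecondCountableTopology F] [ContinuousInv₀ F] [MeasurableSpace F] [BorelSpace F] in
-- The topology of `Fˣ` comes from `a ↦ (a, a⁻¹)`, so compactness needs the lower bound too: it
-- confines the inverse to a compact ball.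
lemma IsLocalModulus.isCompact_shell (r s : ℝ≥0) (hr : 0 < r) :
    IsCompact {a : Fˣ | r ≤ nabs (a : F) ∧ nabs (a : F) ≤ s} := by
  have h := Units.isClosedEmbedding_embedProduct (α := F)
  have hK := (hF.isCompact_le s).prod
    ((hF.isCompact_le r⁻¹).image MulOpposite.continuous_op)
  convert h.isCompact_preimage hK using 1
  ext a
  simp only [Set.mem_ofPred_eq, Set.mem_preimage, Set.mem_prod, Units.embedProduct_apply,
    Set.mem_image, MulOpposite.op_inj, exists_eq_right, Units.val_inv_eq_inv_val, nabs_inv]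
  rw [inv_le_inv₀ (nabs_pos a.ne_zero) hr, and_comm]

/-- The shells `q ^ (n + 1) ≤ |a| ≤ q ^ n` are translates of one another by powers of `ϖ`, hence of
equal Haar measure. The integrand is `|a| ^ s` near zero and `|a| ^ (-η)` near infinity, so the sum
over shells is dominated by a geometric series. -/
lemma IsLocalModulus.lintegral_units_lt_top (ν : Measure Fˣ) [ν.IsHaarMeasure] {s η : ℝ}
    (hs : 0 < s) (hη : 0 < η) :
    ∫⁻ a : Fˣ, ((nabs (a : F) ^ s * max 1 (nabs (a : F)) ^ (-(s + η)) : ℝ≥0) : ℝ≥0∞) ∂ν < ⊤ := by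
  have : BorelSpace Fˣ := borelSpace_units
  have : SecondCountableTopology Fˣ := secondCountableTopology_units
  obtain ⟨ϖ, h0, h1⟩ := hF.exists_lt_one
  set q := nabs ϖ with hqdef
  have hq : 0 < q := nabs_pos h0
  -- The slower of the two rates of decay, so that a shell near zero and its mirror image near
  -- infinity share one weight.
  set σ := min s η with hσ
  have hrpow : ∀ n : ℕ, (q ^ n) ^ σ = (q ^ σ) ^ n := fun n => by
    rw [← NNReal.rpow_natCast, ← NNReal.rpow_mul, ← NNReal.rpow_natCast, ← NNReal.rpow_mul,
      mul_comm]
  have hσ0 : 0 < σ := lt_min hs hη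
  let A : ℤ → Set Fˣ := fun n => {a : Fˣ | q ^ (n + 1) ≤ nabs (a : F) ∧ nabs (a : F) ≤ q ^ n}
  have hA : ∀ n, IsCompact (A n) := fun n => hF.isCompact_shell _ _ (zpow_pos hq _)
  have hνA : ∀ n, ν (A n) = ν (A 0) := by
    intro n
    rw [← measure_preimage_mul ν ((Units.mk0 ϖ h0) ^ n) (A n)]
    congr 1
    ext a
    simp only [A, Set.mem_preimage, Set.mem_ofPred_eq, Units.val_mul, Units.val_zpow_eq_zpow_val,
      Units.val_mk0, nabs_mul, nabs_zpow, ← hqdef, zpow_add₀ hq.ne', zpow_zero, one_mul]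
    rw [mul_le_mul_iff_right₀ (zpow_pos hq n)]
    refine and_congr Iff.rfl ?_
    exact mul_le_iff_le_one_right (zpow_pos hq n)
  calc _ ≤ ∫⁻ a : Fˣ, ∑' n : ℕ, (A n ∪ A (-n - 1)).indicator
          (fun _ => ((q ^ σ : ℝ≥0) : ℝ≥0∞) ^ n) a ∂ν := by
        refine lintegral_mono fun a => ?_
        set t := nabs (a : F)
        have ht : 0 < t := nabs_pos a.ne_zero
        rcases le_or_gt t 1 with h | h
        · obtain ⟨n, hn1, hn2⟩ := exists_nat_pow_near_of_lt_one ht h hq h1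
          refine le_trans ?_ (ENNReal.le_tsum n)
          rw [Set.indicator_of_mem]
          · rw [← ENNReal.coe_pow, ENNReal.coe_le_coe]
            rw [max_eq_left h, NNReal.one_rpow, mul_one]
            calc t ^ s ≤ t ^ σ := NNReal.rpow_le_rpow_of_exponent_ge ht h (min_le_left _ _)
              _ ≤ (q ^ n) ^ σ := by gcongr
              _ = _ := hrpow n
          · exact Or.inl ⟨by exact_mod_cast hn1.le, by exact_mod_cast hn2⟩
        · obtain ⟨n, hn1, hn2⟩ := exists_nat_pow_near_of_lt_one (inv_pos.2 ht)
            (inv_le_one_of_one_le₀ h.le) hq h1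
          refine le_trans ?_ (ENNReal.le_tsum n)
          rw [Set.indicator_of_mem]
          · rw [← ENNReal.coe_pow, ENNReal.coe_le_coe]
            rw [max_eq_right h.le, ← NNReal.rpow_add ht.ne']
            have e1 : s + -(s + η) = -η := by ring
            rw [e1, NNReal.rpow_neg, ← NNReal.inv_rpow]
            calc t⁻¹ ^ η ≤ t⁻¹ ^ σ := NNReal.rpow_le_rpow_of_exponent_ge (inv_pos.2 ht)
                  (inv_le_one_of_one_le₀ h.le) (min_le_right _ _)
              _ ≤ (q ^ n) ^ σ := by gcongr
              _ = _ := hrpow n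
          · refine Or.inr ⟨?_, ?_⟩
            · rw [sub_add_cancel, zpow_neg, zpow_natCast]
              exact (inv_le_comm₀ ht (pow_pos hq _)).1 hn2
            · have e : (-(n : ℤ) - 1) = -((n + 1 : ℕ) : ℤ) := by push_cast; ring
              rw [e, zpow_neg, zpow_natCast]
              exact ((lt_inv_comm₀ (pow_pos hq _) ht).1 hn1).le
    _ = ∑' n : ℕ, ((q ^ σ : ℝ≥0) : ℝ≥0∞) ^ n * ν (A n ∪ A (-n - 1)) := by
        have hm : ∀ n : ℕ, MeasurableSet (A n ∪ A (-n - 1)) := fun n =>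
          (hA _).measurableSet.union (hA _).measurableSet
        rw [lintegral_tsum fun n => (measurable_const.indicator (hm n)).aemeasurable]
        simp_rw [lintegral_indicator_const (hm _)]
    _ ≤ ∑' n : ℕ, ((q ^ σ : ℝ≥0) : ℝ≥0∞) ^ n * (ν (A 0) + ν (A 0)) := by
        refine ENNReal.tsum_le_tsum fun n => ?_
        gcongr
        refine (measure_union_le _ _).trans ?_
        rw [hνA n, hνA (-n - 1)]
    _ < ⊤ := by
        rw [ENNReal.tsum_mul_right, ENNReal.tsum_geometric]
        refine ENNReal.mul_lt_top ?_
          (ENNReal.add_lt_top.2 ⟨(hA 0).measure_lt_top, (hA 0).measure_lt_top⟩)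
        rw [ENNReal.inv_lt_top, tsub_pos_iff_lt]
        exact_mod_cast NNReal.rpow_lt_one h1 hσ0

end Units

/-! ### The majorant integral over `(Fˣ)³ × F²`. -/

lemma lintegral_pi_fin_prod {n : ℕ} {E : Fin n → Type*} [∀ i, MeasurableSpace (E i)]
    (μ : (i : Fin n) → Measure (E i)) [∀ i, SigmaFinite (μ i)] {f : (i : Fin n) → E i → ℝ≥0∞}
    (hf : ∀ i, Measurable (f i)) :
    ∫⁻ x, ∏ i, f i (x i) ∂(Measure.pi μ) = ∏ i, ∫⁻ x, f i x ∂(μ i) := by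
  induction n with
  | zero => simp
  | succ n ih =>
    rw [Fin.prod_univ_succ, ← ih (fun i => μ i.succ) (fun i => hf i.succ),
      ← lintegral_prod_mul (hf 0).aemeasurable
        (Finset.measurable_fun_prod _ fun i _ =>
          (hf i.succ).comp (measurable_pi_apply i)).aemeasurable,
      ← ((measurePreserving_piFinSuccAbove μ 0).symm).lintegral_comp_emb
        (MeasurableEquiv.measurableEmbedding _)]
    simp_rw [MeasurableEquiv.piFinSuccAbove_symm_apply, Fin.insertNthEquiv, Fin.prod_univ_succ]
    rfl

/-- The coefficients of `Q₁, Q₂, Q₃` in `β (Q₁ + Q₂ + Q₃) + v₁ Q₁ + v₂ Q₂ - (v₁ + v₂) Q₃`. -/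
def quadCoeff {F : Type*} [Ring F] (β : F) (v : F × F) : Fin 3 → F :=
  ![β + v.1, β + v.2, β - (v.1 + v.2)]

lemma rpow_neg_le_rpow_neg {x y : ℝ≥0} (hx : 1 ≤ x) (hxy : x ≤ y) {s : ℝ} (hs : 0 ≤ s) :
    y ^ (-s) ≤ x ^ (-s) := by
  rw [NNReal.rpow_neg, NNReal.rpow_neg]
  exact inv_anti₀ (NNReal.rpow_pos (one_pos.trans_le hx)) (NNReal.rpow_le_rpow hxy hs)

/-- The pointwise estimate that separates the variables: the largest of the `W i` is traded for
decay in the other two and for a power of `N`. -/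
lemma kernel_le_separated {κ : Fin 3 → ℝ} {δ : ℝ} (hδ0 : 0 ≤ δ) (hδ : ∀ i, δ < κ i - 1)
    (A W : Fin 3 → ℝ≥0) (hA : ∀ i, 0 < A i) (N C : ℝ≥0) (hN : ∃ i, N * ∏ j, A j ≤ C * W i) :
    N ^ δ * ∏ i, A i ^ (κ i - 1) * max 1 (max (A i) (W i)) ^ (-κ i) ≤
      C ^ δ * ∑ i, (∏ j, A j ^ (κ j - 1 - δ) * max 1 (A j) ^ (-((κ j - 1 - δ) + 1 / 5))) *
        ∏ j ∈ Finset.univ.erase i, max 1 (W j) ^ (-(1 + 1 / 5 : ℝ)) := by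
  obtain ⟨i, -, hi⟩ := Finset.exists_max_image Finset.univ W Finset.univ_nonempty
  have hNi : N * ∏ j, A j ≤ C * W i := by
    obtain ⟨l, hl⟩ := hN
    exact hl.trans (by gcongr; exact hi l (Finset.mem_univ _))
  refine le_trans ?_ (mul_le_mul_right (Finset.single_le_sum_of_canonicallyOrdered
    (Finset.mem_univ i)) _)
  set M : Fin 3 → ℝ≥0 := fun j => max 1 (max (A j) (W j)) with hM
  have hM1 : ∀ j, 1 ≤ M j := fun j => le_max_left _ _
  have hM0 : ∀ j, M j ≠ 0 := fun j => (one_pos.trans_le (hM1 j)).ne'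
  have hMA : ∀ j, max 1 (A j) ≤ M j := fun j => max_le_max le_rfl (le_max_left _ _)
  have hMW : ∀ j, max 1 (W j) ≤ M j := fun j => max_le_max le_rfl (le_max_right _ _)
  have hMi : ∀ j, max 1 (W j) ≤ M i := fun j =>
    (max_le_max le_rfl (hi j (Finset.mem_univ _))).trans (hMW i)
  set s : Fin 3 → ℝ := fun j => κ j - 1 - δ with hs
  have hs0 : ∀ j, 0 < s j := fun j => by simp only [hs]; linarith [hδ j]
  have hsplit : ∀ j, A j ^ (κ j - 1) = A j ^ s j * A j ^ δ := fun j => by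
    rw [← NNReal.rpow_add (hA j).ne']; congr 1; simp [hs]
  -- As `κ j = s j + 1 + δ`, the exponent splits into `s j + 1/5` for convergence in `A j` and `4/5`
  -- for `W j`, with `δ` to spare.
  have hother : ∀ j, M j ^ (-κ j) ≤ max 1 (A j) ^ (-(s j + 1 / 5)) *
      max 1 (W j) ^ (-(4 / 5 : ℝ)) := fun j => by
    calc M j ^ (-κ j) ≤ M j ^ (-(s j + 1 / 5) + -(4 / 5 : ℝ)) :=
          NNReal.rpow_le_rpow_of_exponent_le (hM1 j) (by simp only [hs]; linarith)
      _ = M j ^ (-(s j + 1 / 5)) * M j ^ (-(4 / 5 : ℝ)) := NNReal.rpow_add (hM0 j) _ _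
      _ ≤ _ := mul_le_mul'
        (rpow_neg_le_rpow_neg (le_max_left _ _) (hMA j) (by linarith [hs0 j]))
        (rpow_neg_le_rpow_neg (le_max_left _ _) (hMW j) (by norm_num))
  -- After absorbing `W i ^ δ`, the exponent `s i + 1 = (s i + 1/5) + 2 · (2/5)` is left. Maximality
  -- of `W i` gives `M i ≥ max 1 (W j)`, so each of the other two indices borrows `2/5`; with its
  -- own `4/5` this makes `6/5 > 1`, enough for integrability.
  have hmain : W i ^ δ * M i ^ (-κ i) ≤ max 1 (A i) ^ (-(s i + 1 / 5)) *
      ∏ j ∈ Finset.univ.erase i, max 1 (W j) ^ (-(2 / 5 : ℝ)) := by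
    calc W i ^ δ * M i ^ (-κ i) ≤ M i ^ δ * M i ^ (-κ i) := by
          gcongr
          exact (le_max_right _ _).trans (hMW i)
      _ = M i ^ (-(s i + 1 / 5)) * ∏ j ∈ Finset.univ.erase i, M i ^ (-(2 / 5 : ℝ)) := by
          rw [Finset.prod_const, Finset.card_erase_of_mem (Finset.mem_univ _), Finset.card_univ,
            Fintype.card_fin, ← NNReal.rpow_add (hM0 i), ← NNReal.rpow_natCast,
            ← NNReal.rpow_mul, ← NNReal.rpow_add (hM0 i)]
          congr 1
          simp only [hs]
          norm_num
          ring
      _ ≤ _ := mul_le_mul'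
        (rpow_neg_le_rpow_neg (le_max_left _ _) (hMA i) (by linarith [hs0 i]))
        (Finset.prod_le_prod' fun j _ =>
          rpow_neg_le_rpow_neg (le_max_left _ _) (hMi j) (by norm_num))
  have hNpow : N ^ δ * ∏ j, A j ^ δ ≤ C ^ δ * W i ^ δ := by
    rw [NNReal.finsetProd_rpow, ← NNReal.mul_rpow, ← NNReal.mul_rpow]
    exact NNReal.rpow_le_rpow hNi hδ0
  have hj : ∀ j, max 1 (W j) ^ (-(4 / 5 : ℝ)) * max 1 (W j) ^ (-(2 / 5 : ℝ)) =
      max 1 (W j) ^ (-(1 + 1 / 5 : ℝ)) := fun j => by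
    rw [← NNReal.rpow_add (one_pos.trans_le (le_max_left _ _)).ne']
    norm_num
  calc N ^ δ * ∏ j, A j ^ (κ j - 1) * M j ^ (-κ j)
      = (N ^ δ * ∏ j, A j ^ δ) * (∏ j, A j ^ s j) * ∏ j, M j ^ (-κ j) := by
        simp_rw [hsplit, Finset.prod_mul_distrib]; ring
    _ ≤ (C ^ δ * W i ^ δ) * (∏ j, A j ^ s j) * ∏ j, M j ^ (-κ j) := by gcongr
    _ = C ^ δ * ((∏ j, A j ^ s j) * ((W i ^ δ * M i ^ (-κ i)) *
          ∏ j ∈ Finset.univ.erase i, M j ^ (-κ j))) := by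
        rw [← Finset.mul_prod_erase Finset.univ (fun j => M j ^ (-κ j)) (Finset.mem_univ i)]; ring
    _ ≤ C ^ δ * ((∏ j, A j ^ s j) * ((max 1 (A i) ^ (-(s i + 1 / 5)) *
          ∏ j ∈ Finset.univ.erase i, max 1 (W j) ^ (-(2 / 5 : ℝ))) *
          ∏ j ∈ Finset.univ.erase i, max 1 (A j) ^ (-(s j + 1 / 5)) *
            max 1 (W j) ^ (-(4 / 5 : ℝ)))) := by
        gcongr with j
        exact hother j
    _ = _ := by
        rw [Finset.prod_mul_distrib, Finset.prod_mul_distrib,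
          ← Finset.mul_prod_erase Finset.univ (fun j => max 1 (A j) ^ (-(s j + 1 / 5)))
            (Finset.mem_univ i)]
        simp_rw [← hj, Finset.prod_mul_distrib]
        ring

section

variable {F : Type*} [Field F] [TopologicalSpace F] [IsTopologicalRing F] [LocallyCompactSpace F]
  [T2Space F] [SecondCountableTopology F] [ContinuousInv₀ F] [MeasurableSpace F] [BorelSpace F]

omit [LocallyCompactSpace F] [T2Space F] [ContinuousInv₀ F] in
lemma measurable_quadCoeff (j : Fin 3) :
    Measurable fun p : F × (F × F) => quadCoeff p.1 p.2 j := by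
  fin_cases j <;> simp only [quadCoeff] <;> simp <;> fun_prop

omit [ContinuousInv₀ F] in
-- Any two of the three coefficients are coordinates on the `v`-plane up to translations,
-- reflections and shears, all measure preserving. In particular `β` drops out.
lemma lintegral_quadCoeff_erase (μ : Measure F) [μ.IsAddHaarMeasure] {h : F → ℝ≥0∞}
    (hh : Measurable h) (β : F) (i : Fin 3) :
    ∫⁻ v, ∏ j ∈ Finset.univ.erase i, h (quadCoeff β v j) ∂(μ.prod μ) = (∫⁻ x, h x ∂μ) ^ 2 := by
  have hadd : ∀ c : F, ∫⁻ x, h (c + x) ∂μ = ∫⁻ x, h x ∂μ := fun c =>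
    lintegral_add_left_eq_self h c
  have hsub : ∀ c : F, ∫⁻ x, h (c - x) ∂μ = ∫⁻ x, h x ∂μ := fun c =>
    lintegral_sub_left_eq_self h c
  have e0 : (Finset.univ.erase 0 : Finset (Fin 3)) = {1, 2} := rfl
  have e1 : (Finset.univ.erase 1 : Finset (Fin 3)) = {0, 2} := rfl
  have e2 : (Finset.univ.erase 2 : Finset (Fin 3)) = {0, 1} := rfl
  fin_cases i
  · simp only [Fin.zero_eta, e0, quadCoeff]
    rw [lintegral_prod_symm _ (by simp; fun_prop)]
    simp only [Finset.prod_pair (show (1 : Fin 3) ≠ 2 by decide)]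
    simp
    have : ∀ y, ∫⁻ x, h (β + y) * h (β - (x + y)) ∂μ = h (β + y) * ∫⁻ x, h x ∂μ := fun y => by
      rw [lintegral_const_mul _ (by fun_prop), ← hsub (β - y)]
      simp_rw [sub_sub, add_comm y]
    simp_rw [this]
    rw [lintegral_mul_const _ (by fun_prop), hadd, sq]
  · simp only [Fin.mk_one, e1, quadCoeff]
    rw [lintegral_prod _ (by simp; fun_prop)]
    simp only [Finset.prod_pair (show (0 : Fin 3) ≠ 2 by decide)]
    simp
    have : ∀ y, ∫⁻ x, h (β + y) * h (β - (y + x)) ∂μ = h (β + y) * ∫⁻ x, h x ∂μ := fun y => by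
      rw [lintegral_const_mul _ (by fun_prop), ← hsub (β - y)]
      simp_rw [sub_sub]
    simp_rw [this]
    rw [lintegral_mul_const _ (by fun_prop), hadd, sq]
  · simp only [Fin.reduceFinMk, e2, quadCoeff]
    simp only [Finset.prod_pair (show (0 : Fin 3) ≠ 1 by decide)]
    simp
    rw [lintegral_prod_mul (f := fun x => h (β + x)) (g := fun x => h (β + x)) (by fun_prop)
      (by fun_prop), hadd, sq]

variable (hF : IsLocalModulus F)
include hF

omit [T2Space F] [SecondCountableTopology F] [ContinuousInv₀ F] [MeasurableSpace F]
  [BorelSpace F] in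
-- The three coefficients add up to `3 * β`, so the largest of them controls `β` up to the
-- quasi-triangle constant and `|3|`.
lemma IsLocalModulus.exists_le_quadCoeff (h3 : (3 : F) ≠ 0) :
    ∃ C : ℝ≥0, ∀ β v, ∃ i, nabs (β : F) ≤ C * nabs (quadCoeff β v i) := by
  obtain ⟨C, hC⟩ := hF.quasi
  refine ⟨(nabs (3 : F))⁻¹ * (max C 1) ^ 2, fun β v => ?_⟩
  have hsum : 3 * β = quadCoeff β v 0 + quadCoeff β v 1 + quadCoeff β v 2 := by
    simp [quadCoeff]; ring
  obtain ⟨i, -, hi⟩ := Finset.exists_max_image Finset.univ (fun j => nabs (quadCoeff β v j))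
    Finset.univ_nonempty
  refine ⟨i, ?_⟩
  rw [mul_assoc, ← div_eq_inv_mul, le_div_iff₀ (nabs_pos h3), mul_comm, ← nabs_mul, hsum]
  have hC1 : ∀ x y : F, nabs (x + y) ≤ max C 1 * max (nabs x) (nabs y) := fun x y =>
    (hC x y).trans (by gcongr; exact le_max_left _ _)
  set D := max C 1
  have hD : 1 ≤ D := le_max_right _ _
  set m := nabs (quadCoeff β v i)
  have h01 : nabs (quadCoeff β v 0 + quadCoeff β v 1) ≤ D * m :=
    (hC1 _ _).trans (by
      gcongr
      exact max_le (hi _ (Finset.mem_univ _)) (hi _ (Finset.mem_univ _)))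
  calc _ ≤ D * max _ _ := hC1 _ _
    _ ≤ D * (D * m) := by
      gcongr
      exact max_le h01 ((hi _ (Finset.mem_univ _)).trans (le_mul_of_one_le_left zero_le hD))
    _ = _ := by ring

/-- Once `kernel_le_separated` is applied, the inner integral over `v` no longer depends on `a` or
`B`, and the integral over `a` factors. This is what makes the constant uniform in `B`. -/
theorem IsLocalModulus.lintegral_kernel_le (h3 : (3 : F) ≠ 0) (μ : Measure F) [μ.IsAddHaarMeasure]
    (ν : Measure Fˣ) [ν.IsHaarMeasure] {κ : Fin 3 → ℝ} {δ : ℝ} (hδ0 : 0 ≤ δ)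
    (hδ : ∀ i, δ < κ i - 1) :
    ∃ C : ℝ≥0, ∀ B : F, ((nabs B ^ δ : ℝ≥0) : ℝ≥0∞) *
      ∫⁻ p : (Fin 3 → Fˣ) × (F × F), ((∏ i, nabs (p.1 i : F) ^ (κ i - 1) *
        max 1 (max (nabs (p.1 i : F)) (nabs (quadCoeff (B * ∏ i, (p.1 i : F)) p.2 i))) ^ (-κ i)
          : ℝ≥0) : ℝ≥0∞) ∂((Measure.pi fun _ : Fin 3 => ν).prod (μ.prod μ)) ≤ C := by
  have : SigmaFinite ν := sigmaFinite_haar_units ν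
  obtain ⟨C, hC⟩ := hF.exists_le_quadCoeff h3
  set h : F → ℝ≥0∞ := fun w => ((max 1 (nabs w) ^ (-(1 + 1 / 5 : ℝ)) : ℝ≥0) : ℝ≥0∞) with hh
  set g : Fin 3 → Fˣ → ℝ≥0∞ := fun j a => ((nabs (a : F) ^ (κ j - 1 - δ) *
    max 1 (nabs (a : F)) ^ (-((κ j - 1 - δ) + 1 / 5)) : ℝ≥0) : ℝ≥0∞) with hg
  have hnm := hF.measurable
  have hval : Measurable (Units.val : Fˣ → F) := comap_measurable _
  have hhm : Measurable h := by fun_prop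
  have hgm : ∀ j, Measurable (g j) := fun j => by
    have := hnm.comp hval
    simp only [Function.comp_def] at this
    fun_prop
  have hH : ∫⁻ w, h w ∂μ ≠ ⊤ := (hF.lintegral_max_one_rpow_lt_top μ (by norm_num)).ne
  have hG : ∏ j, ∫⁻ a, g j a ∂ν ≠ ⊤ := ENNReal.prod_ne_top fun j _ =>
    (hF.lintegral_units_lt_top ν (by linarith [hδ j]) (by norm_num)).ne
  have hT : ((C ^ δ : ℝ≥0) : ℝ≥0∞) * (3 * ((∏ j, ∫⁻ a, g j a ∂ν) * (∫⁻ w, h w ∂μ) ^ 2)) ≠ ⊤ :=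
    ENNReal.mul_ne_top ENNReal.coe_ne_top (ENNReal.mul_ne_top (by norm_num)
      (ENNReal.mul_ne_top hG (ENNReal.pow_ne_top hH)))
  refine ⟨_, fun B => le_trans ?_ (ENNReal.coe_toNNReal hT).ge⟩
  rw [← lintegral_const_mul' _ _ ENNReal.coe_ne_top]
  have hmi : ∀ i : Fin 3, Measurable fun p : (Fin 3 → Fˣ) × (F × F) => (∏ j, g j (p.1 j)) *
      ∏ j ∈ Finset.univ.erase i, h (quadCoeff (B * ∏ i, (p.1 i : F)) p.2 j) := fun i => by
    refine Measurable.mul ?_ ?_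
    · exact Finset.measurable_fun_prod _ fun j _ => (hgm j).comp (by fun_prop)
    · refine Finset.measurable_fun_prod _ fun j _ => hhm.comp ((measurable_quadCoeff j).comp
        (Measurable.prodMk (measurable_const.mul ?_) measurable_snd))
      exact Finset.measurable_fun_prod _ fun j _ => hval.comp (by fun_prop)
  calc _ ≤ ∫⁻ p : (Fin 3 → Fˣ) × (F × F), ((C ^ δ : ℝ≥0) : ℝ≥0∞) * ∑ i, (∏ j, g j (p.1 j)) *
        ∏ j ∈ Finset.univ.erase i, h (quadCoeff (B * ∏ i, (p.1 i : F)) p.2 j)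
        ∂((Measure.pi fun _ : Fin 3 => ν).prod (μ.prod μ)) := by
        refine lintegral_mono fun p => ?_
        simp only [hg, hh]
        obtain ⟨i, hi⟩ := hC (B * ∏ i, (p.1 i : F)) p.2
        rw [nabs_mul, nabs_prod] at hi
        exact_mod_cast kernel_le_separated hδ0 hδ (fun i => nabs (p.1 i : F))
          (fun i => nabs (quadCoeff (B * ∏ i, (p.1 i : F)) p.2 i))
          (fun i => nabs_pos (p.1 i).ne_zero) (nabs B) C ⟨i, hi⟩
    _ = ((C ^ δ : ℝ≥0) : ℝ≥0∞) * ∑ i : Fin 3, ∫⁻ p : (Fin 3 → Fˣ) × (F × F), (∏ j, g j (p.1 j)) *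
        ∏ j ∈ Finset.univ.erase i, h (quadCoeff (B * ∏ i, (p.1 i : F)) p.2 j)
        ∂((Measure.pi fun _ : Fin 3 => ν).prod (μ.prod μ)) := by
        rw [lintegral_const_mul' _ _ ENNReal.coe_ne_top, lintegral_finsetSum _ fun i _ => hmi i]
    _ = _ := by
        congr 1
        have : ∀ i : Fin 3, ∫⁻ p : (Fin 3 → Fˣ) × (F × F), (∏ j, g j (p.1 j)) *
            ∏ j ∈ Finset.univ.erase i, h (quadCoeff (B * ∏ i, (p.1 i : F)) p.2 j)
            ∂((Measure.pi fun _ : Fin 3 => ν).prod (μ.prod μ)) =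
            (∏ j, ∫⁻ a, g j a ∂ν) * (∫⁻ w, h w ∂μ) ^ 2 := fun i => by
          rw [lintegral_prod _ (hmi i).aemeasurable]
          simp only
          have : ∀ x : Fin 3 → Fˣ, ∫⁻ v, (∏ j, g j (x j)) *
              ∏ j ∈ Finset.univ.erase i, h (quadCoeff (B * ∏ i, (x i : F)) v j) ∂(μ.prod μ) =
              (∏ j, g j (x j)) * (∫⁻ w, h w ∂μ) ^ 2 := fun x => by
            rw [lintegral_const_mul', lintegral_quadCoeff_erase μ hhm]
            exact ENNReal.prod_ne_top fun j _ => ENNReal.coe_ne_top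
          simp_rw [this]
          rw [lintegral_mul_const' _ _ (ENNReal.pow_ne_top hH),
            lintegral_pi_fin_prod (fun _ => ν) hgm]
        simp_rw [this]
        simp

end

/-! ### Reduction of the theorem to oscillatory decay. -/

section

variable {F : Type*} [Field F] [TopologicalSpace F] [IsTopologicalRing F] [LocallyCompactSpace F]

/-- The decay of the oscillatory integrals with phase `∑ᵢ ⟨xᵢ, uᵢ⟩ᵢ + ∑ᵢ wᵢ Qᵢ(uᵢ)`. -/
def HasOscillatoryDecay [MeasurableSpace F] {d : Fin 3 → ℕ}
    (μV : Measure ((i : Fin 3) → Fin (d i) → F)) (ψ : AddChar F Circle)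
    (Q : (i : Fin 3) → QuadraticForm F (Fin (d i) → F))
    (f : ((i : Fin 3) → Fin (d i) → F) → ℂ) (C : ℝ≥0) : Prop :=
  ∀ (x : (i : Fin 3) → Fin (d i) → F) (w : Fin 3 → F),
    ‖∫ u, (ψ (∑ i, QuadraticMap.polar (Q i) (x i) (u i) + ∑ i, w i * Q i (u i)) : ℂ) * f u ∂μV‖₊
      ≤ C * ∏ i, max 1 (max (boxNorm (x i)) (nabs (w i))) ^ (-((d i : ℝ) / 2))

omit [TopologicalSpace F] [IsTopologicalRing F] [LocallyCompactSpace F] in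
lemma phase_eq {d : Fin 3 → ℕ}
    (Q : (i : Fin 3) → QuadraticForm F (Fin (d i) → F)) (t : Fin 3 → F)
    (ξ : (i : Fin 3) → Fin (d i) → F) (b : F) (a : Fin 3 → Fˣ) (v : F × F)
    (u : (i : Fin 3) → Fin (d i) → F) :
    phase Q t ξ b a v u = ∑ i, QuadraticMap.polar (Q i) (((a i : F) / t i) • ξ i) (u i) +
      ∑ i, quadCoeff (b / (9 * ∏ i, t i) * ∏ i, (a i : F)) v i * Q i (u i) := by
  rw [phase, add_assoc]
  congr 1
  simp [quadCoeff, Fin.sum_univ_three]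
  ring

variable [T2Space F] [SecondCountableTopology F] [ContinuousInv₀ F] [MeasurableSpace F]
  [BorelSpace F]

/-- Since `|tᵢ| = |ξᵢ|`, the vector `aᵢ ξᵢ / tᵢ` has box norm exactly `|aᵢ|`, so the decay
hypothesis bounds the integrand by the kernel above. The constant `C` is chosen before `f`, and the
bound is linear in `C₀`: continuity in `f` therefore only has to be checked for `C₀`. -/
theorem IsLocalModulus.absIntegral_le (hF : IsLocalModulus F) (h3 : (3 : F) ≠ 0)
    (μ : Measure F) [μ.IsAddHaarMeasure] (ν : Measure Fˣ) [ν.IsHaarMeasure]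
    {d : Fin 3 → ℕ} (hd : ∀ i, 2 < d i) {ε : ℝ} (hε0 : 0 < ε) (hε : ε < 1 / 2) :
    ∃ C : ℝ≥0, ∀ (μV : Measure ((i : Fin 3) → Fin (d i) → F)) (ψ : AddChar F Circle)
      (Q : (i : Fin 3) → QuadraticForm F (Fin (d i) → F))
      (f : ((i : Fin 3) → Fin (d i) → F) → ℂ) (C₀ : ℝ≥0), HasOscillatoryDecay μV ψ Q f C₀ →
      ∀ (t : Fin 3 → F) (b : F) (ξ : (i : Fin 3) → Fin (d i) → F),
        (∀ i, ξ i ≠ 0) → (∀ i, nabs (t i) = boxNorm (ξ i)) →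
        absIntegral μ ν μV ψ Q f t b ξ ≤ C₀ * C * decayBound ε b ξ := by
  set δ : ℝ := ((min (d 0) (min (d 1) (d 2)) : ℕ) : ℝ) / 2 - 1 - ε with hδ
  have hmin3 : 3 ≤ min (d 0) (min (d 1) (d 2)) := le_min (hd 0) (le_min (hd 1) (hd 2))
  have hδ0 : 0 ≤ δ := by
    have : (3 : ℝ) ≤ ((min (d 0) (min (d 1) (d 2)) : ℕ) : ℝ) := by exact_mod_cast hmin3
    rw [hδ]; linarith
  have hmin : ∀ i, min (d 0) (min (d 1) (d 2)) ≤ d i := by intro i; fin_cases i <;> simp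
  have hδi : ∀ i, δ < (d i : ℝ) / 2 - 1 := fun i => by
    have : ((min (d 0) (min (d 1) (d 2)) : ℕ) : ℝ) ≤ d i := by exact_mod_cast hmin i
    rw [hδ]; linarith
  -- Exponent zero serves the case where the minimum is `1`, including `b = 0`, where the quotient
  -- is `∞`; the exponent `δ` serves the other case.
  obtain ⟨C₁, hC₁⟩ := hF.lintegral_kernel_le h3 μ ν (κ := fun i => (d i : ℝ) / 2) le_rfl
    (fun i => hδ0.trans_lt (hδi i))
  obtain ⟨C₂, hC₂⟩ := hF.lintegral_kernel_le h3 μ ν (κ := fun i => (d i : ℝ) / 2) hδ0 hδi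
  have h9 : (9 : F) ≠ 0 := by
    have : (9 : F) = 3 * 3 := by norm_num
    rw [this]; exact mul_ne_zero h3 h3
  refine ⟨max C₁ (C₂ * nabs (9 : F) ^ δ), fun μV ψ Q f C₀ hosc t b ξ hξ ht => ?_⟩
  have ht0 : ∀ i, t i ≠ 0 := fun i => by
    refine nabs_eq_zero.not.1 ?_
    rw [ht]; exact (boxNorm_pos (hξ i)).ne'
  set B : F := b / (9 * ∏ i, t i) with hB
  set J : ℝ≥0∞ := ∫⁻ p : (Fin 3 → Fˣ) × (F × F), ((∏ i, nabs (p.1 i : F) ^ ((d i : ℝ) / 2 - 1) *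
        max 1 (max (nabs (p.1 i : F)) (nabs (quadCoeff (B * ∏ i, (p.1 i : F)) p.2 i)))
          ^ (-((d i : ℝ) / 2)) : ℝ≥0) : ℝ≥0∞)
        ∂((Measure.pi fun _ : Fin 3 => ν).prod (μ.prod μ)) with hJ
  have hle : absIntegral μ ν μV ψ Q f t b ξ ≤ C₀ * J := by
    rw [absIntegral, hJ, ← lintegral_const_mul' _ _ ENNReal.coe_ne_top]
    refine lintegral_mono fun p => ?_
    have hx : ∀ i, boxNorm (((p.1 i : F) / t i) • ξ i) = nabs (p.1 i : F) := fun i => by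
      rw [boxNorm_smul, nabs_div, ht, div_mul_cancel₀ _ (boxNorm_pos (hξ i)).ne']
    have h := hosc (fun i => ((p.1 i : F) / t i) • ξ i)
      (quadCoeff (B * ∏ i, (p.1 i : F)) p.2)
    simp only [hx] at h
    simp_rw [phase_eq, ← hB]
    rw [enorm_eq_nnnorm]
    have hp : ∀ i, ((nabs (p.1 i : F) : ℝ≥0) : ℝ≥0∞) ^ ((d i : ℝ) / 2 - 1) =
        ((nabs (p.1 i : F) ^ ((d i : ℝ) / 2 - 1) : ℝ≥0) : ℝ≥0∞) := fun i =>
      (ENNReal.coe_rpow_of_ne_zero (nabs_pos (p.1 i).ne_zero).ne' _).symm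
    simp_rw [hp]
    norm_cast
    rw [Finset.prod_mul_distrib, mul_left_comm, mul_comm (‖_‖₊)]
    exact mul_le_mul_right h _
  refine hle.trans ?_
  rw [mul_assoc]
  gcongr
  have hT : boxNorm (tensorCoords ξ) = ∏ i, nabs (t i) := by
    rw [boxNorm_tensorCoords (fun i => (by omega : 0 < 2).trans (hd i))]
    exact Finset.prod_congr rfl fun i _ => (ht i).symm
  have hT0 : boxNorm (tensorCoords ξ) ≠ 0 := by
    rw [hT]; exact Finset.prod_ne_zero_iff.2 fun i _ => (nabs_pos (ht0 i)).ne'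
  rw [decayBound, ← hδ]
  rcases le_total 1 ((boxNorm (tensorCoords ξ) : ℝ≥0∞) / (nabs b : ℝ≥0∞)) with h | h
  · rw [min_eq_left h, ENNReal.one_rpow, mul_one]
    refine le_trans ?_ (ENNReal.coe_le_coe.2 (le_max_left _ _))
    have := hC₁ B
    rwa [NNReal.rpow_zero, ENNReal.coe_one, one_mul] at this
  · rw [min_eq_right h]
    have hb : nabs b ≠ 0 := fun h0 => by
      rw [h0, ENNReal.coe_zero, ENNReal.div_zero (by exact_mod_cast hT0)] at h
      exact absurd h (by simp)
    have hB0 : nabs B ≠ 0 := by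
      rw [hB, nabs_div, nabs_mul]
      exact div_ne_zero hb (mul_ne_zero (nabs_pos h9).ne'
        (nabs_pos (Finset.prod_ne_zero_iff.2 fun i _ => ht0 i)).ne')
    -- The bound `|B| ^ (-δ)` becomes the required power of the quotient; `|9| ^ δ` is absorbed in
    -- the constant.
    have hBi : nabs (9 : F) * (boxNorm (tensorCoords ξ) / nabs b) = (nabs B)⁻¹ := by
      rw [hB, nabs_div, nabs_mul, nabs_prod, ← hT]
      field_simp
    have key : J ≤ ((C₂ * ((nabs B)⁻¹) ^ δ : ℝ≥0) : ℝ≥0∞) := by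
      have := hC₂ B
      rw [mul_comm, ← ENNReal.le_div_iff_mul_le (Or.inl (by
        exact_mod_cast (NNReal.rpow_pos (pos_iff_ne_zero.2 hB0)).ne'))
        (Or.inl ENNReal.coe_ne_top)] at this
      refine this.trans (le_of_eq ?_)
      rw [← ENNReal.coe_div (NNReal.rpow_pos (pos_iff_ne_zero.2 hB0)).ne', NNReal.inv_rpow,
        div_eq_mul_inv]
    refine key.trans ?_
    rw [← ENNReal.coe_div hb, ← ENNReal.coe_rpow_of_nonneg _ hδ0, ← ENNReal.coe_mul,
      ENNReal.coe_le_coe, ← hBi, NNReal.mul_rpow, ← mul_assoc]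
    gcongr
    exact le_max_right _ _

end

/-! ### Nonarchimedean fields: the Haar modulus against the valuation. -/

section Nonarchimedean

open IsNonarchimedeanLocalField
open scoped Pointwise

variable {F : Type*} [Field F] [ValuativeRel F] [TopologicalSpace F] [IsNonarchimedeanLocalField F]

variable (F) in
lemma t2Space_of_nonarch : T2Space F := by
  let := IsTopologicalAddGroup.rightUniformSpace F
  have := isUniformAddGroup_of_addCommGroup (G := F)
  infer_instance

open scoped Valued in
variable (F) in
lemma secondCountableTopology_of_nonarch : SecondCountableTopology F := by
  let := IsTopologicalAddGroup.rightUniformSpace F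
  have := isUniformAddGroup_of_addCommGroup (G := F)
  let : (Valued.v (R := F)).RankOne :=
  { hom' := IsRankLeOne.nonempty.some.emb (R := F).comp MonoidWithZeroHom.ValueGroup₀.embedding
    strictMono' := IsRankLeOne.nonempty.some.strictMono.comp
        MonoidWithZeroHom.ValueGroup₀.embedding_strictMono }
  have : ProperSpace F := .of_nontriviallyNormedField_of_weaklyLocallyCompactSpace F
  exact secondCountable_of_proper

lemma setOf_valuation_lt_mem_nhds (x : F) {c : F} (hc : c ≠ 0) :
    {y : F | valuation F (y - x) < valuation F c} ∈ nhds x := by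
  have h := (IsValuativeTopology.hasBasis_nhds_zero' F).mem_of_mem
    (i := valuation F c) (by simpa using hc)
  have hc : Filter.Tendsto (fun y : F => y - x) (nhds x) (nhds 0) := by
    simpa using (continuous_sub_right x).tendsto x
  exact hc h

/-- Multiplication by `x` maps the ring of integers, of positive finite measure, into itself. -/
lemma nabs_le_one_of_valuation_le_one {x : F} (hx : valuation F x ≤ 1) : nabs x ≤ 1 := by
  borelize F
  rcases eq_or_ne x 0 with rfl | h0
  · simp [nabs_zero]
  set O : Set F := {y | valuation F y ≤ 1}
  have hO : O ∈ nhds (0 : F) := Filter.mem_of_superset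
    (setOf_valuation_lt_mem_nhds 0 one_ne_zero) fun y hy => by
      simpa [O] using (le_of_lt hy : valuation F (y - 0) ≤ valuation F 1)
  have hO0 := Measure.measure_pos_of_mem_nhds (Measure.addHaar (G := F)) hO
  have hO1 := (isCompact_closedBall F 1).measure_lt_top (μ := Measure.addHaar)
  have h := distribHaarChar_mul Measure.addHaar (Units.mk0 x h0) O
  rw [← nabs_of_ne_zero] at h
  have hsub : (Units.mk0 x h0) • O ⊆ O := by
    rintro _ ⟨y, hy, rfl⟩
    simpa [O, Units.smul_def] using mul_le_one' hx hy
  have h2 : (nabs x : ℝ≥0∞) * Measure.addHaar O ≤ 1 * Measure.addHaar O := by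
    rw [h, one_mul]; exact measure_mono hsub
  exact_mod_cast (ENNReal.mul_le_mul_iff_left hO0.ne' hO1.ne).1 h2

/-- The dilate of the ring of integers by `x` misses the open set of elements close to `1`, all of
valuation one, so it loses positive measure. -/
lemma nabs_lt_one_of_valuation_lt_one {x : F} (hx : valuation F x < 1) : nabs x < 1 := by
  borelize F
  rcases eq_or_ne x 0 with rfl | h0
  · simp [nabs_zero]
  set O : Set F := {y | valuation F y ≤ 1}
  set U : Set F := {y | valuation F (y - 1) < valuation F 1}
  have hU0 := Measure.measure_pos_of_mem_nhds (Measure.addHaar (G := F))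
    (setOf_valuation_lt_mem_nhds (1 : F) one_ne_zero)
  have hO1 := (isCompact_closedBall F 1).measure_lt_top (μ := Measure.addHaar)
  have hOc := (isCompact_closedBall F 1)
  have := t2Space_of_nonarch F
  have h := distribHaarChar_mul Measure.addHaar (Units.mk0 x h0) O
  rw [← nabs_of_ne_zero] at h
  have hlt : ∀ y ∈ (Units.mk0 x h0) • O, valuation F y < 1 := by
    rintro _ ⟨y, hy, rfl⟩
    simpa [O, Units.smul_def] using mul_lt_one_of_lt_of_le hx hy
  have hU1 : ∀ y ∈ U, valuation F y = 1 := fun y hy => by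
    have := Valuation.map_add_eq_of_lt_right (valuation F) (x := y - 1) (y := 1) hy
    simpa using this
  have hdisj : Disjoint U ((Units.mk0 x h0) • O) := Set.disjoint_left.2 fun y hy hy' =>
    (hlt y hy').ne (hU1 y hy)
  have hm : MeasurableSet ((Units.mk0 x h0) • O) := (hOc.smul _).measurableSet
  have hle : Measure.addHaar U + (nabs x : ℝ≥0∞) * Measure.addHaar O ≤ Measure.addHaar O := by
    rw [h, ← measure_union hdisj hm]
    exact measure_mono (Set.union_subset (fun y hy => (hU1 y hy).le) fun y hy => (hlt y hy).le)
  by_contra! hcon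
  have h3 : Measure.addHaar O ≤ (nabs x : ℝ≥0∞) * Measure.addHaar O :=
    le_mul_of_one_le_left zero_le (by exact_mod_cast hcon)
  have h4 := ((add_le_add_right h3 _).trans hle)
  rw [add_comm] at h4
  have h5 := ENNReal.lt_add_right hO1.ne hU0.ne'
  exact absurd h4 (not_le.2 h5)

/-- This transfers the ultrametric properties of the valuation to `nabs` without computing the
modulus of a uniformizer. -/
lemma nabs_le_nabs_iff {x y : F} : nabs x ≤ nabs y ↔ valuation F x ≤ valuation F y := by
  rcases eq_or_ne y 0 with rfl | hy
  · simp [nabs_zero, nabs_eq_zero]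
  have hy' : 0 < valuation F y := by simpa [zero_lt_iff] using hy
  have key : nabs (x / y) ≤ 1 ↔ valuation F (x / y) ≤ 1 := by
    refine ⟨fun h => ?_, nabs_le_one_of_valuation_le_one⟩
    by_contra! hcon
    have h1 : valuation F (x / y)⁻¹ < 1 := by
      rw [map_inv₀]; exact inv_lt_one_of_one_lt₀ hcon
    have h2 := nabs_lt_one_of_valuation_lt_one h1
    rw [nabs_inv] at h2
    have h0 : x / y ≠ 0 := fun h0 => by simp [h0] at hcon
    exact absurd h (not_le.2 ((inv_lt_one₀ (nabs_pos h0)).1 h2))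
  rwa [nabs_div, div_le_one (nabs_pos hy), map_div₀, div_le_one₀ hy'] at key

lemma nabs_lt_nabs_iff {x y : F} : nabs x < nabs y ↔ valuation F x < valuation F y := by
  rw [← not_le, ← not_le, nabs_le_nabs_iff]

lemma nabs_add_le_max (x y : F) : nabs (x + y) ≤ max (nabs x) (nabs y) := by
  rcases le_total (valuation F x) (valuation F y) with h | h
  · exact le_max_of_le_right (nabs_le_nabs_iff.2 ((valuation F).map_add_le h le_rfl))
  · exact le_max_of_le_left (nabs_le_nabs_iff.2 ((valuation F).map_add_le le_rfl h))

variable (F) in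
lemma exists_nabs_lt_one : ∃ ϖ : F, ϖ ≠ 0 ∧ nabs ϖ < 1 := by
  obtain ⟨c, hc, hc1⟩ := Valuation.IsNontrivial.exists_lt_one (v := valuation F)
  exact ⟨c, by simpa using hc, nabs_lt_one_of_valuation_lt_one hc1⟩

variable (F) in
lemma exists_nabs_lt {r : ℝ≥0} (hr : 0 < r) : ∃ c : F, c ≠ 0 ∧ nabs c < r := by
  obtain ⟨ϖ, h0, h1⟩ := exists_nabs_lt_one F
  obtain ⟨n, hn⟩ := exists_pow_lt_of_lt_one hr h1
  exact ⟨ϖ ^ n, pow_ne_zero _ h0, by rwa [nabs_pow]⟩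

lemma setOf_nabs_sub_lt_mem_nhds (x : F) {r : ℝ≥0} (hr : 0 < r) :
    {y : F | nabs (y - x) < r} ∈ nhds x := by
  obtain ⟨c, hc, hcr⟩ := exists_nabs_lt F hr
  exact Filter.mem_of_superset (setOf_valuation_lt_mem_nhds x hc) fun y hy =>
    (nabs_lt_nabs_iff.2 hy).trans hcr

lemma nabs_eq_of_sub_lt {x y : F} (h : nabs (y - x) < nabs x) : nabs y = nabs x := by
  have h1 := Valuation.map_add_eq_of_lt_right (valuation F) (nabs_lt_nabs_iff.1 h)
  rw [sub_add_cancel] at h1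
  exact le_antisymm (nabs_le_nabs_iff.2 h1.le) (nabs_le_nabs_iff.2 h1.ge)

lemma continuous_nabs_of_nonarch : Continuous (nabs : F → ℝ≥0) := by
  rw [continuous_iff_continuousAt]
  intro x
  rcases eq_or_ne x 0 with rfl | hx
  · rw [ContinuousAt, nabs_zero]
    refine (nhds_bot_basis (α := ℝ≥0)).tendsto_right_iff.2 fun r hr => ?_
    filter_upwards [setOf_nabs_sub_lt_mem_nhds (0 : F) hr] with y hy
    simpa using hy
  · refine continuousAt_const (y := nabs x) |>.congr ?_
    filter_upwards [setOf_nabs_sub_lt_mem_nhds x (nabs_pos hx)] with y hy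
    exact (nabs_eq_of_sub_lt hy).symm

variable (F) in
theorem isLocalModulus_of_nonarch : IsLocalModulus F where
  continuous := continuous_nabs_of_nonarch
  isCompact := by
    convert isCompact_closedBall F 1 using 3 with x
    rw [← nabs_one (F := F), nabs_le_nabs_iff, map_one]
  quasi := ⟨1, fun x y => by simpa using nabs_add_le_max x y⟩
  exists_lt_one := exists_nabs_lt_one F

/-- An element of value `exp (-1)` lies in the maximal ideal, hence is a multiple of `ϖ`. So the
value of `ϖ` is at least `exp (-1)` and below `1`, and no integer lies strictly between. -/
lemma valueGroupWithZeroIsoInt_uniformizer {ϖ : 𝒪[F]} (hϖ : Irreducible ϖ) :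
    valueGroupWithZeroIsoInt F (valuation F (ϖ : F)) = WithZero.exp (-1) := by
  set e := valueGroupWithZeroIsoInt F
  have hint := Valuation.integer.integers (valuation F)
  have hϖ0 : valuation F (ϖ : F) ≠ 0 := by
    simpa using hϖ.ne_zero
  have hϖ1 : valuation F (ϖ : F) < 1 := Valuation.Integer.not_isUnit_iff_valuation_lt_one.1 hϖ.1
  obtain ⟨x, hx⟩ := ValuativeRel.valuation_surjective (e.symm (WithZero.exp (-1)))
  have hx1 : valuation F x < 1 := by
    rw [hx, ← e.strictMono.lt_iff_lt, OrderMonoidIso.apply_symm_apply, map_one, ← WithZero.exp_zero,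
      WithZero.exp_lt_exp]
    norm_num
  have hle : valuation F x ≤ valuation F (ϖ : F) := by
    have hxu : ¬ IsUnit (⟨x, hx1.le⟩ : 𝒪[F]) :=
      Valuation.Integer.not_isUnit_iff_valuation_lt_one.2 hx1
    have hmem := (IsLocalRing.mem_maximalIdeal _).2 hxu
    rw [hϖ.maximalIdeal_eq, Ideal.mem_span_singleton] at hmem
    exact hint.le_of_dvd hmem
  have h1 : WithZero.exp (-1) ≤ e (valuation F (ϖ : F)) := by
    rw [← e.strictMono.le_iff_le, hx, OrderMonoidIso.apply_symm_apply] at hle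
    exact hle
  have h2 : e (valuation F (ϖ : F)) < 1 := by
    rw [← map_one e]; exact e.strictMono.lt_iff_lt.2 hϖ1
  have h0 : e (valuation F (ϖ : F)) ≠ 0 := by simpa using hϖ0
  rw [← WithZero.exp_log h0] at h1 h2 ⊢
  rw [← WithZero.exp_zero, WithZero.exp_lt_exp] at h2
  rw [WithZero.exp_le_exp] at h1
  congr 1
  omega

lemma nabs_tildeNonarch {J : Type*} [Fintype J] {ϖ : 𝒪[F]} (hϖ : Irreducible ϖ) {y : J → F}
    (hy : y ≠ 0) : nabs (tildeNonarch (ϖ : F) y) = boxNorm y := by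
  set e := valueGroupWithZeroIsoInt F
  obtain ⟨j₁, hj₁⟩ := Function.ne_iff.1 hy
  have : Nonempty J := ⟨j₁⟩
  obtain ⟨j, -, hj⟩ := Finset.exists_mem_eq_sup Finset.univ Finset.univ_nonempty
    (fun j => valuation F (y j))
  have hmax : ∀ i, valuation F (y i) ≤ valuation F (y j) := fun i =>
    hj ▸ Finset.le_sup (f := fun j => valuation F (y j)) (Finset.mem_univ i)
  have hyj : y j ≠ 0 := fun h => hj₁ (by simpa [h] using hmax j₁)
  have hbox : boxNorm y = nabs (y j) :=
    le_antisymm (boxNorm_le_iff.2 fun i => nabs_le_nabs_iff.2 (hmax i)) (nabs_le_boxNorm y j)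
  have hv : valuation F (tildeNonarch (ϖ : F) y) = valuation F (y j) := by
    apply e.strictMono.injective
    rw [tildeNonarch, ordVec, hj, map_zpow₀, map_zpow₀, valueGroupWithZeroIsoInt_uniformizer hϖ,
      ← WithZero.exp_zsmul]
    have h0 : e (valuation F (y j)) ≠ 0 := by simpa using hyj
    simp only [smul_eq_mul, mul_neg, mul_one, neg_neg]
    exact WithZero.exp_log h0
  rw [hbox]
  exact le_antisymm (nabs_le_nabs_iff.2 hv.le) (nabs_le_nabs_iff.2 hv.ge)

end Nonarchimedean

/-- Weyl differencing: the square of an integral is bounded by the integral of the absolute values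
of the autocorrelation. -/
lemma enorm_integral_sq_le {G : Type*} [AddGroup G] [MeasurableSpace G] [MeasurableAdd₂ G]
    (μ : Measure G) [SFinite μ] [μ.IsAddLeftInvariant] {g : G → ℂ} (hg : Integrable g μ) :
    ‖∫ u, g u ∂μ‖ₑ ^ 2 ≤ ∫⁻ h, ‖∫ u, g (u + h) * (starRingEnd ℂ) (g u) ∂μ‖ₑ ∂μ := by
  have hgc : Integrable (fun u => (starRingEnd ℂ) (g u)) μ :=
    Complex.conjCLE.toContinuousLinearMap.integrable_comp hg
  -- The shear `(u, h) ↦ (u, u + h)` preserves the product measure and turns the autocorrelation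
  -- into a product of integrable functions, which justifies Fubini.
  have hint : Integrable (fun p : G × G => g (p.1 + p.2) * (starRingEnd ℂ) (g p.1))
      (μ.prod μ) := by
    have := ((measurePreserving_prod_add μ μ).integrable_comp
      (hgc.mul_prod hg).aestronglyMeasurable).2 (hgc.mul_prod hg)
    refine this.congr (Filter.Eventually.of_forall fun p => ?_)
    simp [mul_comm]
  have key : (∫ u, g u ∂μ) * (starRingEnd ℂ) (∫ u, g u ∂μ) =
      ∫ h, ∫ u, g (u + h) * (starRingEnd ℂ) (g u) ∂μ ∂μ := by
    rw [← integral_integral_swap hint, ← integral_conj, ← integral_const_mul]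
    refine integral_congr_ae (Filter.Eventually.of_forall fun u => ?_)
    simp only
    rw [integral_mul_const, integral_add_left_eq_self]
  have h2 : ‖∫ u, g u ∂μ‖ₑ ^ 2 = ‖(∫ u, g u ∂μ) * (starRingEnd ℂ) (∫ u, g u ∂μ)‖ₑ := by
    rw [enorm_mul, RCLike.enorm_conj, sq]
  rw [h2, key]
  exact enorm_integral_le_lintegral_enorm _

/-! ### Quadratic phases under differencing. -/

section

variable {F : Type*} [Field F] {d : Fin 3 → ℕ}

/-- The phase `∑ᵢ ⟨xᵢ, uᵢ⟩ᵢ + ∑ᵢ wᵢ Qᵢ(uᵢ)`. -/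
def quadPhase (Q : (i : Fin 3) → QuadraticForm F (Fin (d i) → F))
    (x : (i : Fin 3) → Fin (d i) → F) (w : Fin 3 → F) (u : (i : Fin 3) → Fin (d i) → F) : F :=
  ∑ i, QuadraticMap.polar (Q i) (x i) (u i) + ∑ i, w i * Q i (u i)

lemma quadPhase_add (Q : (i : Fin 3) → QuadraticForm F (Fin (d i) → F))
    (x : (i : Fin 3) → Fin (d i) → F) (w : Fin 3 → F) (u l : (i : Fin 3) → Fin (d i) → F) :
    quadPhase Q x w (u + l) = quadPhase Q x w u + quadPhase Q x w l +
      ∑ i, w i * QuadraticMap.polar (Q i) (u i) (l i) := by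
  have h : ∀ i, Q i (u i + l i) = Q i (u i) + Q i (l i) + QuadraticMap.polar (Q i) (u i) (l i) :=
    fun i => by rw [QuadraticMap.polar]; ring
  simp only [quadPhase, Pi.add_apply, QuadraticMap.polar_add_right, h, mul_add,
    Finset.sum_add_distrib]
  ring

variable [TopologicalSpace F] [IsTopologicalRing F]

omit [TopologicalSpace F] [IsTopologicalRing F] in
lemma exists_quadraticForm_eq_sum {n : ℕ} (Q : QuadraticForm F (Fin n → F)) :
    ∃ M : Fin n → Fin n → F, ∀ x, Q x = ∑ j, ∑ k, x j * x k * M j k := by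
  obtain ⟨B, rfl⟩ := LinearMap.BilinMap.toQuadraticMap_surjective Q
  refine ⟨fun j k => B (Pi.single j 1) (Pi.single k 1), fun x => ?_⟩
  rw [LinearMap.BilinMap.toQuadraticMap_apply]
  conv_lhs => rw [← Finset.univ_sum_single x]
  have hs : ∀ j, (Pi.single j (x j) : Fin n → F) = x j • Pi.single j 1 := fun j => by
    rw [← Pi.single_smul, smul_eq_mul, mul_one]
  simp_rw [map_sum, LinearMap.sum_apply, hs, map_smul, LinearMap.smul_apply, smul_eq_mul]
  rw [Finset.sum_comm]
  refine Finset.sum_congr rfl fun j _ => Finset.sum_congr rfl fun k _ => by ring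

lemma continuous_quadraticForm {n : ℕ} (Q : QuadraticForm F (Fin n → F)) : Continuous Q := by
  obtain ⟨M, hM⟩ := exists_quadraticForm_eq_sum Q
  have : (Q : (Fin n → F) → F) = fun x => ∑ j, ∑ k, x j * x k * M j k := funext hM
  rw [this]
  fun_prop

lemma continuous_quadPhase (Q : (i : Fin 3) → QuadraticForm F (Fin (d i) → F))
    (x : (i : Fin 3) → Fin (d i) → F) (w : Fin 3 → F) : Continuous (quadPhase Q x w) := by
  have h := fun i => continuous_quadraticForm (Q i)
  unfold quadPhase QuadraticMap.polar
  fun_prop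

variable [SecondCountableTopology F] [MeasurableSpace F] [BorelSpace F]

/-- The autocorrelation of `f` twisted by the character `u ↦ ψ (∑ᵢ ⟨uᵢ, wᵢ hᵢ⟩ᵢ)`. -/
noncomputable def twistedCorrelation (μV : Measure ((i : Fin 3) → Fin (d i) → F))
    (ψ : AddChar F Circle) (Q : (i : Fin 3) → QuadraticForm F (Fin (d i) → F)) (w : Fin 3 → F)
    (f g : ((i : Fin 3) → Fin (d i) → F) → ℂ) (h : (i : Fin 3) → Fin (d i) → F) : ℂ :=
  ∫ u, (ψ (∑ i, w i * QuadraticMap.polar (Q i) (u i) (h i)) : ℂ) *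
    (f (u + h) * (starRingEnd ℂ) (g u)) ∂μV

/-- The increment of the phase from `u` to `u + h` is the phase at `h`, a unimodular constant under
the `u`-integral, plus a bilinear term. Thus `x` disappears and only a character linear in `u` is
left. -/
lemma enorm_oscillatory_sq_le (μV : Measure ((i : Fin 3) → Fin (d i) → F)) [SFinite μV]
    [μV.IsAddLeftInvariant] {ψ : AddChar F Circle} (hψ : Continuous ψ)
    (Q : (i : Fin 3) → QuadraticForm F (Fin (d i) → F))
    (x : (i : Fin 3) → Fin (d i) → F) (w : Fin 3 → F)
    {f : ((i : Fin 3) → Fin (d i) → F) → ℂ} (hf : Integrable f μV) :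
    ‖∫ u, (ψ (quadPhase Q x w u) : ℂ) * f u ∂μV‖ₑ ^ 2 ≤
      ∫⁻ h, ‖twistedCorrelation μV ψ Q w f f h‖ₑ ∂μV := by
  have hc : Continuous fun u => (ψ (quadPhase Q x w u) : ℂ) :=
    continuous_subtype_val.comp (hψ.comp (continuous_quadPhase Q x w))
  have hg : Integrable (fun u => (ψ (quadPhase Q x w u) : ℂ) * f u) μV :=
    hf.bdd_mul hc.aestronglyMeasurable (Filter.Eventually.of_forall fun u => (Circle.norm_coe _).le)
  refine (enorm_integral_sq_le μV hg).trans (lintegral_mono fun h => le_of_eq ?_)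
  have : ∀ u, (ψ (quadPhase Q x w (u + h)) : ℂ) * f (u + h) *
      (starRingEnd ℂ) ((ψ (quadPhase Q x w u) : ℂ) * f u) = (ψ (quadPhase Q x w h) : ℂ) *
        ((ψ (∑ i, w i * QuadraticMap.polar (Q i) (u i) (h i)) : ℂ) *
          (f (u + h) * (starRingEnd ℂ) (f u))) := fun u => by
    rw [quadPhase_add, AddChar.map_add_eq_mul, AddChar.map_add_eq_mul, map_mul, Circle.coe_mul,
      Circle.coe_mul]
    have h1 : (ψ (quadPhase Q x w u) : ℂ) * (starRingEnd ℂ) (ψ (quadPhase Q x w u) : ℂ) = 1 := by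
      rw [Complex.mul_conj, Circle.normSq_coe, Complex.ofReal_one]
    linear_combination (ψ (quadPhase Q x w h) : ℂ) *
      (ψ (∑ i, w i * QuadraticMap.polar (Q i) (u i) (h i)) : ℂ) * f (u + h) *
        (starRingEnd ℂ) (f u) * h1
  simp_rw [this]
  rw [integral_const_mul, enorm_mul]
  have h1 : ‖(ψ (quadPhase Q x w h) : ℂ)‖ₑ = 1 := by
    rw [← ofReal_norm, Circle.norm_coe, ENNReal.ofReal_one]
  rw [h1, one_mul, twistedCorrelation]

end

section AlgebraicDuality

variable {F : Type*} [Field F]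

/-- A nondegenerate form is inverted by a linear map on the values at the standard basis. -/
lemma exists_leftInverse_polar {n : ℕ} {Q : QuadraticForm F (Fin n → F)}
    (hQ : Q.polarBilin.Nondegenerate) :
    ∃ S : Fin n → Fin n → F, ∀ x j,
      x j = ∑ k, QuadraticMap.polar Q x (Pi.single k 1) * S k j := by
  let T : (Fin n → F) →ₗ[F] (Fin n → F) :=
    LinearMap.pi fun k => Q.polarBilin.flip (Pi.single k 1)
  have hT : ∀ x k, T x k = QuadraticMap.polar Q x (Pi.single k 1) := fun x k => rfl
  have hker : LinearMap.ker T = ⊥ := by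
    rw [LinearMap.ker_eq_bot']
    intro x hx
    refine hQ.1 x fun y => ?_
    rw [← Finset.univ_sum_single y, map_sum]
    refine Finset.sum_eq_zero fun k _ => ?_
    have h := congrFun hx k
    rw [hT] at h
    rw [← mul_one (y k), ← smul_eq_mul, Pi.single_smul, map_smul]
    simp [h]
  obtain ⟨S, hS⟩ := LinearMap.exists_leftInverse_of_injective T hker
  refine ⟨fun k => S (Pi.single k 1), fun x j => ?_⟩
  have h := LinearMap.congr_fun hS x
  rw [LinearMap.comp_apply, ← Finset.univ_sum_single (T x), map_sum] at h
  have h2 := congrFun h j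
  rw [LinearMap.id_apply] at h2
  rw [← h2, Finset.sum_apply]
  refine Finset.sum_congr rfl fun k _ => ?_
  rw [← mul_one (T x k), ← smul_eq_mul, Pi.single_smul, map_smul, hT]
  rfl

end AlgebraicDuality

/-- The circle has no small subgroups. -/
lemma circle_eq_one_of_forall_pow {z : Circle} (hz : ∀ n : ℕ, ‖((z ^ n : Circle) : ℂ) - 1‖ ≤ 1 / 2) :
    z = 1 := by
  -- From `y ^ 2 - 1 = (y + 1) * (y - 1)`: as long as `y` stays within `1/2` of `1`, each squaring
  -- expands the distance to `1` by at least `3/2`.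
  have key : ∀ n : ℕ, (3 / 2 : ℝ) ^ n * ‖(z : ℂ) - 1‖ ≤ ‖((z ^ (2 ^ n) : Circle) : ℂ) - 1‖ := by
    intro n
    induction n with
    | zero => simp
    | succ n ih =>
      set y : ℂ := ((z ^ (2 ^ n) : Circle) : ℂ) with hy
      have e : ((z ^ (2 ^ (n + 1)) : Circle) : ℂ) - 1 = (y + 1) * (y - 1) := by
        rw [pow_succ 2 n, pow_mul, Circle.coe_pow]; ring
      have h1 : 3 / 2 ≤ ‖y + 1‖ := by
        have h2 := norm_sub_norm_le (2 : ℂ) (-(y - 1))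
        have h3 := hz (2 ^ n)
        rw [norm_neg] at h2
        have e2 : (2 : ℂ) - -(y - 1) = y + 1 := by ring
        rw [e2, RCLike.norm_ofNat] at h2
        linarith
      rw [e, norm_mul, pow_succ, mul_comm _ (3 / 2 : ℝ), mul_assoc]
      gcongr
  by_contra hne
  have hpos : 0 < ‖(z : ℂ) - 1‖ := by
    rw [norm_pos_iff, sub_ne_zero]
    exact fun h => hne (by ext; simpa using h)
  obtain ⟨n, hn⟩ := pow_unbounded_of_one_lt (1 / ‖(z : ℂ) - 1‖) (by norm_num : (1 : ℝ) < 3 / 2)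
  have h1 := (key n).trans (hz _)
  rw [div_lt_iff₀ hpos] at hn
  linarith

/-! ### Nonarchimedean bounds for forms, characters and test functions. -/

section Nonarchimedean

variable {F : Type*} [Field F] [ValuativeRel F] [TopologicalSpace F] [IsNonarchimedeanLocalField F]

lemma nabs_sum_le {ι : Type*} (s : Finset ι) (x : ι → F) {r : ℝ≥0} (h : ∀ i ∈ s, nabs (x i) ≤ r) :
    nabs (∑ i ∈ s, x i) ≤ r := by
  classical
  induction s using Finset.induction_on with
  | empty => simp [nabs_zero]
  | insert i s hi ih =>
    rw [Finset.sum_insert hi]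
    exact (nabs_add_le_max _ _).trans (max_le (h i (Finset.mem_insert_self i s))
      (ih fun j hj => h j (Finset.mem_insert_of_mem hj)))

lemma boxNorm_add_le_max {J : Type*} [Fintype J] (x y : J → F) :
    boxNorm (x + y) ≤ max (boxNorm x) (boxNorm y) :=
  boxNorm_le_iff.2 fun j => (nabs_add_le_max _ _).trans
    (max_le_max (nabs_le_boxNorm x j) (nabs_le_boxNorm y j))

lemma boxNorm_neg {J : Type*} [Fintype J] (x : J → F) : boxNorm (-x) = boxNorm x := by
  simp [boxNorm, nabs_neg]

lemma exists_nabs_quadraticForm_le {n : ℕ} (Q : QuadraticForm F (Fin n → F)) :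
    ∃ P : ℝ≥0, ∀ x, nabs (Q x) ≤ P * boxNorm x ^ 2 := by
  obtain ⟨M, hM⟩ := exists_quadraticForm_eq_sum Q
  refine ⟨Finset.univ.sup fun j => boxNorm (M j), fun x => ?_⟩
  rw [hM]
  refine nabs_sum_le _ _ fun j _ => nabs_sum_le _ _ fun k _ => ?_
  rw [nabs_mul, nabs_mul, mul_comm, sq]
  gcongr
  · exact (nabs_le_boxNorm (M j) k).trans
      (Finset.le_sup (f := fun j => boxNorm (M j)) (Finset.mem_univ j))
  · exact nabs_le_boxNorm x j
  · exact nabs_le_boxNorm x k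

lemma exists_nabs_polar_le {n : ℕ} (Q : QuadraticForm F (Fin n → F)) :
    ∃ P : ℝ≥0, ∀ x y, nabs (QuadraticMap.polar Q x y) ≤ P * boxNorm x * boxNorm y := by
  obtain ⟨M, hM⟩ := exists_quadraticForm_eq_sum Q
  have hp : ∀ x y, QuadraticMap.polar Q x y =
      ∑ j, ∑ k, (x j * y k * M j k + y j * x k * M j k) := fun x y => by
    simp only [QuadraticMap.polar, hM, ← Finset.sum_sub_distrib, Pi.add_apply]
    exact Finset.sum_congr rfl fun j _ => Finset.sum_congr rfl fun k _ => by ring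
  refine ⟨Finset.univ.sup fun j => boxNorm (M j), fun x y => ?_⟩
  rw [hp]
  have hMjk : ∀ j k, nabs (M j k) ≤ Finset.univ.sup fun j => boxNorm (M j) := fun j k =>
    (nabs_le_boxNorm (M j) k).trans
      (Finset.le_sup (f := fun j => boxNorm (M j)) (Finset.mem_univ j))
  refine nabs_sum_le _ _ fun j _ => nabs_sum_le _ _ fun k _ =>
    (nabs_add_le_max _ _).trans (max_le ?_ ?_)
  · rw [nabs_mul, nabs_mul, mul_comm, mul_assoc]
    gcongr
    exacts [hMjk j k, nabs_le_boxNorm x j, nabs_le_boxNorm y k]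
  · rw [nabs_mul, nabs_mul, mul_comm, mul_assoc, mul_comm (nabs (y j))]
    gcongr
    exacts [hMjk j k, nabs_le_boxNorm x k, nabs_le_boxNorm y j]

lemma exists_boxNorm_le_of_polar_le {n : ℕ} {Q : QuadraticForm F (Fin n → F)}
    (hQ : Q.polarBilin.Nondegenerate) :
    ∃ C : ℝ≥0, ∀ x r, (∀ k, nabs (QuadraticMap.polar Q x (Pi.single k 1)) ≤ r) →
      boxNorm x ≤ C * r := by
  obtain ⟨S, hS⟩ := exists_leftInverse_polar hQ
  refine ⟨Finset.univ.sup fun j => boxNorm (S j), fun x r h => boxNorm_le_iff.2 fun j => ?_⟩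
  rw [hS x j]
  refine nabs_sum_le _ _ fun k _ => ?_
  rw [nabs_mul, mul_comm]
  gcongr
  · exact (nabs_le_boxNorm (S k) j).trans
      (Finset.le_sup (f := fun j => boxNorm (S j)) (Finset.mem_univ k))
  · exact h k

lemma exists_nabs_sub_le_of_mem_nhds {x : F} {N : Set F} (hN : N ∈ nhds x) :
    ∃ ρ : ℝ≥0, 0 < ρ ∧ ∀ y, nabs (y - x) ≤ ρ → y ∈ N := by
  have h0 : (fun y => y + x) ⁻¹' N ∈ nhds (0 : F) :=
    (continuous_add_const x).continuousAt.preimage_mem_nhds (by simpa using hN)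
  obtain ⟨γ, hγ, hsub⟩ := (IsValuativeTopology.hasBasis_nhds_zero' F).mem_iff.1 h0
  obtain ⟨c, rfl⟩ := ValuativeRel.valuation_surjective γ
  obtain ⟨ϖ, hϖ0, hϖ1⟩ := exists_nabs_lt_one F
  have hc0 : c ≠ 0 := by simpa using hγ
  refine ⟨nabs (ϖ * c), nabs_pos (mul_ne_zero hϖ0 hc0), fun y hy => ?_⟩
  have hlt : nabs (ϖ * c) < nabs c := by
    rw [nabs_mul]; exact mul_lt_of_lt_one_left (nabs_pos hc0) hϖ1
  simpa using hsub (nabs_lt_nabs_iff.1 (hy.trans_lt hlt))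

omit [Field F] [ValuativeRel F] [TopologicalSpace F] [IsNonarchimedeanLocalField F] in
lemma exists_pos_le {ι : Type*} [Fintype ι] {R : ι → ℝ≥0} (hR : ∀ i, 0 < R i) :
    ∃ r : ℝ≥0, 0 < r ∧ ∀ i, r ≤ R i := by
  refine ⟨(∑ i, (R i)⁻¹ + 1)⁻¹, by positivity, fun i => inv_le_of_inv_le₀ (hR i) ?_⟩
  exact (Finset.single_le_sum_of_canonicallyOrdered (f := fun i => (R i)⁻¹)
    (Finset.mem_univ i)).trans le_self_add

lemma exists_boxNorm_sub_le_of_mem_nhds {d : Fin 3 → ℕ} {x : (i : Fin 3) → Fin (d i) → F}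
    {N : Set ((i : Fin 3) → Fin (d i) → F)} (hN : N ∈ nhds x) :
    ∃ ρ : ℝ≥0, 0 < ρ ∧ ∀ y, (∀ i, boxNorm (y i - x i) ≤ ρ) → y ∈ N := by
  rw [nhds_pi, Filter.mem_pi] at hN
  obtain ⟨I, -, t, ht, hsub⟩ := hN
  have h1 : ∀ i, ∃ ρ : ℝ≥0, 0 < ρ ∧ ∀ y, boxNorm (y - x i) ≤ ρ → y ∈ t i := fun i => by
    have hti := ht i
    rw [nhds_pi, Filter.mem_pi] at hti
    obtain ⟨I', -, t', ht', hsub'⟩ := hti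
    choose R hR hRt using fun j => exists_nabs_sub_le_of_mem_nhds (ht' j)
    obtain ⟨r, hr, hrR⟩ := exists_pos_le hR
    exact ⟨r, hr, fun y hy => hsub' fun j _ =>
      hRt j _ (((nabs_le_boxNorm (y - x i) j).trans hy).trans (hrR j))⟩
  choose R hR hRt using h1
  obtain ⟨r, hr, hrR⟩ := exists_pos_le hR
  exact ⟨r, hr, fun y hy => hsub fun i _ => hRt i _ ((hy i).trans (hrR i))⟩

/-- Small balls are closed under integer multiples, so `ψ` maps them near `1` together with all
powers; the circle has no small subgroups. -/
lemma exists_addChar_eq_one {ψ : AddChar F Circle} (hψ : Continuous ψ) :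
    ∃ ρ : ℝ≥0, 0 < ρ ∧ ∀ y, nabs y ≤ ρ → ψ y = 1 := by
  have hc : Continuous fun y => ‖(ψ y : ℂ) - 1‖ :=
    ((continuous_subtype_val.comp hψ).sub continuous_const).norm
  have h0 : {y : F | ‖(ψ y : ℂ) - 1‖ < 1 / 2} ∈ nhds 0 :=
    hc.continuousAt.preimage_mem_nhds (Iio_mem_nhds (by simp))
  obtain ⟨ρ, hρ, hsub⟩ := exists_nabs_sub_le_of_mem_nhds h0
  refine ⟨ρ, hρ, fun y hy => circle_eq_one_of_forall_pow fun n => ?_⟩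
  rw [← AddChar.map_nsmul_eq_pow]
  have hn : nabs (n • y) ≤ nabs y := by
    rw [← Finset.card_range n, ← Finset.sum_const]
    exact nabs_sum_le _ _ fun _ _ => le_rfl
  exact (hsub (n • y) (by rw [sub_zero]; exact hn.trans hy)).le

/-- If `ψ` is trivial on the multiples `s p` with `|s| ≤ r`, then `|p| ≤ |t₀| / r`, where
`ψ t₀ ≠ 1`. -/
lemma nabs_le_of_addChar_eq_one {ψ : AddChar F Circle} {t₀ : F} (ht₀ : ψ t₀ ≠ 1) {p : F} {r : ℝ≥0}
    (hr : 0 < r) (h : ∀ s : F, nabs s ≤ r → ψ (s * p) = 1) : nabs p ≤ nabs t₀ / r := by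
  rcases eq_or_ne p 0 with rfl | hp
  · simp [nabs_zero]
  have h1 : ¬ nabs (t₀ / p) ≤ r := fun hle => ht₀ (by
    rw [← h _ hle, div_mul_cancel₀ _ hp])
  rw [nabs_div, not_le, lt_div_iff₀ (nabs_pos hp)] at h1
  rw [le_div_iff₀ hr, mul_comm]
  exact h1.le

variable {d : Fin 3 → ℕ}

lemma continuous_boxNorm {J : Type*} [Fintype J] : Continuous (boxNorm : (J → F) → ℝ≥0) := by
  have := continuous_nabs_of_nonarch (F := F)
  unfold boxNorm
  exact Continuous.finset_sup_apply fun j _ => this.comp (continuous_apply j)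

lemma exists_boxNorm_le_of_hasCompactSupport {f : ((i : Fin 3) → Fin (d i) → F) → ℂ}
    (hf : HasCompactSupport f) : ∃ R : ℝ≥0, ∀ u, f u ≠ 0 → ∀ i, boxNorm (u i) ≤ R := by
  have hc : ∀ i, Continuous fun u : (i : Fin 3) → Fin (d i) → F => boxNorm (u i) := fun i =>
    continuous_boxNorm.comp (continuous_apply i)
  choose R hR using fun i => (IsCompact.bddAbove_image hf.isCompact (hc i).continuousOn)
  refine ⟨Finset.univ.sup R, fun u hu i => ?_⟩
  exact (hR i ⟨u, subset_tsupport f hu, rfl⟩).trans (Finset.le_sup (Finset.mem_univ i))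

/-- A ball on which `f` is constant is stable under translation by vectors no larger than its
radius, and finitely many such balls cover the support. -/
lemma exists_forall_add_eq {f : ((i : Fin 3) → Fin (d i) → F) → ℂ} (hf : IsLocallyConstant f)
    (hfc : HasCompactSupport f) :
    ∃ r : ℝ≥0, 0 < r ∧ ∀ u l, (∀ i, boxNorm (l i) ≤ r) → f (u + l) = f u := by
  have key : ∃ r : ℝ≥0, 0 < r ∧ ∀ u ∈ tsupport f, ∀ l, (∀ i, boxNorm (l i) ≤ r) →
      f (u + l) = f u := by
    refine IsCompact.induction_on hfc.isCompact (p := fun s => ∃ r : ℝ≥0, 0 < r ∧ ∀ u ∈ s, ∀ l,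
      (∀ i, boxNorm (l i) ≤ r) → f (u + l) = f u) ⟨1, one_pos, by simp⟩ ?_ ?_ ?_
    · rintro s t hst ⟨r, hr, h⟩
      exact ⟨r, hr, fun u hu => h u (hst hu)⟩
    · rintro s t ⟨r, hr, h⟩ ⟨r', hr', h'⟩
      refine ⟨min r r', lt_min hr hr', fun u hu l hl => ?_⟩
      rcases hu with hu | hu
      · exact h u hu l fun i => (hl i).trans (min_le_left _ _)
      · exact h' u hu l fun i => (hl i).trans (min_le_right _ _)
    · intro x _
      have hx : {y | f y = f x} ∈ nhds x := (hf.eventually_eq x)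
      obtain ⟨r, hr, hsub⟩ := exists_boxNorm_sub_le_of_mem_nhds hx
      refine ⟨{y | f y = f x ∧ ∀ i, boxNorm (y i - x i) ≤ r}, mem_nhdsWithin_of_mem_nhds ?_, r, hr,
        fun y hy l hl => (hsub (y + l) fun i => ?_).trans hy.1.symm⟩
      · filter_upwards [hx, set_pi_mem_nhds Set.finite_univ fun i _ =>
          ((continuous_boxNorm.comp (continuous_sub_right (x i))).continuousAt.preimage_mem_nhds
            (Iic_mem_nhds (by simpa [boxNorm_zero] using hr)))] with y hy hy2
        exact ⟨hy, fun i => hy2 i (Set.mem_univ i)⟩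
      · rw [Pi.add_apply, add_sub_right_comm]
        exact (boxNorm_add_le_max _ _).trans (max_le (hy.2 i) (hl i))
  obtain ⟨r, hr, h⟩ := key
  refine ⟨r, hr, fun u l hl => ?_⟩
  by_cases hu : u ∈ tsupport f
  · exact h u hu l hl
  -- For `u` off the support, a translate that enters it is brought back by `-l`.
  by_cases hul : u + l ∈ tsupport f
  · have := h (u + l) hul (-l) fun i => by rw [Pi.neg_apply, boxNorm_neg]; exact hl i
    rw [add_neg_cancel_right] at this
    exact this.symm
  · rw [image_eq_zero_of_notMem_tsupport hu, image_eq_zero_of_notMem_tsupport hul]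

end Nonarchimedean

lemma IsLocalModulus.measure_box_le {F : Type*} [Field F] [TopologicalSpace F]
    [IsTopologicalRing F] [LocallyCompactSpace F] [T2Space F] [SecondCountableTopology F]
    [MeasurableSpace F] [BorelSpace F] (hF : IsLocalModulus F) {d : Fin 3 → ℕ}
    (μV : Measure ((i : Fin 3) → Fin (d i) → F)) [μV.IsAddHaarMeasure] :
    ∃ C : ℝ≥0, ∀ r : Fin 3 → ℝ≥0, (∀ i, 0 < r i) →
      μV {h | ∀ i, boxNorm (h i) ≤ r i} ≤ ((C * ∏ i, r i ^ d i : ℝ≥0) : ℝ≥0∞) := by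
  let μ : Measure F := Measure.addHaar
  obtain ⟨C, hC⟩ := hF.measure_le μ
  let ν : Measure ((i : Fin 3) → Fin (d i) → F) :=
    Measure.pi fun i => Measure.pi fun _ : Fin (d i) => μ
  obtain ⟨c, hν⟩ : ∃ c : ℝ≥0, μV = c • ν := ⟨_, Measure.isAddLeftInvariant_eq_smul μV ν⟩
  refine ⟨c * ∏ i, C ^ d i, fun r hr => ?_⟩
  have hset : {h : (i : Fin 3) → Fin (d i) → F | ∀ i, boxNorm (h i) ≤ r i} =
      Set.univ.pi fun i => Set.univ.pi fun _ : Fin (d i) => {x : F | nabs x ≤ r i} := by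
    ext h; simp [boxNorm_le_iff]
  rw [hν, hset, Measure.smul_apply, Measure.pi_pi]
  simp_rw [Measure.pi_pi, Finset.prod_const, Finset.card_univ, Fintype.card_fin]
  rw [ENNReal.smul_def, smul_eq_mul, mul_assoc, ← Finset.prod_mul_distrib, ENNReal.coe_mul,
    ENNReal.ofNNReal_finsetProd]
  gcongr with i
  rw [← mul_pow, ENNReal.coe_pow]
  gcongr
  exact_mod_cast hC (r i) (hr i)

/-! ### Oscillatory decay over nonarchimedean fields. -/

section Nonarchimedean

variable {F : Type*} [Field F] [ValuativeRel F] [TopologicalSpace F] [IsNonarchimedeanLocalField F]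
  [MeasurableSpace F] [BorelSpace F] {d : Fin 3 → ℕ}
  (μV : Measure ((i : Fin 3) → Fin (d i) → F)) [μV.IsAddHaarMeasure]
  {ψ : AddChar F Circle} (hψ : Continuous ψ) (hψ1 : ψ ≠ 1)
  {Q : (i : Fin 3) → QuadraticForm F (Fin (d i) → F)} (hQ : ∀ i, (Q i).polarBilin.Nondegenerate)
  {f : ((i : Fin 3) → Fin (d i) → F) → ℂ} (hf : IsLocallyConstant f) (hfc : HasCompactSupport f)

omit [MeasurableSpace F] [BorelSpace F] in
lemma boxNorm_single {n : ℕ} (j : Fin n) (s : F) :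
    boxNorm (Pi.single j s : Fin n → F) = nabs s := by
  refine le_antisymm (boxNorm_le_iff.2 fun k => ?_) ?_
  · rcases eq_or_ne k j with rfl | h
    · simp
    · simp [h, nabs_zero]
  · simpa using nabs_le_boxNorm (Pi.single j s : Fin n → F) j

omit [ValuativeRel F] [TopologicalSpace F] [IsNonarchimedeanLocalField F] [MeasurableSpace F]
  [BorelSpace F] in
lemma polar_single {n : ℕ} (Q : QuadraticForm F (Fin n → F)) (x : Fin n → F) (j : Fin n) (s : F) :
    QuadraticMap.polar Q x (Pi.single j s) = s * QuadraticMap.polar Q x (Pi.single j 1) := by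
  rw [← smul_eq_mul, ← QuadraticMap.polar_smul_right, ← Pi.single_smul, smul_eq_mul, mul_one]

omit [ValuativeRel F] [TopologicalSpace F] [IsNonarchimedeanLocalField F] [MeasurableSpace F]
  [BorelSpace F] in
lemma sum_polar_single (w : Fin 3 → F) (u : (i : Fin 3) → Fin (d i) → F) (i : Fin 3)
    (y : Fin (d i) → F) :
    ∑ k, w k * QuadraticMap.polar (Q k) (u k) ((Pi.single i y : (i : Fin 3) → Fin (d i) → F) k) =
      w i * QuadraticMap.polar (Q i) (u i) y := by
  rw [Finset.sum_eq_single i]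
  · simp
  · intro k _ hk; simp [hk]
  · simp

omit [ValuativeRel F] [TopologicalSpace F] [IsNonarchimedeanLocalField F] [MeasurableSpace F]
  [BorelSpace F] in
lemma quadPhase_single (x : (i : Fin 3) → Fin (d i) → F) (w : Fin 3 → F) (i : Fin 3)
    (y : Fin (d i) → F) :
    quadPhase Q x w (Pi.single i y) = QuadraticMap.polar (Q i) (x i) y + w i * Q i y := by
  rw [quadPhase, Finset.sum_eq_single i, Finset.sum_eq_single i]
  · simp
  · intro k _ hk; simp [hk]
  · simp
  · intro k _ hk; simp [hk]
  · simp

omit [MeasurableSpace F] [BorelSpace F] in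
lemma boxNorm_single_le {i : Fin 3} {j : Fin (d i)} {s : F} {r : ℝ≥0} (hs : nabs s ≤ r)
    (k : Fin 3) :
    boxNorm ((Pi.single i (Pi.single j s) : (i : Fin 3) → Fin (d i) → F) k) ≤ r := by
  rcases eq_or_ne k i with rfl | hk
  · rwa [Pi.single_eq_same, boxNorm_single]
  · rw [Pi.single_eq_of_ne hk, boxNorm_zero]; exact zero_le

include hψ hψ1 hQ hf hfc

/-- Translation in block `i` by a vector of size at most `τ / max 1 |wᵢ|` changes neither `f` nor,
on the support of `f`, the character value of the quadratic part; it multiplies the integral by the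
character of `⟨xᵢ, l⟩ᵢ`. A nonzero integral forces this factor to be `1` for all such translations,
which bounds `xᵢ` by nondegeneracy. -/
theorem exists_boxNorm_le_of_oscillatory_ne_zero :
    ∃ C : ℝ≥0, ∀ x w, ∫ u, (ψ (quadPhase Q x w u) : ℂ) * f u ∂μV ≠ 0 →
      ∀ i, boxNorm (x i) ≤ C * max 1 (nabs (w i)) := by
  have := secondCountableTopology_of_nonarch F
  have := t2Space_of_nonarch F
  obtain ⟨R, hR⟩ := exists_boxNorm_le_of_hasCompactSupport hfc
  obtain ⟨r, hr0, hr⟩ := exists_forall_add_eq hf hfc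
  obtain ⟨ρ, hρ0, hρ⟩ := exists_addChar_eq_one hψ
  obtain ⟨t₀, ht₀⟩ := AddChar.ne_one_iff.1 hψ1
  choose P₁ hP₁ using fun i => exists_nabs_quadraticForm_le (Q i)
  choose P₂ hP₂ using fun i => exists_nabs_polar_le (Q i)
  choose D hD using fun i => exists_boxNorm_le_of_polar_le (hQ i)
  -- `P` dominates the constants in both quadratic contributions of a translation `l`, namely
  -- `Qᵢ(l)` and `⟨uᵢ, l⟩ᵢ` with `u` in the support. Hence `τ ≤ ρ / P` keeps them in the ball where
  -- `ψ` is trivial.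
  set P : ℝ≥0 := Finset.univ.sup P₁ + Finset.univ.sup P₂ * R + 1 with hP
  have hP0 : 0 < P := by positivity
  set τ : ℝ≥0 := min (min 1 r) (ρ / P) with hτ
  have hτ0 : 0 < τ := by positivity
  refine ⟨Finset.univ.sup D * (nabs t₀ / τ), fun x w hI i => ?_⟩
  set W := max 1 (nabs (w i)) with hW
  have hW0 : 0 < W := one_pos.trans_le (le_max_left _ _)
  have hbound := hD i (x i) (nabs t₀ / (τ / W)) fun j =>
    nabs_le_of_addChar_eq_one ht₀ (div_pos hτ0 hW0) fun s hs => ?_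
  · refine hbound.trans ?_
    rw [div_div_eq_mul_div, mul_div_right_comm, mul_assoc]
    gcongr
    exact Finset.le_sup (Finset.mem_univ i)
  have hsτ : nabs s ≤ τ := hs.trans (div_le_self zero_le (le_max_left _ _))
  have hs1 : nabs s ≤ 1 := hsτ.trans ((min_le_left _ _).trans (min_le_left _ _))
  have hsr : nabs s ≤ r := hsτ.trans ((min_le_left _ _).trans (min_le_right _ _))
  have hsw : nabs (w i) * nabs s ≤ ρ / P :=
    calc nabs (w i) * nabs s ≤ W * (τ / W) := by gcongr; exact le_max_right _ _
      _ = τ := mul_div_cancel₀ _ hW0.ne'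
      _ ≤ _ := min_le_right _ _
  set l : (i : Fin 3) → Fin (d i) → F := Pi.single i (Pi.single j s) with hl
  have hfl : ∀ u, f (u + l) = f u := fun u => hr u l (boxNorm_single_le hsr)
  have h1 : ψ (w i * Q i (Pi.single j s)) = 1 := hρ _ <| by
    rw [nabs_mul]
    calc nabs (w i) * nabs (Q i (Pi.single j s)) ≤ nabs (w i) * (P₁ i * nabs s ^ 2) := by
          gcongr
          simpa [boxNorm_single] using hP₁ i (Pi.single j s)
      _ = (nabs (w i) * nabs s) * (P₁ i * nabs s) := by ring
      _ ≤ ρ / P * (P * 1) := by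
          gcongr
          exact (Finset.le_sup (f := P₁) (Finset.mem_univ i)).trans
            (by rw [hP, add_assoc]; exact le_self_add)
      _ = ρ := by rw [mul_one, div_mul_cancel₀ _ hP0.ne']
  have h2 : ∀ u, f u ≠ 0 → ψ (w i * QuadraticMap.polar (Q i) (u i) (Pi.single j s)) = 1 :=
    fun u hu => hρ _ <| by
    rw [nabs_mul]
    calc nabs (w i) * nabs (QuadraticMap.polar (Q i) (u i) (Pi.single j s))
        ≤ nabs (w i) * (P₂ i * boxNorm (u i) * nabs s) := by
          gcongr
          simpa [boxNorm_single] using hP₂ i (u i) (Pi.single j s)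
      _ = (nabs (w i) * nabs s) * (P₂ i * boxNorm (u i)) := by ring
      _ ≤ ρ / P * P := by
          gcongr
          calc P₂ i * boxNorm (u i) ≤ Finset.univ.sup P₂ * R := by
                gcongr
                exacts [Finset.le_sup (f := P₂) (Finset.mem_univ i), hR u hu i]
            _ ≤ P := by rw [hP, add_assoc, add_left_comm]; exact le_self_add
      _ = ρ := by rw [div_mul_cancel₀ _ hP0.ne']
  set c : Circle := ψ (s * QuadraticMap.polar (Q i) (x i) (Pi.single j 1)) with hc
  have hI2 : ∫ u, (ψ (quadPhase Q x w u) : ℂ) * f u ∂μV =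
      c * ∫ u, (ψ (quadPhase Q x w u) : ℂ) * f u ∂μV := by
    conv_lhs => rw [← integral_add_right_eq_self _ l]
    rw [← integral_const_mul]
    refine integral_congr_ae (Filter.Eventually.of_forall fun u => ?_)
    simp only
    rw [hfl]
    by_cases hu : f u = 0
    · simp [hu]
    rw [quadPhase_add, hl, sum_polar_single, quadPhase_single, AddChar.map_add_eq_mul,
      AddChar.map_add_eq_mul, AddChar.map_add_eq_mul, h1, h2 u hu, polar_single, ← hc]
    simp only [mul_one, Circle.coe_mul]
    ring
  have hc1 : (c : ℂ) = 1 := by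
    have : ((c : ℂ) - 1) * ∫ u, (ψ (quadPhase Q x w u) : ℂ) * f u ∂μV = 0 := by
      rw [sub_mul, one_mul, ← hI2, sub_self]
    rcases mul_eq_zero.1 this with h | h
    · exact sub_eq_zero.1 h
    · exact absurd h hI
  exact Circle.ext hc1

omit hψ in
-- Two constraints combine. The supports of `f` and its translate must meet, which bounds `hᵢ`.
-- Invariance of `f` under small translations makes the correlation vanish unless the character of
-- frequency `wᵢ hᵢ` is trivial on them, which bounds `wᵢ hᵢ`.
theorem exists_boxNorm_le_of_twistedCorrelation_ne_zero :
    ∃ C : ℝ≥0, 0 < C ∧ ∀ w h, twistedCorrelation μV ψ Q w f f h ≠ 0 →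
      ∀ i, max 1 (nabs (w i)) * boxNorm (h i) ≤ C := by
  have := secondCountableTopology_of_nonarch F
  have := t2Space_of_nonarch F
  obtain ⟨R, hR⟩ := exists_boxNorm_le_of_hasCompactSupport hfc
  obtain ⟨r, hr0, hr⟩ := exists_forall_add_eq hf hfc
  obtain ⟨t₀, ht₀⟩ := AddChar.ne_one_iff.1 hψ1
  choose D hD using fun i => exists_boxNorm_le_of_polar_le (hQ i)
  refine ⟨max (max 1 R) (Finset.univ.sup D * (nabs t₀ / r)), by positivity, fun w h hK i => ?_⟩
  have hhR : boxNorm (h i) ≤ R := by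
    by_contra! hcon
    refine hK ?_
    rw [twistedCorrelation, integral_eq_zero_of_ae (Filter.Eventually.of_forall fun u => ?_)]
    rw [Pi.zero_apply]
    by_contra hne
    have hu1 : f (u + h) ≠ 0 := fun h0 => hne (by simp [h0])
    have hu2 : f u ≠ 0 := fun h0 => hne (by simp [h0])
    have h3 := boxNorm_add_le_max ((u + h) i) (-(u i))
    rw [Pi.add_apply, add_neg_cancel_comm, boxNorm_neg] at h3
    exact absurd (h3.trans (max_le (hR _ hu1 i) (hR _ hu2 i))) (not_le.2 hcon)
  have hwR : boxNorm (w i • h i) ≤ D i * (nabs t₀ / r) := by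
    refine hD i _ _ fun j => nabs_le_of_addChar_eq_one ht₀ hr0 fun s hs => ?_
    set l : (i : Fin 3) → Fin (d i) → F := Pi.single i (Pi.single j s) with hl
    have hfl : ∀ u, f (u + l) = f u := fun u => hr u l (boxNorm_single_le hs)
    set c : Circle := ψ (s * QuadraticMap.polar (Q i) (w i • h i) (Pi.single j 1)) with hc
    have hI2 : twistedCorrelation μV ψ Q w f f h = c * twistedCorrelation μV ψ Q w f f h := by
      conv_lhs => rw [twistedCorrelation, ← integral_add_right_eq_self _ l]
      rw [twistedCorrelation, ← integral_const_mul]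
      refine integral_congr_ae (Filter.Eventually.of_forall fun u => ?_)
      simp only
      have e : ∑ k, w k * QuadraticMap.polar (Q k) ((u + l) k) (h k) =
          s * QuadraticMap.polar (Q i) (w i • h i) (Pi.single j 1) +
            ∑ k, w k * QuadraticMap.polar (Q k) (u k) (h k) := by
        simp_rw [Pi.add_apply, QuadraticMap.polar_add_left, mul_add, Finset.sum_add_distrib]
        rw [add_comm]
        congr 1
        simp_rw [QuadraticMap.polar_comm _ (l _)]
        rw [hl, sum_polar_single, polar_single, QuadraticMap.polar_smul_left, smul_eq_mul]
        ring
      rw [add_right_comm, hfl, hfl, e, AddChar.map_add_eq_mul, ← hc, Circle.coe_mul]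
      ring
    have : ((c : ℂ) - 1) * twistedCorrelation μV ψ Q w f f h = 0 := by
      rw [sub_mul, one_mul, ← hI2, sub_self]
    rcases mul_eq_zero.1 this with h' | h'
    · exact Circle.ext (sub_eq_zero.1 h')
    · exact absurd h' hK
  rw [boxNorm_smul] at hwR
  rcases le_total 1 (nabs (w i)) with hw | hw
  · rw [max_eq_right hw]
    refine hwR.trans (le_max_of_le_right ?_)
    gcongr
    exact Finset.le_sup (Finset.mem_univ i)
  · rw [max_eq_left hw, one_mul]
    exact hhR.trans (le_max_of_le_left (le_max_right _ _))

/-- The correlation is bounded by `sup |f|` times the `L¹` norm of `f` and lives on a box of volume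
`O(∏ W i ^ (-d i))`; differencing turns this into a bound for the squared integral. -/
theorem hasOscillatoryDecay_of_nonarch : ∃ C : ℝ≥0, HasOscillatoryDecay μV ψ Q f C := by
  have := secondCountableTopology_of_nonarch F
  have := t2Space_of_nonarch F
  obtain ⟨C₁, hC₁⟩ := exists_boxNorm_le_of_oscillatory_ne_zero μV hψ hψ1 hQ hf hfc
  obtain ⟨C₂, hC₂0, hC₂⟩ := exists_boxNorm_le_of_twistedCorrelation_ne_zero μV hψ1 hQ hf hfc
  obtain ⟨C₃, hC₃⟩ := (isLocalModulus_of_nonarch F).measure_box_le μV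
  obtain ⟨B, hB⟩ := hf.continuous.bounded_above_of_compact_support hfc
  have hfi : Integrable f μV := hf.continuous.integrable_of_hasCompactSupport hfc
  set N : ℝ≥0 := (∫⁻ u, ‖f u‖ₑ ∂μV).toNNReal
  have hN : (N : ℝ≥0∞) = ∫⁻ u, ‖f u‖ₑ ∂μV := ENNReal.coe_toNNReal hfi.hasFiniteIntegral.ne
  set M : ℝ≥0 := B.toNNReal * N
  have hM : ∀ w h, ‖twistedCorrelation μV ψ Q w f f h‖ₑ ≤ M := fun w h => by
    refine (enorm_integral_le_lintegral_enorm _).trans ?_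
    rw [ENNReal.coe_mul, hN, ← lintegral_const_mul' _ _ ENNReal.coe_ne_top]
    refine lintegral_mono fun u => ?_
    rw [enorm_mul, enorm_mul, RCLike.enorm_conj, ← ofReal_norm (ψ _ : ℂ), Circle.norm_coe,
      ENNReal.ofReal_one, one_mul]
    gcongr
    rw [← ofReal_norm]
    exact ENNReal.ofReal_le_ofReal (hB _)
  set A : ℝ≥0 := M * (C₃ * ∏ i, C₂ ^ d i) with hA
  set D : ℝ≥0 := max 1 C₁ with hD
  refine ⟨NNReal.sqrt A * ∏ i, D ^ ((d i : ℝ) / 2), fun x w => ?_⟩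
  set I : ℂ := ∫ u, (ψ (quadPhase Q x w u) : ℂ) * f u ∂μV with hI
  change ‖I‖₊ ≤ _
  rcases eq_or_ne I 0 with h0 | h0
  · rw [h0, nnnorm_zero]; exact zero_le
  have hx := hC₁ x w h0
  set W : Fin 3 → ℝ≥0 := fun i => max 1 (nabs (w i)) with hW
  have hW0 : ∀ i, 0 < W i := fun i => one_pos.trans_le (le_max_left _ _)
  have hsq : ‖I‖₊ ^ 2 ≤ A * ∏ i, ((W i) ^ d i)⁻¹ := by
    rw [← ENNReal.coe_le_coe]
    calc ((‖I‖₊ ^ 2 : ℝ≥0) : ℝ≥0∞) = ‖I‖ₑ ^ 2 := by push_cast; rfl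
      _ ≤ ∫⁻ h, ‖twistedCorrelation μV ψ Q w f f h‖ₑ ∂μV :=
          enorm_oscillatory_sq_le μV hψ Q x w hfi
      _ ≤ ∫⁻ h in {h | ∀ i, boxNorm (h i) ≤ C₂ / W i}, M ∂μV := by
          rw [← setLIntegral_eq_of_support_subset (s := {h | ∀ i, boxNorm (h i) ≤ C₂ / W i})]
          · exact lintegral_mono fun h => hM w h
          · intro h hh i
            rw [Function.mem_support, enorm_ne_zero] at hh
            rw [le_div_iff₀ (hW0 i), mul_comm]
            exact hC₂ w h hh i
      _ = M * μV {h | ∀ i, boxNorm (h i) ≤ C₂ / W i} := by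
          rw [setLIntegral_const]
      _ ≤ M * ((C₃ * ∏ i, (C₂ / W i) ^ d i : ℝ≥0) : ℝ≥0∞) := by
          gcongr
          exact hC₃ _ fun i => div_pos hC₂0 (hW0 i)
      _ = _ := by
          rw [← ENNReal.coe_mul, hA]
          simp_rw [div_pow, div_eq_mul_inv, Finset.prod_mul_distrib]
          congr 1
          ring
  have hI2 : ‖I‖₊ ≤ NNReal.sqrt A * ∏ i, W i ^ (-((d i : ℝ) / 2)) := by
    rw [← NNReal.sqrt_sq ‖I‖₊]
    refine (NNReal.sqrt_le_sqrt.2 hsq).trans (le_of_eq ?_)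
    rw [NNReal.sqrt_mul, NNReal.sqrt_eq_rpow (∏ i, _), ← NNReal.finsetProd_rpow]
    congr 1
    refine Finset.prod_congr rfl fun i _ => ?_
    rw [← NNReal.rpow_natCast, ← NNReal.rpow_neg, ← NNReal.rpow_mul]
    congr 1
    ring
  refine hI2.trans ?_
  rw [mul_assoc, ← Finset.prod_mul_distrib]
  gcongr with i
  -- Where the integral is nonzero, `|xᵢ| ≤ C₁ W i`, so decay in `W i` is already decay in the full
  -- radius, up to powers of `D`.
  have hm : max 1 (max (boxNorm (x i)) (nabs (w i))) ≤ D * W i := by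
    refine max_le ?_ (max_le ?_ ?_)
    · exact one_le_mul (le_max_left _ _) (le_max_left _ _)
    · refine (hx i).trans ?_
      gcongr
      exact le_max_right _ _
    · exact (le_max_right _ _).trans (le_mul_of_one_le_left zero_le (le_max_left _ _))
  have hD0 : 0 < D := one_pos.trans_le (le_max_left _ _)
  calc W i ^ (-((d i : ℝ) / 2)) = D ^ ((d i : ℝ) / 2) * (D * W i) ^ (-((d i : ℝ) / 2)) := by
        rw [NNReal.mul_rpow, ← mul_assoc, ← NNReal.rpow_add hD0.ne', add_neg_cancel,
          NNReal.rpow_zero, one_mul]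
    _ ≤ _ := mul_le_mul_right (rpow_neg_le_rpow_neg (le_max_left _ _) hm (by positivity)) _

end Nonarchimedean

/-! ### Archimedean fields: absolute value, characters and weighted bounds. -/

section Archimedean

variable {F : Type*} [RCLike F]

open scoped Pointwise in
lemma nabs_eq_nnnorm_pow (z : F) : nabs z = ‖z‖₊ ^ Module.finrank ℝ F := by
  rcases eq_or_ne z 0 with rfl | hz
  · simp [nabs_zero, Module.finrank_pos.ne']
  rw [nabs_of_ne_zero hz]
  have h0 := (Metric.measure_ball_pos (Measure.addHaar (G := F)) 0 one_pos).ne'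
  have h1 := (measure_ball_lt_top (μ := Measure.addHaar (G := F)) (x := 0) (r := 1)).ne
  have hc : Measure.addHaar (Metric.closedBall (0 : F) 1) = Measure.addHaar (Metric.ball (0 : F) 1) := by
    rw [Measure.addHaar_closedBall _ _ zero_le_one]; simp
  refine distribHaarChar_eq_of_measure_smul_eq_mul (μ := Measure.addHaar)
    (s := Metric.closedBall (0 : F) 1) (hc ▸ h0) (hc ▸ h1) ?_
  have hs : Units.mk0 z hz • Metric.closedBall (0 : F) 1 = Metric.closedBall 0 ‖z‖ := by
    have : Units.mk0 z hz • Metric.closedBall (0 : F) 1 = z • Metric.closedBall (0 : F) 1 := rfl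
    rw [this, smul_closedBall _ _ zero_le_one, smul_zero, mul_one]
  rw [hs, Measure.addHaar_closedBall _ _ (norm_nonneg z), hc, ENNReal.ofReal_pow (norm_nonneg z),
    ofReal_norm, ENNReal.coe_pow, enorm_eq_nnnorm]

variable (F) in
theorem isLocalModulus_of_arch : IsLocalModulus F where
  continuous := by
    have : (nabs : F → ℝ≥0) = fun z => ‖z‖₊ ^ Module.finrank ℝ F := funext nabs_eq_nnnorm_pow
    rw [this]; fun_prop
  isCompact := by
    convert isCompact_closedBall (0 : F) 1 using 1
    ext z
    rw [Set.mem_ofPred_eq, nabs_eq_nnnorm_pow, mem_closedBall_zero_iff,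
      pow_le_one_iff_of_nonneg zero_le Module.finrank_pos.ne', ← NNReal.coe_le_coe]
    rfl
  quasi := ⟨2 ^ Module.finrank ℝ F, fun x y => by
    have hmax : max ‖x‖₊ ‖y‖₊ ^ Module.finrank ℝ F ≤
        max (‖x‖₊ ^ Module.finrank ℝ F) (‖y‖₊ ^ Module.finrank ℝ F) := by
      rcases le_total ‖x‖₊ ‖y‖₊ with h | h
      · rw [max_eq_right h]; exact le_max_right _ _
      · rw [max_eq_left h]; exact le_max_left _ _
    rw [nabs_eq_nnnorm_pow, nabs_eq_nnnorm_pow, nabs_eq_nnnorm_pow]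
    refine le_trans ?_ (mul_le_mul_right hmax _)
    rw [← mul_pow]
    gcongr
    calc ‖x + y‖₊ ≤ ‖x‖₊ + ‖y‖₊ := nnnorm_add_le _ _
      _ ≤ max ‖x‖₊ ‖y‖₊ + max ‖x‖₊ ‖y‖₊ := add_le_add (le_max_left _ _) (le_max_right _ _)
      _ = _ := (two_mul _).symm⟩
  exists_lt_one := ⟨2⁻¹, by simp, by
    rw [nabs_eq_nnnorm_pow, nnnorm_inv, RCLike.nnnorm_ofNat]
    exact pow_lt_one₀ zero_le (by norm_num) Module.finrank_pos.ne'⟩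

lemma boxNorm_eq_nnnorm_pow {J : Type*} [Fintype J] (y : J → F) :
    boxNorm y = ‖y‖₊ ^ Module.finrank ℝ F := by
  refine le_antisymm (boxNorm_le_iff.2 fun j => ?_) ?_
  · rw [nabs_eq_nnnorm_pow]
    gcongr
    exact nnnorm_le_pi_nnnorm y j
  · rcases isEmpty_or_nonempty J with h | h
    · have : y = 0 := Subsingleton.elim _ _
      simp [this, Module.finrank_pos.ne']
    · obtain ⟨j, -, hj⟩ := Finset.exists_mem_eq_sup Finset.univ Finset.univ_nonempty
        (fun j => ‖y j‖₊)
      rw [Pi.nnnorm_def, hj, ← nabs_eq_nnnorm_pow]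
      exact nabs_le_boxNorm y j

lemma nabs_tildeArch {J : Type*} [Fintype J] (y : J → F) :
    nabs (tildeArch y : F) = boxNorm y := by
  rw [nabs_eq_nnnorm_pow, tildeArch, ← NNReal.coe_inj, NNReal.coe_pow, coe_nnnorm,
    RCLike.norm_ofReal, abs_of_nonneg (by positivity), ← Real.rpow_natCast, ← Real.rpow_mul
    (NNReal.coe_nonneg _), one_div_mul_cancel (by exact_mod_cast Module.finrank_pos.ne'),
    Real.rpow_one]

end Archimedean

/-- Averaging makes a continuous character differentiable: its primitive `G` satisfies `G (t + δ) -
G t = g t * G δ`. The derivative is then a constant multiple of `g`, and `|g| = 1` makes the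
constant imaginary. -/
lemma exists_addChar_real_eq_exp {φ : AddChar ℝ Circle} (hφ : Continuous φ) :
    ∃ a : ℝ, ∀ t, (φ t : ℂ) = Complex.exp (Complex.I * (a * t : ℝ)) := by
  set g : ℝ → ℂ := fun t => (φ t : ℂ) with hg
  have hgc : Continuous g := continuous_subtype_val.comp hφ
  have hg0 : g 0 = 1 := by simp [hg]
  have hgadd : ∀ s t, g (s + t) = g s * g t := fun s t => by simp [hg, AddChar.map_add_eq_mul]
  set G : ℝ → ℂ := fun t => ∫ x in (0 : ℝ)..t, g x with hG
  have hGd : ∀ t, HasDerivAt G (g t) t := fun t =>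
    intervalIntegral.integral_hasDerivAt_right (hgc.intervalIntegrable _ _)
      (hgc.stronglyMeasurableAtFilter _ _) hgc.continuousAt
  have hne : ∃ δ, G δ ≠ 0 := by
    by_contra! hcon
    have h1 := hGd 0
    have h2 : G = fun _ => 0 := funext hcon
    rw [h2, hg0] at h1
    exact one_ne_zero (h1.unique (hasDerivAt_const (0 : ℝ) (0 : ℂ)))
  obtain ⟨δ, hδ⟩ := hne
  have hshift : ∀ t, G (t + δ) - G t = g t * G δ := fun t => by
    rw [hG]
    simp only
    rw [intervalIntegral.integral_interval_sub_left (hgc.intervalIntegrable _ _)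
      (hgc.intervalIntegrable _ _), ← intervalIntegral.integral_const_mul]
    simp_rw [← hgadd]
    rw [intervalIntegral.integral_comp_add_left (fun x => g x) t, add_zero]
  have hgd : ∀ t, HasDerivAt g ((g (t + δ) - g t) / G δ) t := fun t => by
    have h1 := ((hGd (t + δ)).comp_add_const t δ).sub (hGd t)
    have h2 := h1.div_const (G δ)
    refine h2.congr_of_eventuallyEq (Filter.Eventually.of_forall fun s => ?_)
    have := hshift s
    simp only [Pi.sub_apply]
    rw [this, mul_div_cancel_right₀ _ hδ]
  set α : ℂ := (g δ - 1) / G δ with hα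
  have hgd' : ∀ t, HasDerivAt g (g t * α) t := fun t => by
    convert! hgd t using 1
    rw [hgadd, hα]; ring
  have hexp : ∀ t : ℝ, g t = Complex.exp (α * t) := by
    have hd : ∀ t : ℝ, HasDerivAt (fun s : ℝ => g s * Complex.exp (-(α * s))) 0 t := fun t => by
      have h1 : HasDerivAt (fun s : ℝ => -(α * (s : ℂ))) (-(α * 1)) t :=
        ((Complex.ofRealCLM.hasDerivAt (x := t)).const_mul α).neg
      convert! (hgd' t).mul h1.cexp using 1
      ring
    intro t
    have h := is_const_of_deriv_eq_zero (fun t => (hd t).differentiableAt) (fun t => (hd t).deriv) t 0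
    simp only [hg0, Complex.ofReal_zero, mul_zero, neg_zero, Complex.exp_zero, mul_one] at h
    rw [Complex.exp_neg] at h
    field_simp at h
    exact h
  have hre : α.re = 0 := by
    have h1 : ‖g 1‖ = 1 := Circle.norm_coe _
    rw [hexp, Complex.norm_exp] at h1
    simpa using h1
  refine ⟨α.im, fun t => ?_⟩
  change g t = _
  rw [hexp]
  congr 1
  apply Complex.ext <;> simp [hre]

/-- The lines through `1` and `RCLike.I` are treated separately; over the reals `RCLike.I = 0` and
the second contributes nothing. -/
lemma exists_addChar_eq_exp {F : Type*} [RCLike F] {ψ : AddChar F Circle} (hψ : Continuous ψ) :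
    ∃ ℓ : F →L[ℝ] ℝ, ∀ z, (ψ z : ℂ) = Complex.exp (Complex.I * (ℓ z : ℝ)) := by
  have h : ∀ c : F, ∃ a : ℝ, ∀ t : ℝ, (ψ (t * c) : ℂ) = Complex.exp (Complex.I * (a * t : ℝ)) :=
    fun c => by
      let φ : AddChar ℝ Circle := ⟨fun t => ψ (t * c), by simp, fun s t => by
        rw [RCLike.ofReal_add, add_mul, AddChar.map_add_eq_mul]⟩
      have hφ : Continuous φ := hψ.comp (RCLike.continuous_ofReal.mul continuous_const)
      exact exists_addChar_real_eq_exp hφ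
  obtain ⟨a, ha⟩ := h 1
  obtain ⟨b, hb⟩ := h RCLike.I
  refine ⟨a • RCLike.reCLM + b • RCLike.imCLM, fun z => ?_⟩
  conv_lhs => rw [← RCLike.re_add_im z, ← mul_one (RCLike.re z : F), AddChar.map_add_eq_mul,
    Circle.coe_mul, ha, hb, ← Complex.exp_add]
  congr 1
  simp
  ring

/-- If multiplying `I θ f` by the weights `a i θ` costs only finitely many continuous operations on
`f`, then a bound for `I` improves by all powers of the weights. -/
lemma exists_weighted_bound {S Θ ι : Type*} [TopologicalSpace S] {K : ι → Type*}
    [∀ i, Fintype (K i)]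
    {I : Θ → S → ℝ} {a : ι → Θ → ℝ} {B : Θ → ℝ} (ha : ∀ i θ, 0 ≤ a i θ)
    (hbase : ∃ C : S → ℝ, Continuous C ∧ ∀ θ f, I θ f ≤ C f * B θ)
    {D : (i : ι) → K i → S → S} (hD : ∀ i k, Continuous (D i k)) {c : ℝ} (hc : 0 ≤ c)
    (hstep : ∀ i θ f, a i θ * I θ f ≤ c * ∑ k, I θ (D i k f)) (s : Multiset ι) :
    ∃ C : S → ℝ, Continuous C ∧
      ∀ θ f, (s.map fun i => 1 + a i θ).prod * I θ f ≤ C f * B θ := by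
  induction s using Multiset.induction_on with
  | empty => simpa using hbase
  | cons i s ih =>
    obtain ⟨C, hC, h⟩ := ih
    -- One more weight replaces `f` by finitely many `D i k f`. The same `B θ` serves throughout,
    -- and the new constant stays continuous.
    refine ⟨fun f => C f + c * ∑ k, C (D i k f), ?_, fun θ f => ?_⟩
    · exact hC.add (continuous_const.mul
        (continuous_finsetSum _ fun k _ => hC.comp (hD i k)))
    rw [Multiset.map_cons, Multiset.prod_cons]
    set P := (s.map fun i => 1 + a i θ).prod with hP
    have hP0 : 0 ≤ P := Multiset.prod_nonneg fun x hx => by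
      obtain ⟨j, -, rfl⟩ := Multiset.mem_map.1 hx
      linarith [ha j θ]
    calc (1 + a i θ) * P * I θ f = P * I θ f + P * (a i θ * I θ f) := by ring
      _ ≤ C f * B θ + P * (c * ∑ k, I θ (D i k f)) :=
          add_le_add (h θ f) (mul_le_mul_of_nonneg_left (hstep i θ f) hP0)
      _ = C f * B θ + c * ∑ k, P * I θ (D i k f) := by rw [mul_left_comm, Finset.mul_sum]
      _ ≤ C f * B θ + c * ∑ k, C (D i k f) * B θ := 
          add_le_add le_rfl (mul_le_mul_of_nonneg_left
            (Finset.sum_le_sum fun k _ => h θ (D i k f)) hc)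
      _ = _ := by rw [← Finset.sum_mul]; ring

lemma exists_weighted_bound_fin {S Θ : Type*} [TopologicalSpace S] {m : ℕ} {K : Fin m → Type*}
    [∀ i, Fintype (K i)]
    {I : Θ → S → ℝ} {a : Fin m → Θ → ℝ} {B : Θ → ℝ} (ha : ∀ i θ, 0 ≤ a i θ)
    (hbase : ∃ C : S → ℝ, Continuous C ∧ ∀ θ f, I θ f ≤ C f * B θ)
    {D : (i : Fin m) → K i → S → S} (hD : ∀ i k, Continuous (D i k)) {c : ℝ} (hc : 0 ≤ c)
    (hstep : ∀ i θ f, a i θ * I θ f ≤ c * ∑ k, I θ (D i k f)) (n : Fin m → ℕ) :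
    ∃ C : S → ℝ, Continuous C ∧
      ∀ θ f, (∏ i, (1 + a i θ) ^ n i) * I θ f ≤ C f * B θ := by
  obtain ⟨C, hC, h⟩ := exists_weighted_bound ha hbase hD hc hstep
    (∑ i, Multiset.replicate (n i) i)
  refine ⟨C, hC, fun θ f => ?_⟩
  have := h θ f
  rwa [← Multiset.coe_mapAddMonoidHom, map_sum, Multiset.prod_sum,
    Finset.prod_congr rfl fun i _ => by
      rw [Multiset.coe_mapAddMonoidHom, Multiset.map_replicate, Multiset.prod_replicate]] at this

open LineDeriv

/-! ### Integration by parts against a quadratic phase. -/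

section Archimedean

variable {F : Type*} [RCLike F] {d : Fin 3 → ℕ} {ψ : AddChar F Circle} {ℓ : F →L[ℝ] ℝ}

lemma hasLineDerivAt_addChar (hℓ : ∀ z, (ψ z : ℂ) = Complex.exp (Complex.I * (ℓ z : ℝ)))
    {V : Type*} [AddCommGroup V] [Module ℝ V] {Φ : V → F} {u y : V} {p q : F}
    (hΦ : ∀ t : ℝ, Φ (u + t • y) = Φ u + t * p + t ^ 2 * q) :
    HasLineDerivAt ℝ (fun u => (ψ (Φ u) : ℂ)) (Complex.I * ℓ p * ψ (Φ u)) u y := by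
  have hfun : (fun t : ℝ => (ψ (Φ (u + t • y)) : ℂ)) = fun t : ℝ =>
      (ψ (Φ u) : ℂ) * Complex.exp (Complex.I * ((t * ℓ p + t ^ 2 * ℓ q : ℝ) : ℂ)) := by
    funext t
    rw [hΦ, add_assoc, AddChar.map_add_eq_mul, Circle.coe_mul, hℓ (_ + _), map_add]
    have h1 : ∀ (s : ℝ) (z : F), ℓ ((s : F) * z) = s * ℓ z := fun s z => by
      rw [← RCLike.real_smul_eq_coe_mul, map_smul, smul_eq_mul]
    rw [h1, ← RCLike.ofReal_pow, h1]
  rw [HasLineDerivAt, hfun]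
  have h1 : HasDerivAt (fun t : ℝ => t * ℓ p + t ^ 2 * ℓ q) (ℓ p) 0 := by
    have := ((hasDerivAt_id (0 : ℝ)).mul_const (ℓ p)).add
      ((hasDerivAt_pow 2 (0 : ℝ)).mul_const (ℓ q))
    convert! this using 1
    simp
  have h2 := ((h1.ofReal_comp.const_mul Complex.I).cexp).const_mul (ψ (Φ u) : ℂ)
  convert! h2 using 1
  simp
  ring

/-- The derivative of `ψ ∘ Φ` along `y` is `I * ℓ (p u)` times itself, so integration by parts
trades the factor `ℓ (p u)` for a derivative of `g`. The second-order coefficient `q` plays no role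
at `t = 0`. -/
lemma integral_addChar_mul_eq (hℓ : ∀ z, (ψ z : ℂ) = Complex.exp (Complex.I * (ℓ z : ℝ)))
    {V : Type*} [NormedAddCommGroup V] [NormedSpace ℝ V] [FiniteDimensional ℝ V]
    [MeasurableSpace V] [BorelSpace V] (μV : Measure V) [μV.IsAddHaarMeasure]
    {Φ p : V → F} {y : V} (q : F) (hψ : Continuous ψ) (hΦc : Continuous Φ)
    (hΦ : ∀ u, ∀ t : ℝ, Φ (u + t • y) = Φ u + t * p u + t ^ 2 * q)
    {g g' : V → ℂ} (hg : ∀ u, HasLineDerivAt ℝ g (g' u) u y) (hgi : Integrable g μV)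
    (hgi' : Integrable g' μV) (hpg : Integrable (fun u => (ℓ (p u) : ℂ) * g u) μV) :
    ∫ u, (ψ (Φ u) : ℂ) * ((ℓ (p u) : ℂ) * g u) ∂μV =
      Complex.I * ∫ u, (ψ (Φ u) : ℂ) * g' u ∂μV := by
  have hc : Continuous fun u => (ψ (Φ u) : ℂ) := continuous_subtype_val.comp (hψ.comp hΦc)
  have hbdd : ∀ {k : V → ℂ}, Integrable k μV → Integrable (fun u => (ψ (Φ u) : ℂ) * k u) μV :=
    fun hk => hk.bdd_mul hc.aestronglyMeasurable
      (Filter.Eventually.of_forall fun u => (Circle.norm_coe _).le)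
  have h := integral_bilinear_hasLineDerivAt_right_eq_neg_left_of_integrable (μ := μV)
    (f := fun u => (ψ (Φ u) : ℂ)) (f' := fun u => Complex.I * ℓ (p u) * ψ (Φ u)) (g := g)
    (g' := g') (v := y) (B := ContinuousLinearMap.mul ℝ ℂ)
    (((hbdd hpg).const_mul Complex.I).congr (Filter.Eventually.of_forall fun u => by
      simp only [ContinuousLinearMap.mul_apply']; ring))
    (hbdd hgi') (hbdd hgi) (fun u _ => hasLineDerivAt_addChar hℓ (hΦ u)) (fun u _ => hg u)
  simp only [ContinuousLinearMap.mul_apply'] at h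
  rw [h, ← integral_neg, ← integral_const_mul]
  refine integral_congr_ae (Filter.Eventually.of_forall fun u => ?_)
  simp only
  linear_combination ((ψ (Φ u) : ℂ) * ((ℓ (p u) : ℂ) * g u)) * Complex.I_mul_I

/-- The real-linear functional `u ↦ ℓ ⟨uᵢ, z⟩ᵢ`. -/
noncomputable def polarFunctional (ℓ : F →L[ℝ] ℝ) (Q : (i : Fin 3) → QuadraticForm F (Fin (d i) → F))
    (i : Fin 3) (z : Fin (d i) → F) : ((i : Fin 3) → Fin (d i) → F) →L[ℝ] ℝ :=
  LinearMap.toContinuousLinearMap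
    ((ℓ : F →ₗ[ℝ] ℝ) ∘ₗ ((Q i).polarBilin.flip z).restrictScalars ℝ ∘ₗ LinearMap.proj i)

lemma polarFunctional_apply (Q : (i : Fin 3) → QuadraticForm F (Fin (d i) → F)) (i : Fin 3)
    (z : Fin (d i) → F) (u : (i : Fin 3) → Fin (d i) → F) :
    polarFunctional ℓ Q i z u = ℓ (QuadraticMap.polar (Q i) (u i) z) := rfl

/-- The vectors `eⱼ` and `i eⱼ`. -/
noncomputable def realBasisVec {n : ℕ} (k : Fin n × Bool) : Fin n → F :=
  Pi.single k.1 (if k.2 then 1 else RCLike.I)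

lemma map_mul_eq_re_im (ℓ : F →L[ℝ] ℝ) (w z : F) :
    ℓ (w * z) = RCLike.re w * ℓ z + RCLike.im w * ℓ (RCLike.I * z) := by
  have h1 : ∀ (s : ℝ) (z : F), ℓ ((s : F) * z) = s * ℓ z := fun s z => by
    rw [← RCLike.real_smul_eq_coe_mul, map_smul, smul_eq_mul]
  conv_lhs => rw [← RCLike.re_add_im w, add_mul, map_add, mul_assoc, h1, h1]

/-- The functional `ℓ` sees only one real direction of `F`, so pairings with both `eⱼ` and `i eⱼ`
are needed: if `ℓ` kills `z` and `I * z` with `z ≠ 0`, it is zero. An injective linear map in finite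
dimension is bounded below. -/
lemma exists_norm_le_sum_polar (hℓ0 : ℓ ≠ 0) {n : ℕ} {Q : QuadraticForm F (Fin n → F)}
    (hQ : Q.polarBilin.Nondegenerate) :
    ∃ c : ℝ, 0 ≤ c ∧ ∀ x : Fin n → F,
      ‖x‖ ≤ c * ∑ k : Fin n × Bool, |ℓ (QuadraticMap.polar Q x (realBasisVec k))| := by
  let T : (Fin n → F) →ₗ[ℝ] (Fin n × Bool → ℝ) := LinearMap.pi fun k =>
    (ℓ : F →ₗ[ℝ] ℝ) ∘ₗ (Q.polarBilin.flip (realBasisVec k)).restrictScalars ℝ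
  have hT : ∀ x k, T x k = ℓ (QuadraticMap.polar Q x (realBasisVec k)) := fun x k => rfl
  obtain ⟨S, hS⟩ := exists_leftInverse_polar hQ
  obtain ⟨t₀, ht₀⟩ : ∃ t, ℓ t ≠ 0 := by
    by_contra! h
    exact hℓ0 (ContinuousLinearMap.ext h)
  have hker : LinearMap.ker T = ⊥ := by
    rw [LinearMap.ker_eq_bot']
    intro x hx
    have hz : ∀ j, QuadraticMap.polar Q x (Pi.single j 1) = 0 := fun j => by
      set z := QuadraticMap.polar Q x (Pi.single j 1) with hz
      have h1 : ℓ z = 0 := by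
        have := congrFun hx (j, true)
        rw [hT] at this
        simpa [realBasisVec] using this
      have h2 : ℓ (RCLike.I * z) = 0 := by
        have := congrFun hx (j, false)
        rw [hT] at this
        simp only [realBasisVec, Bool.false_eq_true, if_false] at this
        rw [polar_single] at this
        exact this
      by_contra hne
      refine ht₀ ?_
      rw [← div_mul_cancel₀ t₀ hne, map_mul_eq_re_im, h1, h2]
      simp
    ext j
    rw [hS x j]
    simp [hz]
  obtain ⟨K, -, hK⟩ := T.exists_antilipschitzWith hker
  refine ⟨K, K.2, fun x => ?_⟩
  have h := hK.le_mul_dist x 0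
  rw [map_zero, dist_zero_right, dist_zero_right] at h
  refine h.trans ?_
  gcongr
  refine (pi_norm_le_iff_of_nonneg (Finset.sum_nonneg fun _ _ => abs_nonneg _)).2 fun k => ?_
  rw [hT, Real.norm_eq_abs]
  exact Finset.single_le_sum (f := fun k => |ℓ (QuadraticMap.polar Q x (realBasisVec k))|)
    (fun _ _ => abs_nonneg _) (Finset.mem_univ k)

end Archimedean

open LineDeriv

/-! ### Rapid decay of twisted correlations of Schwartz functions. -/

section Archimedean

variable {F : Type*} [RCLike F] {d : Fin 3 → ℕ} {ψ : AddChar F Circle} {ℓ : F →L[ℝ] ℝ}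

/-- Multiplication of a Schwartz function by `u ↦ ℓ ⟨uᵢ, z⟩ᵢ`. -/
noncomputable def polarMul (ℓ : F →L[ℝ] ℝ) (Q : (i : Fin 3) → QuadraticForm F (Fin (d i) → F))
    (i : Fin 3) (z : Fin (d i) → F) :
    𝓢((i : Fin 3) → Fin (d i) → F, ℂ) →L[ℝ] 𝓢((i : Fin 3) → Fin (d i) → F, ℂ) :=
  SchwartzMap.smulLeftCLM ℂ (polarFunctional ℓ Q i z)

lemma polarMul_apply (Q : (i : Fin 3) → QuadraticForm F (Fin (d i) → F))
    (i : Fin 3) (z : Fin (d i) → F) (f : 𝓢((i : Fin 3) → Fin (d i) → F, ℂ))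
    (u : (i : Fin 3) → Fin (d i) → F) :
    polarMul ℓ Q i z f u = (ℓ (QuadraticMap.polar (Q i) (u i) z) : ℂ) * f u := by
  rw [polarMul, SchwartzMap.smulLeftCLM_apply_apply
    (polarFunctional ℓ Q i z).hasTemperateGrowth, polarFunctional_apply, Complex.real_smul]

/-- The derivative of a Schwartz function in the direction `z` of the `i`-th factor. -/
noncomputable def blockDeriv (i : Fin 3) (z : Fin (d i) → F) :
    𝓢((i : Fin 3) → Fin (d i) → F, ℂ) →L[ℝ] 𝓢((i : Fin 3) → Fin (d i) → F, ℂ) :=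
  lineDerivOpCLM ℝ 𝓢((i : Fin 3) → Fin (d i) → F, ℂ)
    (Pi.single i z : (i : Fin 3) → Fin (d i) → F)

lemma hasLineDerivAt_blockDeriv (i : Fin 3) (z : Fin (d i) → F)
    (f : 𝓢((i : Fin 3) → Fin (d i) → F, ℂ)) (u : (i : Fin 3) → Fin (d i) → F) :
    HasLineDerivAt ℝ f (blockDeriv i z f u) u (Pi.single i z) :=
  (f.hasFDerivAt u).hasLineDerivAt _

variable (μV : Measure ((i : Fin 3) → Fin (d i) → F)) [μV.IsAddHaarMeasure]
  {Q : (i : Fin 3) → QuadraticForm F (Fin (d i) → F)}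

lemma integrable_addChar_mul (hψ : Continuous ψ) {V : Type*} [MeasurableSpace V]
    [TopologicalSpace V] [OpensMeasurableSpace V] {μV : Measure V}
    {Φ : V → F} (hΦ : Continuous Φ) {g : V → ℂ} (hg : Integrable g μV) :
    Integrable (fun u => (ψ (Φ u) : ℂ) * g u) μV :=
  hg.bdd_mul (continuous_subtype_val.comp (hψ.comp hΦ)).aestronglyMeasurable
    (Filter.Eventually.of_forall fun _ => (Circle.norm_coe _).le)

lemma integrable_correlation (f g : 𝓢((i : Fin 3) → Fin (d i) → F, ℂ))
    (h : (i : Fin 3) → Fin (d i) → F) :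
    Integrable (fun u => f (u + h) * (starRingEnd ℂ) (g u)) μV := by
  have hgc : Integrable (fun u => (starRingEnd ℂ) (g u)) μV :=
    Complex.conjCLE.toContinuousLinearMap.integrable_comp g.integrable
  exact hgc.bdd_mul (f.continuous.comp (continuous_add_const h)).aestronglyMeasurable
    (Filter.Eventually.of_forall fun u => SchwartzMap.norm_le_seminorm ℝ f (u + h))

lemma continuous_sum_polar (Q : (i : Fin 3) → QuadraticForm F (Fin (d i) → F)) (w : Fin 3 → F)
    (h : (i : Fin 3) → Fin (d i) → F) :
    Continuous fun u : (i : Fin 3) → Fin (d i) → F =>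
      ∑ i, w i * QuadraticMap.polar (Q i) (u i) (h i) := by
  have h := fun i => continuous_quadraticForm (Q i)
  unfold QuadraticMap.polar
  fun_prop

/-- The norm of the twisted correlation is bounded by the product of a sup norm and an `L¹` norm. -/
lemma exists_norm_twistedCorrelation_le :
    ∃ C : 𝓢((i : Fin 3) → Fin (d i) → F, ℂ) × 𝓢((i : Fin 3) → Fin (d i) → F, ℂ) → ℝ,
      Continuous C ∧ ∀ (θ : (Fin 3 → F) × ((i : Fin 3) → Fin (d i) → F)) f,
        ‖twistedCorrelation μV ψ Q θ.1 f.1 f.2 θ.2‖ ≤ C f * 1 := by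
  refine ⟨fun f => ‖SchwartzMap.toBoundedContinuousFunctionCLM ℝ _ ℂ f.1‖ * ‖f.2.toLp 1 μV‖,
    ?_, fun θ f => ?_⟩
  · exact (((SchwartzMap.toBoundedContinuousFunctionCLM ℝ _ ℂ).continuous.comp
      continuous_fst).norm).mul ((SchwartzMap.continuous_toLp.comp continuous_snd).norm)
  · beta_reduce
    rw [mul_one, SchwartzMap.norm_toLp_one, ← integral_const_mul]
    refine norm_integral_le_of_norm_le (f.2.integrable.norm.const_mul _)
      (Filter.Eventually.of_forall fun u => ?_)
    rw [norm_mul, norm_mul, Circle.norm_coe, one_mul, RCLike.norm_conj]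
    gcongr
    exact (SchwartzMap.toBoundedContinuousFunctionCLM ℝ _ ℂ f.1).norm_coe_le_norm (u + θ.2)

/-- Writing `h = (u + h) - u` moves the weight onto one of the two functions at a time. This is why
the correlation is kept as a form in a pair `f, g`. -/
lemma polar_mul_twistedCorrelation (hψ : Continuous ψ)
    (f g : 𝓢((i : Fin 3) → Fin (d i) → F, ℂ)) (w : Fin 3 → F)
    (h : (i : Fin 3) → Fin (d i) → F) (i : Fin 3) (z : Fin (d i) → F) :
    (ℓ (QuadraticMap.polar (Q i) (h i) z) : ℂ) * twistedCorrelation μV ψ Q w f g h =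
      twistedCorrelation μV ψ Q w (polarMul ℓ Q i z f) g h -
        twistedCorrelation μV ψ Q w f (polarMul ℓ Q i z g) h := by
  have hc := continuous_sum_polar Q w h
  rw [twistedCorrelation, twistedCorrelation, twistedCorrelation,
    ← integral_sub (integrable_addChar_mul hψ hc (integrable_correlation μV _ _ h))
      (integrable_addChar_mul hψ hc (integrable_correlation μV _ _ h)), ← integral_const_mul]
  refine integral_congr_ae (Filter.Eventually.of_forall fun u => ?_)
  simp only [polarMul_apply, Pi.add_apply, QuadraticMap.polar_add_left, map_add, map_mul,
    Complex.conj_ofReal, Complex.ofReal_add]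
  ring

/-- The phase is linear in `u` and its derivative along `z` in block `i` is `⟨wᵢ hᵢ, z⟩ᵢ`;
integration by parts distributes the derivative by the product rule. -/
lemma polar_smul_mul_twistedCorrelation (hψ : Continuous ψ)
    (hℓ : ∀ z, (ψ z : ℂ) = Complex.exp (Complex.I * (ℓ z : ℝ)))
    (f g : 𝓢((i : Fin 3) → Fin (d i) → F, ℂ)) (w : Fin 3 → F)
    (h : (i : Fin 3) → Fin (d i) → F) (i : Fin 3) (z : Fin (d i) → F) :
    (ℓ (QuadraticMap.polar (Q i) (w i • h i) z) : ℂ) * twistedCorrelation μV ψ Q w f g h =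
      Complex.I * (twistedCorrelation μV ψ Q w (blockDeriv i z f) g h +
        twistedCorrelation μV ψ Q w f (blockDeriv i z g) h) := by
  have hc := continuous_sum_polar Q w h
  have hp : ∀ u (t : ℝ), ∑ k, w k * QuadraticMap.polar (Q k)
      ((u + t • (Pi.single i z : (i : Fin 3) → Fin (d i) → F)) k) (h k) =
      ∑ k, w k * QuadraticMap.polar (Q k) (u k) (h k) +
        t * QuadraticMap.polar (Q i) (w i • h i) z + t ^ 2 * 0 := fun u t => by
    simp_rw [Pi.add_apply, QuadraticMap.polar_add_left, mul_add, Finset.sum_add_distrib]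
    rw [mul_zero, add_zero]
    congr 1
    have hs : ∀ k, (t • (Pi.single i z : (i : Fin 3) → Fin (d i) → F)) k =
        (t : F) • (Pi.single i z : (i : Fin 3) → Fin (d i) → F) k := fun k => by
      rw [Pi.smul_apply, RCLike.real_smul_eq_coe_smul (K := F)]
    simp_rw [hs, QuadraticMap.polar_smul_left, smul_eq_mul, mul_left_comm _ (t : F),
      ← Finset.mul_sum, QuadraticMap.polar_comm _ ((Pi.single i z :
        (i : Fin 3) → Fin (d i) → F) _), sum_polar_single]
  have hder : ∀ u, HasLineDerivAt ℝ (fun u => f (u + h) * (starRingEnd ℂ) (g u))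
      (blockDeriv i z f (u + h) * (starRingEnd ℂ) (g u) +
        f (u + h) * (starRingEnd ℂ) (blockDeriv i z g u)) u (Pi.single i z) := fun u => by
    have h1 := hasLineDerivAt_blockDeriv i z f (u + h)
    have h2 := hasLineDerivAt_blockDeriv i z g u
    rw [HasLineDerivAt] at h1 h2 ⊢
    have h3 : HasDerivAt (fun t : ℝ => f (u + t • (Pi.single i z :
        (i : Fin 3) → Fin (d i) → F) + h)) (blockDeriv i z f (u + h)) 0 := by
      convert! h1 using 3
      abel
    have h4 : HasDerivAt (fun t : ℝ => (starRingEnd ℂ) (g (u + t • (Pi.single i z :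
        (i : Fin 3) → Fin (d i) → F)))) ((starRingEnd ℂ) (blockDeriv i z g u)) 0 :=
      (Complex.conjCLE.toContinuousLinearMap.hasFDerivAt.comp_hasDerivAt 0 h2)
    convert! h3.mul h4 using 1
    simp
  have key := integral_addChar_mul_eq hℓ μV (q := 0) hψ hc hp hder
    (integrable_correlation μV f g h)
    ((integrable_correlation μV _ _ h).add (integrable_correlation μV _ _ h))
    ((integrable_correlation μV f g h).const_mul _)
  rw [twistedCorrelation, ← integral_const_mul]
  rw [twistedCorrelation, twistedCorrelation,
    ← integral_add (integrable_addChar_mul hψ hc (integrable_correlation μV _ _ h))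
      (integrable_addChar_mul hψ hc (integrable_correlation μV _ _ h))]
  simp_rw [← mul_add]
  rw [← key]
  refine integral_congr_ae (Filter.Eventually.of_forall fun u => ?_)
  simp only
  ring

lemma exists_weight_mul_twistedCorrelation_le (hψ : Continuous ψ)
    (hℓ : ∀ z, (ψ z : ℂ) = Complex.exp (Complex.I * (ℓ z : ℝ))) (hℓ0 : ℓ ≠ 0)
    (hQ : ∀ i, (Q i).polarBilin.Nondegenerate) :
    ∃ c : ℝ, 0 ≤ c ∧ ∀ (i : Fin 3) (f g : 𝓢((i : Fin 3) → Fin (d i) → F, ℂ)) (w : Fin 3 → F)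
      (h : (i : Fin 3) → Fin (d i) → F),
      max 1 ‖w i‖ * ‖h i‖ * ‖twistedCorrelation μV ψ Q w f g h‖ ≤
        c * ∑ k : Fin (d i) × Bool,
          (‖twistedCorrelation μV ψ Q w (polarMul ℓ Q i (realBasisVec k) f) g h‖ +
          ‖twistedCorrelation μV ψ Q w f (polarMul ℓ Q i (realBasisVec k) g) h‖ +
          ‖twistedCorrelation μV ψ Q w (blockDeriv i (realBasisVec k) f) g h‖ +
          ‖twistedCorrelation μV ψ Q w f (blockDeriv i (realBasisVec k) g) h‖) := by
  choose c hc0 hc using fun i => exists_norm_le_sum_polar hℓ0 (hQ i)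
  refine ⟨∑ i, c i, Finset.sum_nonneg fun i _ => hc0 i, fun i f g w h => ?_⟩
  have hle : c i ≤ ∑ i, c i := Finset.single_le_sum (fun i _ => hc0 i) (Finset.mem_univ i)
  -- The weight splits into `‖h i‖`, handled by multiplication operators, and `‖w i • h i‖`, handled
  -- by derivatives.
  have h1 : max 1 ‖w i‖ * ‖h i‖ ≤ ‖h i‖ + ‖w i • h i‖ := by
    rw [norm_smul]
    have : max 1 ‖w i‖ ≤ 1 + ‖w i‖ := max_le (by simp) (by simp)
    nlinarith [norm_nonneg (h i)]
  set T := ‖twistedCorrelation μV ψ Q w f g h‖ with hT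
  have hT0 : 0 ≤ T := norm_nonneg _
  calc max 1 ‖w i‖ * ‖h i‖ * T ≤ (‖h i‖ + ‖w i • h i‖) * T := by gcongr
    _ ≤ (c i * ∑ k, |ℓ (QuadraticMap.polar (Q i) (h i) (realBasisVec k))| +
          c i * ∑ k, |ℓ (QuadraticMap.polar (Q i) (w i • h i) (realBasisVec k))|) * T := by
        gcongr
        exacts [hc i _, hc i _]
    _ = c i * ∑ k, (|ℓ (QuadraticMap.polar (Q i) (h i) (realBasisVec k))| * T +
          |ℓ (QuadraticMap.polar (Q i) (w i • h i) (realBasisVec k))| * T) := by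
        rw [← mul_add, ← Finset.sum_add_distrib, mul_assoc, Finset.sum_mul]
        simp_rw [add_mul]
    _ ≤ _ := by
        refine mul_le_mul hle (Finset.sum_le_sum fun k _ => ?_) (by positivity)
          (Finset.sum_nonneg fun i _ => hc0 i)
        rw [add_assoc (_ + _)]
        refine add_le_add ?_ ?_
        · rw [hT, ← Real.norm_eq_abs, ← Complex.norm_real, ← norm_mul,
            polar_mul_twistedCorrelation μV hψ]
          exact norm_sub_le _ _
        · rw [hT, ← Real.norm_eq_abs, ← Complex.norm_real, ← norm_mul,
            polar_smul_mul_twistedCorrelation μV hψ hℓ, norm_mul, Complex.norm_I, one_mul]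
          exact norm_add_le _ _

/-- The one-step estimate is iterated on pairs of Schwartz functions, starting from the trivial
bound, and then restricted to the diagonal. -/
theorem exists_twistedCorrelation_decay (hψ : Continuous ψ)
    (hℓ : ∀ z, (ψ z : ℂ) = Complex.exp (Complex.I * (ℓ z : ℝ))) (hℓ0 : ℓ ≠ 0)
    (hQ : ∀ i, (Q i).polarBilin.Nondegenerate) (n : Fin 3 → ℕ) :
    ∃ C : 𝓢((i : Fin 3) → Fin (d i) → F, ℂ) → ℝ, Continuous C ∧
      ∀ w h (f : 𝓢((i : Fin 3) → Fin (d i) → F, ℂ)),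
      (∏ i, (1 + max 1 ‖w i‖ * ‖h i‖) ^ n i) * ‖twistedCorrelation μV ψ Q w f f h‖ ≤ C f := by
  obtain ⟨c, hc0, hc⟩ := exists_weight_mul_twistedCorrelation_le μV hψ hℓ hℓ0 hQ
  obtain ⟨C, hC, hCb⟩ := exists_weighted_bound_fin
    (S := 𝓢((i : Fin 3) → Fin (d i) → F, ℂ) × 𝓢((i : Fin 3) → Fin (d i) → F, ℂ))
    (Θ := (Fin 3 → F) × ((i : Fin 3) → Fin (d i) → F))
    (K := fun i => (Fin (d i) × Bool) × Fin 4)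
    (I := fun θ f => ‖twistedCorrelation μV ψ Q θ.1 f.1 f.2 θ.2‖)
    (a := fun i θ => max 1 ‖θ.1 i‖ * ‖θ.2 i‖) (B := fun _ => 1) (fun i θ => by positivity)
    (exists_norm_twistedCorrelation_le μV)
    (D := fun i k f => ![(polarMul ℓ Q i (realBasisVec k.1) f.1, f.2),
      (f.1, polarMul ℓ Q i (realBasisVec k.1) f.2), (blockDeriv i (realBasisVec k.1) f.1, f.2),
      (f.1, blockDeriv i (realBasisVec k.1) f.2)] k.2)
    (fun i ⟨k, m⟩ => by
      fin_cases m
      · exact ((polarMul ℓ Q i (realBasisVec k)).continuous.comp continuous_fst).prodMk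
          continuous_snd
      · exact continuous_fst.prodMk
          ((polarMul ℓ Q i (realBasisVec k)).continuous.comp continuous_snd)
      · exact ((blockDeriv i (realBasisVec k)).continuous.comp continuous_fst).prodMk
          continuous_snd
      · exact continuous_fst.prodMk
          ((blockDeriv i (realBasisVec k)).continuous.comp continuous_snd)) hc0
    (fun i θ f => by
      rw [Fintype.sum_prod_type]
      simp only [Fin.sum_univ_four]
      exact hc i f.1 f.2 θ.1 θ.2) n
  refine ⟨fun f => C (f, f), hC.comp (continuous_id.prodMk continuous_id), fun w h f => ?_⟩
  simpa using hCb (w, h) (f, f)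

end Archimedean

lemma lintegral_one_add_mul_norm {E : Type*} [NormedAddCommGroup E] [NormedSpace ℝ E]
    [FiniteDimensional ℝ E] [MeasurableSpace E] [BorelSpace E] (μ : Measure E)
    [μ.IsAddHaarMeasure] {W : ℝ} (hW : 0 < W) (r : ℕ) :
    ∫⁻ h, ENNReal.ofReal ((1 + W * ‖h‖) ^ r)⁻¹ ∂μ =
      ENNReal.ofReal (W ^ Module.finrank ℝ E)⁻¹ *
        ∫⁻ h, ENNReal.ofReal ((1 + ‖h‖) ^ r)⁻¹ ∂μ := by
  have hm : Measurable fun h : E => ENNReal.ofReal ((1 + ‖h‖) ^ r)⁻¹ := by fun_prop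
  have h1 := lintegral_map (μ := μ) hm (measurable_const_smul W)
  rw [Measure.map_addHaar_smul μ hW.ne', lintegral_smul_measure] at h1
  simp_rw [norm_smul, Real.norm_of_nonneg hW.le] at h1
  rw [← h1, abs_of_nonneg (by positivity), smul_eq_mul]

lemma lintegral_one_add_norm_lt_top {E : Type*} [NormedAddCommGroup E] [NormedSpace ℝ E]
    [FiniteDimensional ℝ E] [MeasurableSpace E] [BorelSpace E] (μ : Measure E)
    [μ.IsAddHaarMeasure] :
    ∫⁻ h, ENNReal.ofReal ((1 + ‖h‖) ^ (Module.finrank ℝ E + 1))⁻¹ ∂μ < ∞ := by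
  have := finite_integral_one_add_norm (μ := μ) (r := ((Module.finrank ℝ E + 1 : ℕ) : ℝ))
    (by push_cast; linarith)
  refine lt_of_le_of_lt (lintegral_mono fun h => ?_) this
  rw [Real.rpow_neg (by positivity), Real.rpow_natCast]

/-! ### Archimedean decay in the quadratic coefficients. -/

section Archimedean

variable {F : Type*} [RCLike F] {d : Fin 3 → ℕ} {ψ : AddChar F Circle} {ℓ : F →L[ℝ] ℝ}
  (μV : Measure ((i : Fin 3) → Fin (d i) → F)) [μV.IsAddHaarMeasure]
  {Q : (i : Fin 3) → QuadraticForm F (Fin (d i) → F)}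

lemma exists_lintegral_prod_one_add_mul_norm_le :
    ∃ c : ℝ≥0, ∀ W : Fin 3 → ℝ, (∀ i, 0 < W i) →
      ∫⁻ h, ∏ i, ENNReal.ofReal
        ((1 + W i * ‖h i‖) ^ (Module.finrank ℝ (Fin (d i) → F) + 1))⁻¹ ∂μV ≤
      c * ENNReal.ofReal (∏ i, (W i ^ Module.finrank ℝ (Fin (d i) → F))⁻¹) := by
  set π : Measure ((i : Fin 3) → Fin (d i) → F) := Measure.pi fun _ => Measure.addHaar with hπ
  obtain ⟨c, hc⟩ : ∃ c : ℝ≥0, μV = c • π := ⟨_, Measure.isAddLeftInvariant_eq_smul μV π⟩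
  have hA := fun i => (lintegral_one_add_norm_lt_top
    (Measure.addHaar : Measure (Fin (d i) → F))).ne
  choose A hA using fun i => (⟨_, ENNReal.coe_toNNReal (hA i)⟩ : ∃ A : ℝ≥0, (A : ℝ≥0∞) = _)
  refine ⟨c * ∏ i, A i, fun W hW => ?_⟩
  rw [hc, lintegral_smul_measure, hπ, lintegral_pi_fin_prod (fun _ => Measure.addHaar)
    (f := fun i (h : Fin (d i) → F) => ENNReal.ofReal
      ((1 + W i * ‖h‖) ^ (Module.finrank ℝ (Fin (d i) → F) + 1))⁻¹) fun i => by fun_prop]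
  simp_rw [lintegral_one_add_mul_norm _ (hW _), ← hA]
  rw [Finset.prod_mul_distrib, ENNReal.ofReal_prod_of_nonneg
    fun i _ => inv_nonneg.2 (pow_nonneg (hW i).le _), ENNReal.coe_mul, ENNReal.ofNNReal_finsetProd]
  refine le_of_eq ?_
  rw [ENNReal.smul_def, smul_eq_mul]
  ring

/-- Decay of the oscillatory integral in the coefficients of the quadratic part of the phase. -/
theorem exists_oscillatory_quadratic_decay (hψ : Continuous ψ)
    (hℓ : ∀ z, (ψ z : ℂ) = Complex.exp (Complex.I * (ℓ z : ℝ))) (hℓ0 : ℓ ≠ 0)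
    (hQ : ∀ i, (Q i).polarBilin.Nondegenerate) :
    ∃ C : 𝓢((i : Fin 3) → Fin (d i) → F, ℂ) → ℝ, Continuous C ∧
      ∀ (θ : ((i : Fin 3) → Fin (d i) → F) × (Fin 3 → F))
        (f : 𝓢((i : Fin 3) → Fin (d i) → F, ℂ)),
        ‖∫ u, (ψ (quadPhase Q θ.1 θ.2 u) : ℂ) * f u ∂μV‖ ≤
          C f * √(∏ i, (max 1 ‖θ.2 i‖ ^ Module.finrank ℝ (Fin (d i) → F))⁻¹) := by
  -- The exponent `dim + 1` in each block makes the majorant integrable in `h`; rescaling `h i` by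
  -- `W i` then extracts `W i ^ (-dim)`.
  obtain ⟨C, hC, hCb⟩ := exists_twistedCorrelation_decay μV hψ hℓ hℓ0 hQ
    (fun i => Module.finrank ℝ (Fin (d i) → F) + 1)
  obtain ⟨c, hc⟩ := exists_lintegral_prod_one_add_mul_norm_le μV
  refine ⟨fun f => √(C f * c), (hC.mul continuous_const).sqrt, fun θ f => ?_⟩
  set W : Fin 3 → ℝ := fun i => max 1 ‖θ.2 i‖ with hW
  have hW0 : ∀ i, 0 < W i := fun i => lt_max_of_lt_left one_pos
  have hC0 : 0 ≤ C f := le_trans (by positivity) (hCb 0 0 f)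
  rw [← Real.sqrt_mul (by positivity)]
  refine Real.le_sqrt_of_sq_le ?_
  have key := enorm_oscillatory_sq_le μV hψ Q θ.1 θ.2 f.integrable
  rw [← ENNReal.ofReal_le_ofReal_iff (by positivity), ENNReal.ofReal_pow (norm_nonneg _),
    ofReal_norm, mul_assoc, ENNReal.ofReal_mul hC0, ENNReal.ofReal_mul c.coe_nonneg, ENNReal.ofReal_coe_nnreal]
  refine key.trans (le_trans ?_ (mul_le_mul_right (hc W hW0) _))
  rw [← lintegral_const_mul _ (by fun_prop)]
  refine lintegral_mono fun h => ?_
  rw [← ENNReal.ofReal_prod_of_nonneg fun i _ => by positivity, ← ENNReal.ofReal_mul hC0,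
    ← ofReal_norm]
  refine ENNReal.ofReal_le_ofReal ?_
  rw [Finset.prod_inv_distrib, ← div_eq_mul_inv, le_div_iff₀ (Finset.prod_pos fun i _ =>
    pow_pos (by have := hW0 i; positivity) _), mul_comm]
  exact hCb θ.2 h f

end Archimedean

/-! ### Archimedean decay in the linear coefficients. -/

section Archimedean

variable {F : Type*} [RCLike F] {d : Fin 3 → ℕ} {ψ : AddChar F Circle} {ℓ : F →L[ℝ] ℝ}
  (μV : Measure ((i : Fin 3) → Fin (d i) → F)) [μV.IsAddHaarMeasure]
  {Q : (i : Fin 3) → QuadraticForm F (Fin (d i) → F)}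

lemma quadPhase_add_smul_single (x : (i : Fin 3) → Fin (d i) → F) (w : Fin 3 → F) (i : Fin 3)
    (z : Fin (d i) → F) (u : (i : Fin 3) → Fin (d i) → F) (t : ℝ) :
    quadPhase Q x w (u + t • (Pi.single i z : (i : Fin 3) → Fin (d i) → F)) =
      quadPhase Q x w u +
        t * (QuadraticMap.polar (Q i) (x i) z + w i * QuadraticMap.polar (Q i) (u i) z) +
        t ^ 2 * (w i * Q i z) := by
  have h : t • (Pi.single i z : (i : Fin 3) → Fin (d i) → F) = Pi.single i ((t : F) • z) := by
    rw [← Pi.single_smul, RCLike.real_smul_eq_coe_smul (K := F)]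
  rw [h, quadPhase_add, sum_polar_single, quadPhase_single, QuadraticMap.polar_smul_right,
    QuadraticMap.polar_smul_right, QuadraticMap.map_smul]
  simp only [smul_eq_mul]
  ring

/-- The derivative of the phase along `z` is `⟨xᵢ, z⟩ᵢ + wᵢ ⟨uᵢ, z⟩ᵢ`; integration by parts is
solved for the first term. As `ℓ` is only real linear, `wᵢ` is split into real and imaginary parts,
the latter paired with `I • z`. -/
lemma polar_mul_oscillatory_eq (hψ : Continuous ψ)
    (hℓ : ∀ z, (ψ z : ℂ) = Complex.exp (Complex.I * (ℓ z : ℝ)))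
    (x : (i : Fin 3) → Fin (d i) → F) (w : Fin 3 → F) (i : Fin 3) (z : Fin (d i) → F)
    (f : 𝓢((i : Fin 3) → Fin (d i) → F, ℂ)) :
    (ℓ (QuadraticMap.polar (Q i) (x i) z) : ℂ) * ∫ u, (ψ (quadPhase Q x w u) : ℂ) * f u ∂μV =
      Complex.I * (∫ u, (ψ (quadPhase Q x w u) : ℂ) * blockDeriv i z f u ∂μV) -
      ((RCLike.re (w i) : ℝ) : ℂ) *
        (∫ u, (ψ (quadPhase Q x w u) : ℂ) * polarMul ℓ Q i z f u ∂μV) -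
      ((RCLike.im (w i) : ℝ) : ℂ) *
        ∫ u, (ψ (quadPhase Q x w u) : ℂ) * polarMul ℓ Q i ((RCLike.I : F) • z) f u ∂μV := by
  have hc := continuous_quadPhase Q x w
  have hint : ∀ g : 𝓢((i : Fin 3) → Fin (d i) → F, ℂ),
      Integrable (fun u => (ψ (quadPhase Q x w u) : ℂ) * g u) μV := fun g =>
    integrable_addChar_mul hψ hc g.integrable
  have e : ∀ u, (ℓ (QuadraticMap.polar (Q i) (x i) z + w i * QuadraticMap.polar (Q i) (u i) z) : ℂ)
      * f u = ((ℓ (QuadraticMap.polar (Q i) (x i) z) : ℂ) * f u +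
        ((RCLike.re (w i) : ℝ) : ℂ) * polarMul ℓ Q i z f u) +
        ((RCLike.im (w i) : ℝ) : ℂ) * polarMul ℓ Q i ((RCLike.I : F) • z) f u := fun u => by
    rw [polarMul_apply, polarMul_apply, map_add, map_mul_eq_re_im, QuadraticMap.polar_smul_right,
      smul_eq_mul]
    push_cast
    ring
  have key := integral_addChar_mul_eq hℓ μV (w i * Q i z) hψ hc
    (quadPhase_add_smul_single (Q := Q) x w i z)
    (hasLineDerivAt_blockDeriv i z f) f.integrable (blockDeriv i z f).integrable
    (by
      simp_rw [e]
      exact ((f.integrable.const_mul _).add ((polarMul ℓ Q i z f).integrable.const_mul _)).add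
        ((polarMul ℓ Q i ((RCLike.I : F) • z) f).integrable.const_mul _))
  simp_rw [e, mul_add, mul_left_comm (ψ _ : ℂ)] at key
  have h1 := (hint f).const_mul (ℓ (QuadraticMap.polar (Q i) (x i) z) : ℂ)
  have h2 := (hint (polarMul ℓ Q i z f)).const_mul ((RCLike.re (w i) : ℝ) : ℂ)
  have h3 := (hint (polarMul ℓ Q i ((RCLike.I : F) • z) f)).const_mul ((RCLike.im (w i) : ℝ) : ℂ)
  have h12 := integral_add (h1.add h2) h3
  simp only [Pi.add_apply] at h12
  rw [h12, integral_add h1 h2, integral_const_mul, integral_const_mul, integral_const_mul] at key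
  rw [← key]
  ring

/-- The terms carrying `wᵢ` cost a factor at most `‖w i‖`; division by `max 1 ‖w i‖` makes the step
uniform, so the gain is in `‖x i‖ / max 1 ‖w i‖`. -/
lemma exists_weight_mul_oscillatory_le (hψ : Continuous ψ)
    (hℓ : ∀ z, (ψ z : ℂ) = Complex.exp (Complex.I * (ℓ z : ℝ))) (hℓ0 : ℓ ≠ 0)
    (hQ : ∀ i, (Q i).polarBilin.Nondegenerate) :
    ∃ c : ℝ, 0 ≤ c ∧ ∀ (i : Fin 3) (f : 𝓢((i : Fin 3) → Fin (d i) → F, ℂ))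
      (x : (i : Fin 3) → Fin (d i) → F) (w : Fin 3 → F),
      ‖x i‖ / max 1 ‖w i‖ * ‖∫ u, (ψ (quadPhase Q x w u) : ℂ) * f u ∂μV‖ ≤
        c * ∑ k : Fin (d i) × Bool,
          (‖∫ u, (ψ (quadPhase Q x w u) : ℂ) * blockDeriv i (realBasisVec k) f u ∂μV‖ +
          ‖∫ u, (ψ (quadPhase Q x w u) : ℂ) * polarMul ℓ Q i (realBasisVec k) f u ∂μV‖ +
          ‖∫ u, (ψ (quadPhase Q x w u) : ℂ) *
            polarMul ℓ Q i ((RCLike.I : F) • realBasisVec k) f u ∂μV‖) := by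
  choose c hc0 hc using fun i => exists_norm_le_sum_polar hℓ0 (hQ i)
  refine ⟨∑ i, c i, Finset.sum_nonneg fun i _ => hc0 i, fun i f x w => ?_⟩
  have hle : c i ≤ ∑ i, c i := Finset.single_le_sum (fun i _ => hc0 i) (Finset.mem_univ i)
  have hW : 0 < max 1 ‖w i‖ := lt_max_of_lt_left one_pos
  set T := ‖∫ u, (ψ (quadPhase Q x w u) : ℂ) * f u ∂μV‖ with hT
  rw [div_mul_eq_mul_div, div_le_iff₀ hW]
  calc ‖x i‖ * T
      ≤ c i * (∑ k, |ℓ (QuadraticMap.polar (Q i) (x i) (realBasisVec k))|) * T :=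
        mul_le_mul_of_nonneg_right (hc i _) (norm_nonneg _)
    _ = c i * ∑ k, |ℓ (QuadraticMap.polar (Q i) (x i) (realBasisVec k))| * T := by
        rw [mul_assoc, Finset.sum_mul]
    _ ≤ _ := by
        rw [mul_assoc]
        refine mul_le_mul hle ?_ (Finset.sum_nonneg fun k _ => by positivity)
          (Finset.sum_nonneg fun i _ => hc0 i)
        rw [Finset.sum_mul]
        refine Finset.sum_le_sum fun k _ => ?_
        rw [hT, ← Real.norm_eq_abs, ← Complex.norm_real, ← norm_mul,
          polar_mul_oscillatory_eq μV hψ hℓ]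
        refine (norm_sub_le _ _).trans ?_
        rw [add_mul]
        refine add_le_add ((norm_sub_le _ _).trans ?_) ?_
        · rw [add_mul, norm_mul, norm_mul, Complex.norm_I, one_mul, Complex.norm_real, mul_comm _ (max _ _),
            mul_comm _ (max _ _)]
          refine add_le_add (le_mul_of_one_le_left (norm_nonneg _) (le_max_left _ _))
            (mul_le_mul_of_nonneg_right (le_max_of_le_right ?_) (norm_nonneg _))
          exact RCLike.abs_re_le_norm _
        · rw [norm_mul, Complex.norm_real, mul_comm _ (max _ _)]
          refine mul_le_mul_of_nonneg_right (le_max_of_le_right ?_) (norm_nonneg _)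
          exact RCLike.abs_im_le_norm _

omit μV [μV.IsAddHaarMeasure] in
/-- The radius `max(1, |x|, |w|)` is at most the corresponding power of `max(1, ‖w‖) + ‖x‖`. -/
lemma one_le_radius_sq_mul (n : ℕ) (x : Fin n → F) (w : F) :
    1 ≤ ((max 1 (max (boxNorm x) (nabs w)) ^ (-((n : ℝ) / 2)) : ℝ≥0) : ℝ) ^ 2 *
      (max 1 ‖w‖ + ‖x‖) ^ Module.finrank ℝ (Fin n → F) := by
  set N : ℝ≥0 := max 1 ‖w‖₊ + ‖x‖₊ with hN
  have hNr : max 1 ‖w‖ + ‖x‖ = (N : ℝ) := by simp [hN]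
  have hN1 : 1 ≤ N := le_add_right (le_max_left _ _)
  have hle : max 1 (max (boxNorm x) (nabs w)) ≤ N ^ Module.finrank ℝ F := by
    rw [boxNorm_eq_nnnorm_pow, nabs_eq_nnnorm_pow]
    refine max_le (one_le_pow₀ hN1) (max_le ?_ ?_)
    · exact pow_le_pow_left₀ zero_le (le_add_left le_rfl) _
    · exact pow_le_pow_left₀ zero_le (le_add_right (le_max_right _ _)) _
  have h := rpow_neg_le_rpow_neg (le_max_left _ _) hle (s := (n : ℝ) / 2) (by positivity)
  rw [hNr, ← NNReal.coe_pow, ← NNReal.coe_pow, ← NNReal.coe_mul, NNReal.one_le_coe]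
  refine le_trans (le_of_eq ?_) (mul_le_mul_left (pow_le_pow_left₀ zero_le h 2) _)
  have hfin : Module.finrank ℝ (Fin n → F) = Module.finrank ℝ F * n := by
    rw [Module.finrank_pi_fintype]; simp [mul_comm]
  rw [← NNReal.rpow_natCast (_ ^ _) 2, ← NNReal.rpow_mul, hfin, pow_mul,
    show -((n : ℝ) / 2) * ((2 : ℕ) : ℝ) = -(n : ℝ) by push_cast; ring, NNReal.rpow_neg,
    NNReal.rpow_natCast, inv_mul_cancel₀]
  exact pow_ne_zero _ (pow_ne_zero _ (zero_lt_one.trans_le hN1).ne')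

/-- Comparing squares removes the square root, and `hRW` says that `R i ^ 2` is at least the square
of the decay available in block `i`. -/
lemma le_mul_prod_of_weighted {ι : Type*} [Fintype ι] {T C : ℝ} (hT : 0 ≤ T) {R W b : ι → ℝ}
    {n : ι → ℕ} (hW : ∀ i, 0 < W i) (hR : ∀ i, 0 ≤ R i)
    (hRW : ∀ i, 1 ≤ R i ^ 2 * (W i ^ n i * ((1 + b i) ^ n i) ^ 2))
    (h : (∏ i, (1 + b i) ^ n i) * T ≤ C * √(∏ i, (W i ^ n i)⁻¹))
    (hb : 0 ≤ (∏ i, (1 + b i) ^ n i)) :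
    T ≤ ‖C‖ * ∏ i, R i := by
  have hW' : 0 < ∏ i, W i ^ n i := Finset.prod_pos fun i _ => pow_pos (hW i) _
  rw [← pow_le_pow_iff_left₀ hT (mul_nonneg (norm_nonneg _) (Finset.prod_nonneg fun i _ => hR i))
    two_ne_zero]
  have h1 : 1 ≤ ∏ i, R i ^ 2 * (W i ^ n i * ((1 + b i) ^ n i) ^ 2) := by
    have := Finset.prod_le_prod (s := Finset.univ) (f := fun _ : ι => (1 : ℝ))
      (fun _ _ => zero_le_one) fun i _ => hRW i
    rwa [Finset.prod_const_one] at this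
  have h2 := pow_le_pow_left₀ (mul_nonneg hb hT) h 2
  rw [mul_pow C, Real.sq_sqrt (Finset.prod_nonneg fun i _ => inv_nonneg.2 (pow_pos (hW i) _).le),
    Finset.prod_inv_distrib] at h2
  rw [Finset.prod_mul_distrib, Finset.prod_mul_distrib, Finset.prod_pow, Finset.prod_pow] at h1
  calc T ^ 2 ≤ ((∏ i, R i) ^ 2 * ((∏ i, W i ^ n i) * (∏ i, (1 + b i) ^ n i) ^ 2)) * T ^ 2 :=
        le_mul_of_one_le_left (sq_nonneg _) h1
    _ = (∏ i, R i) ^ 2 * (∏ i, W i ^ n i) * ((∏ i, (1 + b i) ^ n i) * T) ^ 2 := by ring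
    _ ≤ (∏ i, R i) ^ 2 * (∏ i, W i ^ n i) * (C ^ 2 * (∏ i, W i ^ n i)⁻¹) :=
        mul_le_mul_of_nonneg_left h2 (mul_nonneg (sq_nonneg _) hW'.le)
    _ = _ := by
        rw [mul_pow, Real.norm_eq_abs, sq_abs]
        field_simp

/-- The bound in the quadratic coefficients starts an iteration that gains powers of `1 + ‖x i‖ /
max 1 ‖w i‖`, the substitute for the nonarchimedean vanishing. Together they control `max 1 ‖w i‖ +
‖x i‖`, whose power `finrank ℝ F` dominates the radius. -/
theorem hasOscillatoryDecay_of_arch (hψ : Continuous ψ) (hψ1 : ψ ≠ 1)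
    (hQ : ∀ i, (Q i).polarBilin.Nondegenerate) :
    ∃ C : 𝓢((i : Fin 3) → Fin (d i) → F, ℂ) → ℝ≥0, Continuous C ∧
      ∀ f : 𝓢((i : Fin 3) → Fin (d i) → F, ℂ), HasOscillatoryDecay μV ψ Q f (C f) := by
  obtain ⟨ℓ, hℓ⟩ := exists_addChar_eq_exp hψ
  have hℓ0 : ℓ ≠ 0 := by
    rintro rfl
    refine hψ1 (DFunLike.ext _ _ fun z => Circle.ext ?_)
    simp [hℓ]
  obtain ⟨c, hc0, hc⟩ := exists_weight_mul_oscillatory_le μV hψ hℓ hℓ0 hQ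
  set m := Module.finrank ℝ F with hm
  have hn : ∀ i, Module.finrank ℝ (Fin (d i) → F) = d i * m := fun i => by
    rw [Module.finrank_pi_fintype]; simp [hm]
  obtain ⟨C, hC, hCb⟩ := exists_weighted_bound_fin
    (S := 𝓢((i : Fin 3) → Fin (d i) → F, ℂ))
    (Θ := ((i : Fin 3) → Fin (d i) → F) × (Fin 3 → F))
    (K := fun i => (Fin (d i) × Bool) × Fin 3)
    (I := fun θ f => ‖∫ u, (ψ (quadPhase Q θ.1 θ.2 u) : ℂ) * f u ∂μV‖)
    (a := fun i θ => ‖θ.1 i‖ / max 1 ‖θ.2 i‖) (fun i θ => by positivity)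
    (exists_oscillatory_quadratic_decay μV hψ hℓ hℓ0 hQ)
    (D := fun i k f => ![blockDeriv i (realBasisVec k.1) f, polarMul ℓ Q i (realBasisVec k.1) f,
      polarMul ℓ Q i ((RCLike.I : F) • realBasisVec k.1) f] k.2)
    (fun i ⟨k, j⟩ => by
      fin_cases j
      · exact (blockDeriv i (realBasisVec k)).continuous
      · exact (polarMul ℓ Q i (realBasisVec k)).continuous
      · exact (polarMul ℓ Q i ((RCLike.I : F) • realBasisVec k)).continuous) hc0
    (fun i θ f => by
      rw [Fintype.sum_prod_type]
      simp only [Fin.sum_univ_three]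
      exact hc i f θ.1 θ.2) (fun i => d i * m)
  refine ⟨fun f => ‖C f‖₊, hC.nnnorm, fun f x w => ?_⟩
  have hb := hCb (x, w) f
  simp_rw [hn] at hb
  change ‖∫ u, (ψ (quadPhase Q x w u) : ℂ) * f u ∂μV‖₊ ≤ _
  rw [← NNReal.coe_le_coe, NNReal.coe_mul, NNReal.coe_prod, coe_nnnorm, coe_nnnorm]
  refine le_mul_prod_of_weighted (norm_nonneg _) (W := fun i => max 1 ‖w i‖)
    (fun i => lt_max_of_lt_left one_pos) (fun i => NNReal.coe_nonneg _) (fun i => ?_) hb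
    (Finset.prod_nonneg fun i _ => by positivity)
  have h1 := one_le_radius_sq_mul (d i) (x i) (w i)
  rw [hn] at h1
  have hW : 0 < max 1 ‖w i‖ := lt_max_of_lt_left one_pos
  have e : max 1 ‖w i‖ * (1 + ‖x i‖ / max 1 ‖w i‖) = max 1 ‖w i‖ + ‖x i‖ := by
    field_simp
  rw [← e, mul_pow] at h1
  refine h1.trans ?_
  -- One power of this factor already matches the radius; the square in `hRW` only helps.
  have h2 : (1 : ℝ) ≤ (1 + ‖x i‖ / max 1 ‖w i‖) ^ (d i * m) :=
    one_le_pow₀ (le_add_of_nonneg_right (by positivity))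
  gcongr
  exact le_self_pow₀ h2 two_ne_zero

end Archimedean

/-! ### Assembly of the two cases. -/

lemma ne_zero_of_mem_Yani {F : Type*} [Field F] {d : Fin 3 → ℕ}
    {Q : (i : Fin 3) → QuadraticForm F (Fin (d i) → F)} {ξ : (i : Fin 3) → Fin (d i) → F}
    (hξ : ξ ∈ Yani Q) (i : Fin 3) : ξ i ≠ 0 := by
  obtain ⟨h01, h12, h0⟩ := hξ
  intro hi
  fin_cases i
  · exact h0 (by simpa using congrArg (Q 0) hi)
  · exact h0 (h01.trans (by simpa using congrArg (Q 1) hi))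
  · exact h0 (h01.trans (h12.trans (by simpa using congrArg (Q 2) hi)))

end QuadraticTriple

theorem mainTheorem10 (d : Fin 3 → ℕ) (hd : ∀ i, 2 < d i) (hdeven : ∀ i, Even (d i))
    (ε : ℝ) (hε0 : 0 < ε) (hε : ε < 1 / 2) :
    -- nonarchimedean local fields of characteristic zero
    (∀ (F : Type*) [Field F] [ValuativeRel F] [TopologicalSpace F] [IsNonarchimedeanLocalField F]
      [CharZero F] [MeasurableSpace F] [BorelSpace F]
      (ϖ : 𝒪[F]) (_ : Irreducible ϖ)
      (μ : Measure F) [μ.IsAddHaarMeasure] (ν : Measure Fˣ) [ν.IsHaarMeasure]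
      (μV : Measure ((i : Fin 3) → Fin (d i) → F)) [μV.IsAddHaarMeasure]
      (ψ : AddChar F Circle) (_ : Continuous ψ) (_ : ψ ≠ 1)
      (Q : (i : Fin 3) → QuadraticForm F (Fin (d i) → F)) (_ : ∀ i, (Q i).polarBilin.Nondegenerate)
      (f : ((i : Fin 3) → Fin (d i) → F) → ℂ) (_ : IsLocallyConstant f) (_ : HasCompactSupport f),
      ∃ C : ℝ, 0 < C ∧ ∀ (b : F), ∀ ξ ∈ QuadraticTriple.Yani Q,
        QuadraticTriple.absIntegral μ ν μV ψ Q f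
            (fun i => QuadraticTriple.tildeNonarch (ϖ : F) (ξ i)) b ξ
          ≤ ENNReal.ofReal C * QuadraticTriple.decayBound ε b ξ)
    ∧
    -- archimedean local fields, with a constant depending continuously on the Schwartz function
    (∀ (F : Type*) [RCLike F]
      (μ : Measure F) [μ.IsAddHaarMeasure] (ν : Measure Fˣ) [ν.IsHaarMeasure]
      (μV : Measure ((i : Fin 3) → Fin (d i) → F)) [μV.IsAddHaarMeasure]
      (ψ : AddChar F Circle) (_ : Continuous ψ) (_ : ψ ≠ 1)
      (Q : (i : Fin 3) → QuadraticForm F (Fin (d i) → F)) (_ : ∀ i, (Q i).polarBilin.Nondegenerate),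
      ∃ C : 𝓢((i : Fin 3) → Fin (d i) → F, ℂ) → ℝ, Continuous C ∧ ∀ f, 0 < C f ∧
        ∀ (b : F), ∀ ξ ∈ QuadraticTriple.Yani Q,
          QuadraticTriple.absIntegral μ ν μV ψ Q f
              (fun i => QuadraticTriple.tildeArch (ξ i)) b ξ
            ≤ ENNReal.ofReal (C f) * QuadraticTriple.decayBound ε b ξ) := by
  constructor
  · intro F _ _ _ _ _ _ _ ϖ hϖ μ _ ν _ μV _ ψ hψ hψ1 Q hQ f hf hfc
    have := QuadraticTriple.t2Space_of_nonarch F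
    have := QuadraticTriple.secondCountableTopology_of_nonarch F
    obtain ⟨C₁, hC₁⟩ := (QuadraticTriple.isLocalModulus_of_nonarch F).absIntegral_le
      three_ne_zero μ ν hd hε0 hε
    obtain ⟨C₀, hC₀⟩ := QuadraticTriple.hasOscillatoryDecay_of_nonarch μV hψ hψ1 hQ hf hfc
    -- The added `1` only serves to make the constant positive.
    refine ⟨C₀ * C₁ + 1, by positivity, fun b ξ hξ => ?_⟩
    refine (hC₁ μV ψ Q f C₀ hC₀ _ b ξ (QuadraticTriple.ne_zero_of_mem_Yani hξ) fun i =>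
      QuadraticTriple.nabs_tildeNonarch hϖ (QuadraticTriple.ne_zero_of_mem_Yani hξ i)).trans ?_
    rw [← ENNReal.coe_mul, ← ENNReal.ofReal_coe_nnreal, NNReal.coe_mul]
    gcongr
    linarith
  · intro F _ μ _ ν _ μV _ ψ hψ hψ1 Q hQ
    obtain ⟨C₁, hC₁⟩ := (QuadraticTriple.isLocalModulus_of_arch F).absIntegral_le
      three_ne_zero μ ν hd hε0 hε
    obtain ⟨C₀, hC₀c, hC₀⟩ := QuadraticTriple.hasOscillatoryDecay_of_arch μV hψ hψ1 hQ
    refine ⟨fun f => C₀ f * C₁ + 1, by fun_prop, fun f => ⟨by positivity, fun b ξ hξ => ?_⟩⟩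
    refine (hC₁ μV ψ Q f (C₀ f) (hC₀ f) _ b ξ (QuadraticTriple.ne_zero_of_mem_Yani hξ) fun i =>
      QuadraticTriple.nabs_tildeArch (ξ i)).trans ?_
    rw [← ENNReal.coe_mul, ← ENNReal.ofReal_coe_nnreal, NNReal.coe_mul]
    gcongr
    linarith
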